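/- **Setting.** Let $m\ge 1$, $1\le q\le r$ be integers and $\mathcal X=[0,1]^r$. Let $\mathbb S_m$ be the Sobolev–Hilbert space of functions on $[0,1]$ with $f^{(m-1)}$ absolutely continuous and $f,f',\dots,f^{(m)}\in L_2[0,1]$, with inner product $$\langle f,g\rangle_{\mathbb S_m}=\sum_{k=0}^{m-1}\int_0^1 f^{(k)}(x)\,dx\int_0^1 g^{(k)}(y)\,dy+\int_0^1 f^{(m)}(x)g^{(m)}(x)\,dx ,$$ and let $\mathbb S_m^{(0)}=\{f\in\mathbb S_m:\int_0^1 f=0\}$. Let $\mathcal H_q$ be the Hilbert space of functions on $\mathcal X$ obtained by completing the span of the products $\prod_{s\in S}g_s(x_s)$, $S\subseteq\{1,\dots,r\}$, $|S|\le q$, $g_s\in\mathbb S_m^{(0)}$, under the inner product $\langle\cdot,\cdot\rangle_{\mathcal H_q}$ determined by $\langle\prod_{s=1}^r f_s(x_s),\prod_{s=1}^r g_s(x_s)\rangle_{\mathcal H_q}=\prod_{s=1}^r\langle f_s,g_s\rangle_{\mathbb S_m}$ (the factors with $s\notin S$ being the constant $1$). Let $f_0\in\mathcal H_q$ and $Y_i=f_0(\mathbf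 X_i)+\epsilon_i$, where the pairs $(\mathbf X_i,\epsilon_i)$, $i\ge1$, are i.i.d. copies of $(\mathbf X,\epsilon)$ with $\mathbf X\in\mathcal X$. For $\lambda=\lambda_n>0$ let $$\widehat f=\operatorname*{arg\,min}_{f\in\mathcal H_q}\Big\{\frac1{2n}\sum_{i=1}^n(Y_i-f(\mathbf X_i))^2+\frac\lambda2\|f\|_{\mathcal H_q}^2\Big\}.$$ Let $\beta=(\beta_1,\dots,\beta_r)\in\mathbb N^r$ have at most $q$ nonzero entries, and put $\beta_{\max}=\max_i\beta_i$, $N_{\max}=\#\{i:\beta_i=\beta_{\max}\}$. Let $\|\cdot\|_{\sup}$ be the supremum norm on $\mathcal X$. **Assumptions.** (1) $\mathbf X$ has a density $\pi$ on $\mathcal X$ with $C_\pi^{-1}\le\pi\le C_\pi$ for some $C_\pi\ge1$. The noise satisfies $\mathbb P(|\epsilon|>t)\le2\exp\{-t^2/(2\sigma^2)\}$ for some $\sigma>0$ and all $t>0$. Moreover, almost surely, $\mathbb E(\epsilon\mid\mathbf X)=0$, $\mathbb E(\epsilon^2\mid\mathbf X)\ge C_\sigma^{-1}$ and $\mathbb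 E(\epsilon^k\mid\mathbf X)\le C_\sigma^k$ for $k=1,2,3,4$, for some $C_\sigma>0$. (2) Let $\mathbb I_q$ be the set of $\mathbf i\in\{1,2,\dots\}^r$ with at most $q$ entries larger than $1$, and $\langle f,g\rangle_{L_2}=\int_{\mathcal X}fg\,\pi$. There are $\rho_{\mathbf i}>0$ and $\psi_{\mathbf i}\in\mathcal H_q$, $\mathbf i\in\mathbb I_q$, such that the $\psi_{\mathbf i}$ are orthonormal in $\langle\cdot,\cdot\rangle_{L_2}$, only the zero function of $\mathcal H_q$ is $L_2$-orthogonal to all of them, and $\langle\psi_{\mathbf i},f\rangle_{\mathcal H_q}=\langle\psi_{\mathbf i},f\rangle_{L_2}/\rho_{\mathbf i}$ for all $f\in\mathcal H_q$. They are labelled so that, for some constant $C$, $\prod_k i_k\le\prod_k j_k$ implies $\rho_{\mathbf j}\le C\rho_{\mathbf i}$ (as is the case, for instance, if $\rho_{\mathbf i}\asymp\prod_k i_k^{-2m}$). For some $C_\psi>0$ and all $\mathbf i\in\mathbb I_q$, $\|\psi_{\mathbf i}\|_{\sup}\le C_\psi$ and $\|\partial^{\beta}\psi_{\mathbf i}\|_{\sup}\le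 C_\psi\prod_k i_k^{\beta_k}$. **Corollary 1.** Suppose that (1) and (2) hold and $\beta_{\max}\le m-1$. If $n\lambda^{1/m}[\log n]^{2-2q}\to\infty$ and $\lambda\to0$ as $n\to\infty$, then $$\|\partial^{\beta}\widehat f-\partial^{\beta}f_0\|_{\sup}^2=O_P\Big(\lambda^{1-\frac{2\beta_{\max}+1}{2m}}[\log n]^{\min(N_{\max},q)-1}+n^{-1}\lambda^{-\frac{\beta_{\max}+1}{m}}[\log n]^{\min(N_{\max},q)+q-2}\Big).$$ As a consequence: (i) If $\lambda\asymp(n[\log n]^{1-q})^{-2m/(2m+1)}$, then $$\|\partial^{\beta}\widehat f-\partial^{\beta}f_0\|_{\sup}^2=O_P\Big(n^{-\frac{2m-2\beta_{\max}-1}{2m+1}}[\log n]^{\frac{(q-1)(2m-2\beta_{\max}-1)}{2m+1}+\min(N_{\max},q)-1}\Big).$$ (ii) If $\lambda\asymp n^{-\nu}$ with $0<\nu<m/(\beta_{\max}+1)$, then $\|\partial^{\beta}\widehat f-\partial^{\beta}f_0\|_{\sup}=o_P(1)$. -/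

import Mathlib

open MeasureTheory ProbabilityTheory Filter Set
open scoped Topology ENNReal

noncomputable section

namespace SSAnova

/-! ### The univariate Sobolev–Hilbert space on `[0,1]` -/

/-- The `k`-th derivative of a function on `[0,1]` (one-sided at the end points). -/
def der (k : ℕ) (f : ℝ → ℝ) : ℝ → ℝ := iteratedDerivWithin k f (Icc 0 1)

/-- The Sobolev–Hilbert space of order `m ≥ 1` on `[0,1]`: `f` is `m - 1` times continuously
differentiable, `f^(m-1)` is absolutely continuous, and `f, f', …, f^(m)` are square integrable.
Only the values of `f` on `[0,1]` matter. -/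
structure MemSobolev (m : ℕ) (f : ℝ → ℝ) : Prop where
  contDiffOn : ContDiffOn ℝ ((m - 1 : ℕ) : ℕ∞) f (Icc 0 1)
  absCont : AbsolutelyContinuousOnInterval (der (m - 1) f) 0 1
  memLp : ∀ k ≤ m, MemLp (der k f) 2 (volume.restrict (Icc 0 1))

/-- `∑_{k<m} (∫ f^(k)) (∫ g^(k)) + ∫ f^(m) g^(m)`. -/
def sobolevInner (m : ℕ) (f g : ℝ → ℝ) : ℝ :=
  ∑ k ∈ Finset.range m, (∫ x in Icc (0 : ℝ) 1, der k f x) * (∫ y in Icc (0 : ℝ) 1, der k g y)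
    + ∫ x in Icc (0 : ℝ) 1, der m f x * der m g x

/-- The orthogonal complement of the constants: Sobolev functions with integral zero. -/
def MemSobolevZero (m : ℕ) (f : ℝ → ℝ) : Prop :=
  MemSobolev m f ∧ ∫ x in Icc (0 : ℝ) 1, f x = 0

/-! ### The tensor product space with interactions of order at most `q` -/

/-- The cube `[0,1]^r`. -/
def cube (r : ℕ) : Set (Fin r → ℝ) := {x | ∀ s, x s ∈ Icc (0 : ℝ) 1}

/-- Elementary tensors `∏_{s ∈ S} g_s(x_s)` with `|S| ≤ q` and every `g_s` a Sobolev function of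
integral zero. The factors outside `S` are the constant `1`. -/
def ElemTensor (r m q : ℕ) : Type :=
  {a : Fin r → ℝ → ℝ // ∃ S : Finset (Fin r), S.card ≤ q ∧
    (∀ s ∈ S, MemSobolevZero m (a s)) ∧ ∀ s ∉ S, a s = fun _ => 1}

/-- Finite formal linear combinations of elementary tensors. -/
abbrev FormalSum (r m q : ℕ) : Type := ElemTensor r m q →₀ ℝ

/-- The function on the cube that a formal combination stands for. -/
def FormalSum.eval {r m q : ℕ} (c : FormalSum r m q) (x : Fin r → ℝ) : ℝ :=
  c.sum fun a α => α * ∏ s, a.1 s (x s)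

/-- The bilinear form with `⟨⊗ a_s, ⊗ b_s⟩ = ∏ ⟨a_s, b_s⟩`. -/
def FormalSum.inner {r m q : ℕ} (c d : FormalSum r m q) : ℝ :=
  c.sum fun a α => d.sum fun b γ => α * γ * ∏ s, sobolevInner m (a.1 s) (b.1 s)

/-- `c` is a Cauchy sequence for the tensor product norm and converges to `f` pointwise
on the cube. -/
def Represents {r m q : ℕ} (c : ℕ → FormalSum r m q) (f : (Fin r → ℝ) → ℝ) : Prop :=
  (∀ δ > 0, ∃ N, ∀ k ≥ N, ∀ l ≥ N, FormalSum.inner (c k - c l) (c k - c l) < δ) ∧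
    ∀ x ∈ cube r, Tendsto (fun k => (c k).eval x) atTop (𝓝 (f x))

/-- The space `H_q`: the completion, as a space of functions on the cube, of the span of the
elementary tensors. Only the values of `f` on the cube matter. -/
def MemH (r m q : ℕ) (f : (Fin r → ℝ) → ℝ) : Prop :=
  ∃ c : ℕ → FormalSum r m q, Represents c f

/-- `v` is the inner product of `f` and `g` in `H_q`: the limit of the inner products along
approximating Cauchy sequences. -/
def HasInnerH (r m q : ℕ) (f g : (Fin r → ℝ) → ℝ) (v : ℝ) : Prop :=
  ∃ c d : ℕ → FormalSum r m q, Represents c f ∧ Represents d g ∧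
    Tendsto (fun k => FormalSum.inner (c k) (d k)) atTop (𝓝 v)

open Classical in
/-- The inner product of `H_q`. For `f`, `g` in `H_q` the limit exists and does not depend on the
approximating sequences. -/
def innerH (r m q : ℕ) (f g : (Fin r → ℝ) → ℝ) : ℝ :=
  if h : ∃ v, HasInnerH r m q f g v then h.choose else 0

/-! ### Partial derivatives and norms on the cube -/

/-- The `k`-th partial derivative in the coordinate `s`, within the cube. -/
def partialDer {r : ℕ} (s : Fin r) (k : ℕ) (f : (Fin r → ℝ) → ℝ) : (Fin r → ℝ) → ℝ :=
  fun x => der k (fun t => f (Function.update x s t)) (x s)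

/-- The mixed partial derivative `∂^β f` within the cube. -/
def mixedDer {r : ℕ} (β : Fin r → ℕ) (f : (Fin r → ℝ) → ℝ) : (Fin r → ℝ) → ℝ :=
  (List.finRange r).foldr (fun s g => partialDer s (β s) g) f

/-- The supremum norm on the cube, with values in `[0,∞]`. -/
def supNorm {r : ℕ} (f : (Fin r → ℝ) → ℝ) : ℝ≥0∞ := ⨆ x ∈ cube r, ‖f x‖ₑ

/-- The `L₂` inner product with weight `dens` on the cube. -/
def innerL2 {r : ℕ} (dens : (Fin r → ℝ) → ℝ) (f g : (Fin r → ℝ) → ℝ) : ℝ :=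
  ∫ x in cube r, f x * g x * dens x

/-- `β_max`. -/
def betaMax {r : ℕ} (β : Fin r → ℕ) : ℕ := Finset.univ.sup β

/-- `N_max`, the number of coordinates at which `β_max` is attained. -/
def nMax {r : ℕ} (β : Fin r → ℕ) : ℕ := (Finset.univ.filter fun s => β s = betaMax β).card

/-! ### The kernel ridge regression estimator -/

/-- The penalized least squares criterion for the first `n` of the observations `(x i, y i)`. -/
def krrObjective (r m q n : ℕ) (lam : ℝ) (x : ℕ → Fin r → ℝ) (y : ℕ → ℝ)
    (f : (Fin r → ℝ) → ℝ) : ℝ :=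
  1 / (2 * (n : ℝ)) * ∑ i ∈ Finset.range n, (y i - f (x i)) ^ 2 + lam / 2 * innerH r m q f f

/-- `f` minimizes the penalized least squares criterion over `H_q`. -/
def IsKRR (r m q n : ℕ) (lam : ℝ) (x : ℕ → Fin r → ℝ) (y : ℕ → ℝ)
    (f : (Fin r → ℝ) → ℝ) : Prop :=
  MemH r m q f ∧
    ∀ g, MemH r m q g → krrObjective r m q n lam x y f ≤ krrObjective r m q n lam x y g

/-! ### Assumptions on the design, the noise and the eigenfunctions -/

/-- The pairs `(X i, ε i)` are i.i.d., and the covariates take values in the cube and have a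
density there that is bounded and bounded away from zero. -/
structure IsDesign {Ω : Type*} [MeasurableSpace Ω] (P : Measure Ω) (r : ℕ)
    (X : ℕ → Ω → Fin r → ℝ) (ε : ℕ → Ω → ℝ) (dens : (Fin r → ℝ) → ℝ) : Prop where
  measurable_X : ∀ i, Measurable (X i)
  measurable_noise : ∀ i, Measurable (ε i)
  indep : iIndepFun (fun i ω => (X i ω, ε i ω)) P
  identDistrib : ∀ i, IdentDistrib (fun ω => (X i ω, ε i ω)) (fun ω => (X 0 ω, ε 0 ω)) P P
  mem_cube : ∀ i ω, X i ω ∈ cube r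
  measurable_dens : Measurable dens
  map_eq : P.map (X 0) = (volume.restrict (cube r)).withDensity fun x => ENNReal.ofReal (dens x)
  dens_bounds : ∃ C : ℝ, 1 ≤ C ∧ ∀ x ∈ cube r, C⁻¹ ≤ dens x ∧ dens x ≤ C

/-- The noise `e` is sub-Gaussian, has conditional mean zero and conditional variance bounded away
from zero given `Z`, and its first four conditional moments are bounded. -/
structure IsNoise {Ω : Type*} [MeasurableSpace Ω] (P : Measure Ω) {r : ℕ}
    (Z : Ω → Fin r → ℝ) (e : Ω → ℝ) : Prop where
  subGaussian : ∃ σ : ℝ, 0 < σ ∧ ∀ t : ℝ, 0 < t →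
    P {ω | t < |e ω|} ≤ ENNReal.ofReal (2 * Real.exp (-t ^ 2 / (2 * σ ^ 2)))
  condMean : P[e | MeasurableSpace.comap Z inferInstance] =ᵐ[P] 0
  condMoments : ∃ C : ℝ, 0 < C ∧
    (∀ᵐ ω ∂P, C⁻¹ ≤ (P[fun ω => e ω ^ 2 | MeasurableSpace.comap Z inferInstance]) ω) ∧
    ∀ k ∈ Finset.Icc 1 4,
      ∀ᵐ ω ∂P, (P[fun ω => e ω ^ k | MeasurableSpace.comap Z inferInstance]) ω ≤ C ^ k

/-- The multi-indices of positive integers with at most `q` entries larger than `1`. -/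
def anovaIndex (r q : ℕ) : Set (Fin r → ℕ) :=
  {i | (∀ k, 1 ≤ i k) ∧ (Finset.univ.filter fun k => 1 < i k).card ≤ q}

/-- `(ρ i, ψ i)`, `i ∈ anovaIndex r q`, is the eigensystem of `H_q` with respect to the weighted
`L₂` inner product: `⟨ψ i, f⟩_H = ⟨ψ i, f⟩_{L₂} / ρ i` for every `f` in `H_q`, and the `ψ i` form an
orthonormal basis with respect to `L₂`. The field `ordered` says how the eigenpairs are labelled:
up to a constant factor, the eigenvalues decrease in the product `∏ i_k` of the entries of the
label (this is so, for instance, when `ρ i` is of the exact order `∏ i_k^(-2m)`). -/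
structure IsEigensystem (r m q : ℕ) (dens : (Fin r → ℝ) → ℝ)
    (ρ : (Fin r → ℕ) → ℝ) (ψ : (Fin r → ℕ) → (Fin r → ℝ) → ℝ) : Prop where
  pos : ∀ i ∈ anovaIndex r q, 0 < ρ i
  mem : ∀ i ∈ anovaIndex r q, MemH r m q (ψ i)
  orthonormal : ∀ i ∈ anovaIndex r q, ∀ j ∈ anovaIndex r q,
    innerL2 dens (ψ i) (ψ j) = if i = j then 1 else 0
  eigen : ∀ i ∈ anovaIndex r q, ∀ f, MemH r m q f →
    innerH r m q (ψ i) f = innerL2 dens (ψ i) f / ρ i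
  complete : ∀ f, MemH r m q f → (∀ i ∈ anovaIndex r q, innerL2 dens (ψ i) f = 0) →
    ∀ x ∈ cube r, f x = 0
  ordered : ∃ C : ℝ, ∀ i ∈ anovaIndex r q, ∀ j ∈ anovaIndex r q,
    ∏ k, i k ≤ ∏ k, j k → ρ j ≤ C * ρ i

/-- `|ψ i| ≤ C` and `|∂^β ψ i| ≤ C i^β` on the cube, uniformly in `i`. -/
def EigenfunctionBounds (r q : ℕ) (β : Fin r → ℕ) (ψ : (Fin r → ℕ) → (Fin r → ℝ) → ℝ) : Prop :=
  ∃ C : ℝ, 0 < C ∧ ∀ i ∈ anovaIndex r q, ∀ x ∈ cube r,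
    |ψ i x| ≤ C ∧ |mixedDer β (ψ i) x| ≤ C * ∏ k, (i k : ℝ) ^ β k

/-! ### Stochastic orders -/

/-- `Z_n = O_P(a_n)`, for nonnegative `Z_n`. -/
def IsBigOP {Ω : Type*} [MeasurableSpace Ω] (P : Measure Ω) (Z : ℕ → Ω → ℝ≥0∞) (a : ℕ → ℝ) :
    Prop :=
  ∀ δ : ℝ≥0∞, 0 < δ → ∃ C : ℝ, 0 < C ∧
    ∀ᶠ n in atTop, P {ω | ENNReal.ofReal (C * a n) < Z n ω} ≤ δ

/-- `Z_n = o_P(1)`, for nonnegative `Z_n`. -/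
def IsLittleOPOne {Ω : Type*} [MeasurableSpace Ω] (P : Measure Ω) (Z : ℕ → Ω → ℝ≥0∞) : Prop :=
  ∀ δ : ℝ, 0 < δ → Tendsto (fun n => P {ω | ENNReal.ofReal δ < Z n ω}) atTop (𝓝 0)

end SSAnova

end

open MeasureTheory ProbabilityTheory Filter Set
open scoped Topology ENNReal

noncomputable section

namespace SSAnova

/-! ### The real trigonometric system on `[0,1]` -/

/-! The estimator is analysed in the eigenbasis. Let d_i be the L₂ coefficients of the error δ =
fhat - f₀, put s_i = ρ_i / (ρ_i + lam), and measure δ by N² = ∑ d_i² / s_i = ‖δ‖²_{L₂} + lam ‖δ‖²_H.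
Comparing the criterion at fhat and at f₀ bounds the empirical norm of δ plus its penalty by a noise
average and a cross term with f₀. Weighted Cauchy–Schwarz bounds the noise average by N V^(1/2),
with V the `noiseTerm`, and the gap between empirical and population norm by N² times the root of
`gramTerm`. If `gramTerm` is small, then N² ≤ 16 (V + lam ‖f₀‖²), and a further Cauchy–Schwarz gives
|∂^β δ|² ≤ N² ∑ s_i |∂^β ψ_i|² (`sq_mixedDer_sub_le`).

Since the ψ_i are uniformly bounded, E V is of order n⁻¹ ∑ s_i and E `gramTerm` of order n⁻¹ (∑
s_i)², so Markov's inequality suffices. What remains are the sums ∑ s_i ∏ i_k^(2β_k). They live on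
hyperbolic crosses ∏ i_k ≲ lam^(-1/(2m)): the largest exponent fixes the power of lam, and every
further active coordinate attaining it adds a logarithm (`exists_tsum_cross_le`). For β = 0 the sum
is of order lam^(-1/(2m)) (log n)^(q-1) at most, and the growth condition on n lam^(1/m) says that
the resulting bound on `gramTerm` tends to zero. The product of the two factors is the rate
(`rate_eq`).

The decay ρ_i ≲ (∏ i_k)^(-2m) is not assumed, only an ordering of the labels. It follows from a
min–max dimension count (`exists_eigenvalue_le`) against an explicit tensor basis, made of Bernoulli
polynomials and iterated antiderivatives of the `cas` system, whose coefficient map is isometric on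
the Sobolev space. The same basis identifies H_q with a closed subspace of ℓ² (`memH_iff`,
`innerH_eq`) on which evaluation of a derivative of order below m in each variable is a bounded
functional (`mixedDer_eq_inner`). -/

/-- `cos + sin`. -/
def cas (θ : ℝ) : ℝ := Real.cos θ + Real.sin θ

lemma continuous_cas : Continuous cas := by unfold cas; fun_prop

lemma abs_cas_le (θ : ℝ) : |cas θ| ≤ 2 := by
  unfold cas
  exact (abs_add_le _ _).trans (by linarith [Real.abs_cos_le_one θ, Real.abs_sin_le_one θ])

/-- The term in `a + b` is a sine. For arguments shifted by `k` quarter periods its phase is a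
multiple of π, so it integrates to zero even at opposite frequencies. This is why one family indexed
by ℤ is orthonormal. -/
lemma cas_mul_cas (a b : ℝ) : cas a * cas b = Real.cos (a - b) + Real.sin (a + b) := by
  unfold cas; rw [Real.cos_sub, Real.sin_add]; ring

lemma setIntegral_Icc_eq (f : ℝ → ℝ) : ∫ x in Icc (0 : ℝ) 1, f x = ∫ x in (0 : ℝ)..1, f x := by
  rw [integral_Icc_eq_integral_Ioc, intervalIntegral.integral_of_le zero_le_one]

lemma integral_cos_affine (z : ℤ) (a : ℝ) :
    ∫ x in (0 : ℝ)..1, Real.cos (2 * Real.pi * z * x + a) = if z = 0 then Real.cos a else 0 := by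
  split_ifs with h
  · simp [h]
  · have hc : (2 * Real.pi * z) ≠ 0 := by positivity
    rw [intervalIntegral.integral_comp_mul_add (fun y => Real.cos y) hc, integral_cos]
    have : Real.sin (2 * Real.pi * z * 1 + a) = Real.sin (2 * Real.pi * z * 0 + a) := by
      rw [mul_one, mul_zero, zero_add, add_comm, show 2 * Real.pi * z = z * (2 * Real.pi) by ring,
        Real.sin_add_int_mul_two_pi]
    rw [this]; simp

lemma integral_sin_affine (z : ℤ) (a : ℝ) :
    ∫ x in (0 : ℝ)..1, Real.sin (2 * Real.pi * z * x + a) = if z = 0 then Real.sin a else 0 := by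
  have := integral_cos_affine z (a - Real.pi / 2)
  simp only [← add_sub_assoc, Real.cos_sub_pi_div_two] at this
  exact this

lemma integral_cas_mul_cas (k : ℕ) (z w : ℤ) :
    ∫ x in (0 : ℝ)..1, cas (2 * Real.pi * z * x - k * (Real.pi / 2)) *
      cas (2 * Real.pi * w * x - k * (Real.pi / 2)) = if z = w then 1 else 0 := by
  have h1 : ∀ x : ℝ, cas (2 * Real.pi * z * x - k * (Real.pi / 2)) *
      cas (2 * Real.pi * w * x - k * (Real.pi / 2)) =
      Real.cos (2 * Real.pi * ((z - w : ℤ) : ℝ) * x + 0) +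
      Real.sin (2 * Real.pi * ((z + w : ℤ) : ℝ) * x + (-(k * Real.pi))) := by
    intro x
    rw [cas_mul_cas]; push_cast; congr 2 <;> ring
  simp_rw [h1]
  rw [intervalIntegral.integral_add (by apply Continuous.intervalIntegrable; fun_prop)
    (by apply Continuous.intervalIntegrable; fun_prop), integral_cos_affine, integral_sin_affine]
  simp [sub_eq_zero]

lemma integral_cas (k : ℕ) (z : ℤ) (hz : z ≠ 0) :
    ∫ x in (0 : ℝ)..1, cas (2 * Real.pi * z * x - k * (Real.pi / 2)) = 0 := by
  unfold cas
  simp only [sub_eq_add_neg]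
  rw [intervalIntegral.integral_add (by apply Continuous.intervalIntegrable; fun_prop)
    (by apply Continuous.intervalIntegrable; fun_prop), integral_cos_affine, integral_sin_affine]
  simp [hz]

/-- The coefficients of `h` in the real trigonometric system. -/
def casCoeff (h : ℝ → ℝ) (z : ℤ) : ℝ := ∫ x in Icc (0 : ℝ) 1, h x * cas (2 * Real.pi * z * x)

instance isFiniteMeasure_unitInterval :
    IsFiniteMeasure (volume.restrict (Icc (0 : ℝ) 1)) := ⟨by simp⟩

lemma integrable_mul_of_continuous {h g : ℝ → ℝ}
    (hh : MemLp h 2 (volume.restrict (Icc (0 : ℝ) 1))) (hg : Continuous g) :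
    IntegrableOn (fun x => h x * g x) (Icc 0 1) := by
  have h1 : IntegrableOn h (Icc 0 1) := hh.integrable (by norm_num)
  exact h1.mul_continuousOn hg.continuousOn isCompact_Icc

lemma fourierCoeffOn_ofReal {h : ℝ → ℝ} (hh : MemLp h 2 (volume.restrict (Icc (0 : ℝ) 1)))
    (z : ℤ) :
    fourierCoeffOn (zero_lt_one (α := ℝ)) (fun x => (h x : ℂ)) z =
      ((∫ x in Icc (0 : ℝ) 1, h x * Real.cos (2 * Real.pi * z * x) : ℝ) : ℂ) -
        ((∫ x in Icc (0 : ℝ) 1, h x * Real.sin (2 * Real.pi * z * x) : ℝ) : ℂ) * Complex.I := by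
  rw [fourierCoeffOn_eq_integral, intervalIntegral.integral_of_le zero_le_one,
    ← integral_Icc_eq_integral_Ioc, ← integral_complex_ofReal, ← integral_complex_ofReal,
    ← integral_mul_const, ← integral_sub]
  · simp only [sub_zero, div_one, one_smul]
    refine integral_congr_ae (Eventually.of_forall fun x => ?_)
    simp only [smul_eq_mul, fourier_coe_apply, Complex.ofReal_mul]
    rw [show (2 * (Real.pi : ℂ) * Complex.I * ((-z : ℤ) : ℂ) * (x : ℂ) / ((1 - 0 : ℝ) : ℂ)) =
      (((-(2 * Real.pi * z * x) : ℝ)) : ℂ) * Complex.I by push_cast; ring, Complex.exp_mul_I,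
      ← Complex.ofReal_cos, ← Complex.ofReal_sin, Real.cos_neg, Real.sin_neg]
    push_cast; ring
  · exact (integrable_mul_of_continuous hh (g := fun x => Real.cos (2 * Real.pi * z * x))
      (by fun_prop)).ofReal
  · exact ((integrable_mul_of_continuous hh (g := fun x => Real.sin (2 * Real.pi * z * x))
      (by fun_prop)).ofReal).mul_const _

/-- Parseval's identity for the real trigonometric system. -/
lemma hasSum_sq_casCoeff {h : ℝ → ℝ} (hh : MemLp h 2 (volume.restrict (Icc (0 : ℝ) 1))) :
    HasSum (fun z => casCoeff h z ^ 2) (∫ x in Icc (0 : ℝ) 1, h x ^ 2) := by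
  set A : ℤ → ℝ := fun z => ∫ x in Icc (0 : ℝ) 1, h x * Real.cos (2 * Real.pi * z * x) with hA
  set B : ℤ → ℝ := fun z => ∫ x in Icc (0 : ℝ) 1, h x * Real.sin (2 * Real.pi * z * x) with hB
  have hh' : MemLp (fun x => (h x : ℂ)) 2 (volume.restrict (Ioc (0 : ℝ) 1)) := by
    rw [← Measure.restrict_congr_set (Ioc_ae_eq_Icc (μ := volume) (a := (0 : ℝ)) (b := 1)).symm]
    exact hh.ofReal
  have key := hasSum_sq_fourierCoeffOn (zero_lt_one (α := ℝ)) hh'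
  have h1 : HasSum (fun z => A z ^ 2 + B z ^ 2) (∫ x in Icc (0 : ℝ) 1, h x ^ 2) := by
    convert key using 1
    · ext z
      rw [fourierCoeffOn_ofReal hh, ← Complex.normSq_eq_norm_sq, Complex.normSq_apply]
      simp [A, B]; ring
    · rw [setIntegral_Icc_eq]
      simp
  have hs : Summable fun z => A z * B z := by
    refine Summable.of_norm_bounded h1.summable fun z => ?_
    rw [Real.norm_eq_abs, abs_mul]
    nlinarith [sq_nonneg (|A z| - |B z|), sq_abs (A z), sq_abs (B z), sq_nonneg (A z),
      sq_nonneg (B z)]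
  -- The square of `A z + B z` exceeds the Fourier term by `2 * A z * B z`. Cosine coefficients are
  -- even and sine coefficients odd in `z`, so these cross terms cancel between `z` and `-z`.
  have hodd : ∀ z, A (-z) * B (-z) = -(A z * B z) := by
    intro z
    have e1 : A (-z) = A z := by simp [hA]
    have e2 : B (-z) = -B z := by
      simp only [hB]
      rw [← integral_neg]
      congr 1; ext x; simp
    rw [e1, e2]; ring
  have h0 : ∑' z, A z * B z = 0 := by
    have := (Equiv.neg ℤ).tsum_eq (fun z => A z * B z)
    simp only [Equiv.neg_apply, hodd, tsum_neg] at this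
    linarith
  have h2 : HasSum (fun z => A z * B z) 0 := h0 ▸ hs.hasSum
  have h3 := h1.add (h2.mul_left 2)
  rw [mul_zero, add_zero] at h3
  convert h3 using 1
  ext z
  have : casCoeff h z = A z + B z := by
    simp only [casCoeff, hA, hB, cas, mul_add]
    exact integral_add (integrable_mul_of_continuous hh (by fun_prop))
      (integrable_mul_of_continuous hh (by fun_prop))
  rw [this]; ring

lemma casCoeff_add {h k : ℝ → ℝ} (hh : MemLp h 2 (volume.restrict (Icc (0 : ℝ) 1)))
    (hk : MemLp k 2 (volume.restrict (Icc (0 : ℝ) 1))) (z : ℤ) :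
    casCoeff (fun x => h x + k x) z = casCoeff h z + casCoeff k z := by
  have hc : Continuous fun x : ℝ => cas (2 * Real.pi * z * x) :=
    continuous_cas.comp (by fun_prop)
  simp only [casCoeff, add_mul]
  exact integral_add (integrable_mul_of_continuous hh hc) (integrable_mul_of_continuous hk hc)

/-- The polarized form of Parseval's identity. -/
lemma hasSum_casCoeff_mul {h k : ℝ → ℝ} (hh : MemLp h 2 (volume.restrict (Icc (0 : ℝ) 1)))
    (hk : MemLp k 2 (volume.restrict (Icc (0 : ℝ) 1))) :
    HasSum (fun z => casCoeff h z * casCoeff k z) (∫ x in Icc (0 : ℝ) 1, h x * k x) := by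
  have h1 := hasSum_sq_casCoeff (hh.add hk)
  have h2 := ((h1.sub (hasSum_sq_casCoeff hh)).sub (hasSum_sq_casCoeff hk)).mul_left (1 / 2)
  convert! h2 using 1
  · ext z
    rw [show (h + k) = fun x => h x + k x from rfl, casCoeff_add hh hk]; ring
  · have e : ∀ x, (h + k) x ^ 2 = (h x ^ 2 + k x ^ 2) + 2 * (h x * k x) := by
      intro x; simp only [Pi.add_apply]; ring
    simp_rw [e]
    have i1 : Integrable (fun x => h x ^ 2) (volume.restrict (Icc (0 : ℝ) 1)) := hh.integrable_sq
    have i2 : Integrable (fun x => k x ^ 2) (volume.restrict (Icc (0 : ℝ) 1)) := hk.integrable_sq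
    have i3 : Integrable (fun x => 2 * (h x * k x)) (volume.restrict (Icc (0 : ℝ) 1)) :=
      (hh.integrable_mul hk).const_mul 2
    have i4 : Integrable (fun x => h x ^ 2 + k x ^ 2) (volume.restrict (Icc (0 : ℝ) 1)) :=
      i1.add i2
    rw [integral_add i4 i3, integral_add i1 i2, integral_const_mul]
    ring

/-! ### Iterated antiderivatives -/

/-- The `k`-fold antiderivative of `cas (2πz·)` all of whose derivatives have mean zero. -/
def trigAnti (k : ℕ) (z : ℤ) (x : ℝ) : ℝ :=
  (2 * Real.pi * z)⁻¹ ^ k * cas (2 * Real.pi * z * x - k * (Real.pi / 2))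

/-- The Bernoulli polynomial divided by `k!`. -/
def bern (k : ℕ) (x : ℝ) : ℝ := bernoulliFun k x / (k.factorial : ℝ)

lemma continuous_trigAnti (k : ℕ) (z : ℤ) : Continuous (trigAnti k z) := by
  unfold trigAnti
  exact continuous_const.mul (continuous_cas.comp (by fun_prop))

lemma continuous_bern (k : ℕ) : Continuous (bern k) :=
  (continuous_bernoulliFun (k := k)).div_const _

lemma hasDerivAt_bern (k : ℕ) (x : ℝ) : HasDerivAt (bern (k + 1)) (bern k x) x := by
  have := (hasDerivAt_bernoulliFun (k + 1) x).div_const ((k + 1).factorial : ℝ)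
  convert! this using 1
  simp only [bern, Nat.add_sub_cancel, Nat.factorial_succ]
  push_cast
  field_simp

lemma hasDerivAt_bern_zero (x : ℝ) : HasDerivAt (bern 0) 0 x := by
  have : bern 0 = fun _ => 1 := by ext x; simp [bern]
  rw [this]; exact hasDerivAt_const _ _

lemma integral_bern (k : ℕ) : ∫ x in (0 : ℝ)..1, bern k x = if k = 0 then 1 else 0 := by
  unfold bern
  rw [intervalIntegral.integral_div, integral_bernoulliFun]
  split_ifs with h <;> simp [h]

lemma hasDerivAt_trigAnti (k : ℕ) {z : ℤ} (hz : z ≠ 0) (x : ℝ) :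
    HasDerivAt (trigAnti (k + 1) z) (trigAnti k z x) x := by
  have hc : (2 * Real.pi * z : ℝ) ≠ 0 := by positivity
  have h1 : HasDerivAt (fun x : ℝ => 2 * Real.pi * z * x - ((k + 1 : ℕ) : ℝ) * (Real.pi / 2))
      (2 * Real.pi * z) x := by
    simpa using ((hasDerivAt_id x).const_mul (2 * Real.pi * (z : ℝ))).sub_const
      (((k + 1 : ℕ) : ℝ) * (Real.pi / 2))
  have h2 := ((h1.cos.add h1.sin).const_mul ((2 * Real.pi * (z : ℝ))⁻¹ ^ (k + 1)))
  convert! h2 using 1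
  simp only [trigAnti, cas]
  have e : 2 * Real.pi * z * x - ((k + 1 : ℕ) : ℝ) * (Real.pi / 2) =
      (2 * Real.pi * z * x - k * (Real.pi / 2)) - Real.pi / 2 := by push_cast; ring
  rw [e, Real.sin_sub_pi_div_two, Real.cos_sub_pi_div_two, pow_succ]
  field_simp

lemma integral_trigAnti (k : ℕ) {z : ℤ} (hz : z ≠ 0) :
    ∫ x in (0 : ℝ)..1, trigAnti k z x = 0 := by
  unfold trigAnti
  rw [intervalIntegral.integral_const_mul, integral_cas k z hz, mul_zero]

lemma abs_trigAnti_le (k : ℕ) (z : ℤ) (x : ℝ) :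
    |trigAnti k z x| ≤ 2 * |(2 * Real.pi * z)⁻¹| ^ k := by
  unfold trigAnti
  rw [abs_mul, abs_pow, mul_comm]
  exact mul_le_mul_of_nonneg_right (abs_cas_le _) (by positivity)

lemma trigAnti_zero (z : ℤ) (x : ℝ) : trigAnti 0 z x = cas (2 * Real.pi * z * x) := by
  simp [trigAnti]

lemma integral_trigAnti_mul (k : ℕ) (z w : ℤ) :
    ∫ x in (0 : ℝ)..1, trigAnti k z x * trigAnti k w x =
      if z = w then ((2 * Real.pi * z)⁻¹ ^ k) ^ 2 else 0 := by
  have : ∀ x, trigAnti k z x * trigAnti k w x =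
      ((2 * Real.pi * z)⁻¹ ^ k * (2 * Real.pi * w)⁻¹ ^ k) *
      (cas (2 * Real.pi * z * x - k * (Real.pi / 2)) *
      cas (2 * Real.pi * w * x - k * (Real.pi / 2))) := by
    intro x; unfold trigAnti; ring
  simp_rw [this]
  rw [intervalIntegral.integral_const_mul, integral_cas_mul_cas]
  split_ifs with h
  · subst h; ring
  · simp

/-! ### An orthonormal basis of the univariate Sobolev space -/

/-- An enumeration of the integers. -/
def freq (n : ℕ) : ℤ := Equiv.intEquivNat.symm n

lemma intEquivNat_le (z : ℤ) : Equiv.intEquivNat z ≤ 2 * z.natAbs := by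
  cases z with
  | ofNat n => exact le_of_eq rfl
  | negSucc n =>
    change 2 * n + 1 ≤ 2 * (n + 1)
    omega

/-- The enumeration is 0, -1, 1, -2, 2, …, so decay in the frequency is decay in the index. -/
lemma le_two_mul_natAbs_freq (n : ℕ) : n ≤ 2 * (freq n).natAbs := by
  simpa [freq] using intEquivNat_le (Equiv.intEquivNat.symm n)

lemma freq_zero : freq 0 = 0 := by
  rw [freq, Equiv.symm_apply_eq]; rfl

lemma freq_injective : Function.Injective freq := Equiv.intEquivNat.symm.injective

lemma freq_ne_zero {n : ℕ} (hn : n ≠ 0) : freq n ≠ 0 := by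
  rw [← freq_zero]; exact fun h => hn (freq_injective h)

lemma abs_inv_freq_le {n : ℕ} (hn : n ≠ 0) :
    |(2 * Real.pi * (freq n : ℝ))⁻¹| ≤ (n : ℝ)⁻¹ := by
  have h1 : (n : ℝ) ≤ 2 * |(freq n : ℝ)| := by
    have := le_two_mul_natAbs_freq n
    have h2 : (((freq n).natAbs : ℕ) : ℝ) = |(freq n : ℝ)| := by
      rw [Nat.cast_natAbs, Int.cast_abs]
    rw [← h2]; exact_mod_cast this
  have hn' : (0 : ℝ) < n := by exact_mod_cast Nat.pos_of_ne_zero hn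
  rw [abs_inv]
  apply inv_anti₀ hn'
  rw [abs_mul, abs_mul, abs_of_pos Real.pi_pos, abs_of_pos (by norm_num : (0 : ℝ) < 2)]
  nlinarith [Real.pi_gt_three, abs_nonneg (freq n : ℝ)]

/-- The `l`-th derivative of the `j`-th function of the basis of the Sobolev space of order `m`:
Bernoulli polynomials for `j ≤ m`, followed by trigonometric functions. -/
def basisDer (m l j : ℕ) (x : ℝ) : ℝ :=
  if j ≤ m then (if l ≤ j then bern (j - l) x else 0) else trigAnti (m - l) (freq (j - m)) x

lemma continuous_basisDer (m l j : ℕ) : Continuous (basisDer m l j) := by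
  unfold basisDer
  split_ifs
  · exact continuous_bern _
  · exact continuous_const
  · exact continuous_trigAnti _ _

lemma hasDerivAt_basisDer {m l : ℕ} (hl : l < m) (j : ℕ) (x : ℝ) :
    HasDerivAt (basisDer m l j) (basisDer m (l + 1) j x) x := by
  unfold basisDer
  split_ifs with h1 h2 h3 h3
  · have := hasDerivAt_bern (j - (l + 1)) x
    rwa [show j - (l + 1) + 1 = j - l by omega] at this
  · rw [show j - l = 0 by omega]; exact hasDerivAt_bern_zero x
  · omega
  · exact hasDerivAt_const _ _
  · have := hasDerivAt_trigAnti (m - (l + 1)) (freq_ne_zero (show j - m ≠ 0 by omega)) x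
    rwa [show m - (l + 1) + 1 = m - l by omega] at this

/-- The first `m` coefficient functionals of the Sobolev space are the means of the derivatives of
order below `m`, so this is their biorthogonality to the basis. The derivatives of order `m` of the
functions with `j ≥ m` form the `cas` system itself. -/
lemma integral_basisDer {m l : ℕ} (hl : l < m) (j : ℕ) :
    ∫ x in (0 : ℝ)..1, basisDer m l j x = if j = l then 1 else 0 := by
  unfold basisDer
  split_ifs with h1 h2 h3 h3 h3
  · rw [integral_bern, if_pos (by omega)]
  · rw [integral_bern, if_neg (by omega)]
  · omega
  · simp
  · omega
  · exact integral_trigAnti _ (freq_ne_zero (by omega))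

/-- The interval exceeds `[0,1]` so that series can be differentiated on an open interval containing
both end points. -/
lemma exists_abs_bern_le (m : ℕ) :
    ∃ B : ℝ, 0 < B ∧ ∀ k ≤ m, ∀ y ∈ Icc (-1 : ℝ) 2, |bern k y| ≤ B := by
  have h : ∀ k, ∃ B : ℝ, ∀ y ∈ Icc (-1 : ℝ) 2, |bern k y| ≤ B := fun k =>
    isCompact_Icc.exists_bound_of_continuousOn (continuous_bern k).continuousOn
  choose B hB using h
  refine ⟨1 + ∑ k ∈ Finset.range (m + 1), |B k|, by positivity, fun k hk y hy => ?_⟩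
  have h1 : |B k| ≤ ∑ k ∈ Finset.range (m + 1), |B k| :=
    Finset.single_le_sum (f := fun k => |B k|) (fun _ _ => abs_nonneg _)
      (Finset.mem_range.2 (by omega))
  linarith [hB k y hy, le_abs_self (B k)]

/-- The size of the basis functions and their derivatives. -/
lemma exists_abs_basisDer_le (m : ℕ) : ∃ C : ℝ, 1 ≤ C ∧ ∀ l ≤ m, ∀ j, ∀ y ∈ Icc (-1 : ℝ) 2,
    |basisDer m l j y| ≤ C * ((j : ℝ) + 1)⁻¹ ^ (m - l) := by
  obtain ⟨B, hB, hBb⟩ := exists_abs_bern_le m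
  refine ⟨(1 + B + 2) * ((m : ℝ) + 2) ^ m, ?_, fun l hl j y hy => ?_⟩
  · have : (1 : ℝ) ≤ ((m : ℝ) + 2) ^ m := one_le_pow₀ (by linarith [(Nat.cast_nonneg m : (0:ℝ) ≤ m)])
    nlinarith
  have hm0 : (0 : ℝ) ≤ m := Nat.cast_nonneg m
  have hpow : ((m : ℝ) + 2) ^ (m - l) ≤ ((m : ℝ) + 2) ^ m :=
    pow_le_pow_right₀ (by linarith) (Nat.sub_le _ _)
  have hj0 : (0 : ℝ) < (j : ℝ) + 1 := by positivity
  suffices h : |basisDer m l j y| ≤ (1 + B + 2) * (((m : ℝ) + 2) * ((j : ℝ) + 1)⁻¹) ^ (m - l) by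
    refine h.trans ?_
    rw [mul_pow, ← mul_assoc]
    gcongr
  unfold basisDer
  -- The finitely many Bernoulli indices are absorbed by the constant: for them the decay factor,
  -- enlarged by a power of `m + 2`, is at least one.
  have hone : j ≤ m → (1 : ℝ) ≤ (((m : ℝ) + 2) * ((j : ℝ) + 1)⁻¹) ^ (m - l) := by
    intro hjm
    apply one_le_pow₀
    rw [← div_eq_mul_inv, le_div_iff₀ hj0]
    have : (j : ℝ) ≤ m := by exact_mod_cast hjm
    linarith
  split_ifs with h1 h2
  · have := hBb (j - l) (by omega) y hy
    nlinarith [hone h1]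
  · rw [abs_zero]; positivity
  · refine (abs_trigAnti_le _ _ _).trans ?_
    have hn : j - m ≠ 0 := by omega
    have hn1 : (1 : ℝ) ≤ ((j - m : ℕ) : ℝ) := by exact_mod_cast Nat.one_le_iff_ne_zero.2 hn
    have hjm : (j : ℝ) = m + ((j - m : ℕ) : ℝ) := by
      rw [← Nat.cast_add]; congr 1; omega
    have h3 : |(2 * Real.pi * (freq (j - m) : ℝ))⁻¹| ≤ ((m : ℝ) + 2) * ((j : ℝ) + 1)⁻¹ := by
      refine (abs_inv_freq_le hn).trans ?_
      rw [← div_eq_mul_inv, le_div_iff₀ hj0, inv_mul_le_iff₀ (by linarith)]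
      nlinarith
    have h4 := pow_le_pow_left₀ (abs_nonneg _) h3 (m - l)
    have h5 : (0 : ℝ) ≤ (((m : ℝ) + 2) * ((j : ℝ) + 1)⁻¹) ^ (m - l) := by positivity
    nlinarith

/-- Below order `m` at least one power of `j + 1` is left, which is square summable. Point
evaluation of such derivatives is therefore bounded on ℓ². -/
lemma exists_abs_basisDer_le_inv (m : ℕ) : ∃ C : ℝ, 1 ≤ C ∧ ∀ l < m, ∀ j, ∀ y ∈ Icc (-1 : ℝ) 2,
    |basisDer m l j y| ≤ C * ((j : ℝ) + 1)⁻¹ := by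
  obtain ⟨C, hC, h⟩ := exists_abs_basisDer_le m
  refine ⟨C, hC, fun l hl j y hy => (h l hl.le j y hy).trans ?_⟩
  have h1 : ((j : ℝ) + 1)⁻¹ ≤ 1 := inv_le_one_of_one_le₀ (by linarith [(Nat.cast_nonneg j : (0:ℝ) ≤ j)])
  gcongr
  exact pow_le_of_le_one (by positivity) h1 (by omega)

lemma summable_sq_inv_succ (C : ℝ) : Summable fun j : ℕ => (C * ((j : ℝ) + 1)⁻¹) ^ 2 := by
  have h := (summable_nat_add_iff 1).2 (Real.summable_one_div_nat_pow.2 (by norm_num : 1 < 2))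
  convert! h.mul_left (C ^ 2) using 1
  ext j
  push_cast
  field_simp

lemma summable_mul_of_sq {ι : Type*} {a b : ι → ℝ} (ha : Summable fun j => a j ^ 2)
    (hb : Summable fun j => b j ^ 2) : Summable fun j => |a j| * |b j| := by
  refine Summable.of_nonneg_of_le (fun j => by positivity) (fun j => ?_) (ha.add hb)
  nlinarith [sq_nonneg (|a j| - |b j|), sq_abs (a j), sq_abs (b j), sq_nonneg (a j),
    sq_nonneg (b j)]

/-- The `l`-th derivative of `∑ b j g j`. -/
def seriesDer (m : ℕ) (b : ℕ → ℝ) (l : ℕ) (x : ℝ) : ℝ := ∑' j, b j * basisDer m l j x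

section Series

variable {m : ℕ} {b : ℕ → ℝ}

/-- The majorant is a product of two square summable sequences, uniform in the order and the point.
It justifies every termwise operation on `seriesDer`. -/
lemma exists_seriesDer_bound (hb : Summable fun j => b j ^ 2) : ∃ u : ℕ → ℝ, Summable u ∧
    ∀ l < m, ∀ j, ∀ y ∈ Icc (-1 : ℝ) 2, ‖b j * basisDer m l j y‖ ≤ u j := by
  obtain ⟨C, hC, h⟩ := exists_abs_basisDer_le_inv m
  refine ⟨_, summable_mul_of_sq hb (summable_sq_inv_succ C), fun l hl j y hy => ?_⟩
  rw [norm_mul, Real.norm_eq_abs, Real.norm_eq_abs]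
  exact mul_le_mul_of_nonneg_left ((h l hl j y hy).trans (le_abs_self _)) (abs_nonneg _)

lemma summable_series (hb : Summable fun j => b j ^ 2) {l : ℕ} (hl : l < m) {y : ℝ}
    (hy : y ∈ Icc (-1 : ℝ) 2) : Summable fun j => b j * basisDer m l j y := by
  obtain ⟨u, hu, h⟩ := exists_seriesDer_bound (m := m) hb
  exact Summable.of_norm_bounded hu fun j => h l hl j y hy

lemma hasDerivAt_seriesDer (hb : Summable fun j => b j ^ 2) {l : ℕ} (hl : l + 1 < m) {y : ℝ}
    (hy : y ∈ Ioo (-1 : ℝ) 2) : HasDerivAt (seriesDer m b l) (seriesDer m b (l + 1) y) y := by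
  obtain ⟨u, hu, h⟩ := exists_seriesDer_bound (m := m) hb
  exact hasDerivAt_tsum_of_isPreconnected hu isOpen_Ioo isPreconnected_Ioo
    (fun j y _ => (hasDerivAt_basisDer (by omega) j y).const_mul (b j))
    (fun j y hy => h (l + 1) hl j y (Ioo_subset_Icc_self hy)) hy
    (summable_series hb (by omega) (Ioo_subset_Icc_self hy)) hy

lemma hasSum_integral_seriesDer_mul (hb : Summable fun j => b j ^ 2) {l : ℕ} (hl : l < m)
    {φ : ℝ → ℝ} (hφ : Continuous φ) :
    HasSum (fun j => b j * ∫ x in Icc (0 : ℝ) 1, basisDer m l j x * φ x)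
      (∫ x in Icc (0 : ℝ) 1, seriesDer m b l x * φ x) := by
  obtain ⟨u, hu, h⟩ := exists_seriesDer_bound (m := m) hb
  obtain ⟨D, hD⟩ := isCompact_Icc.exists_bound_of_continuousOn
    (hφ.continuousOn (s := Icc (0 : ℝ) 1))
  have hsub : Icc (0 : ℝ) 1 ⊆ Icc (-1 : ℝ) 2 := Icc_subset_Icc (by norm_num) (by norm_num)
  have hInt : ∀ j, Integrable (fun x => b j * (basisDer m l j x * φ x))
      (volume.restrict (Icc (0 : ℝ) 1)) := fun j =>
    (((continuous_basisDer m l j).mul hφ).continuousOn.integrableOn_compact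
      isCompact_Icc).const_mul _
  have hn : ∀ j, ∀ x ∈ Icc (0 : ℝ) 1, ‖b j * (basisDer m l j x * φ x)‖ ≤ u j * D := by
    intro j x hx
    rw [← mul_assoc, norm_mul]
    exact mul_le_mul (h l hl j x (hsub hx)) (hD x hx) (norm_nonneg _)
      ((norm_nonneg _).trans (h l hl j x (hsub hx)))
  have key := hasSum_integral_of_summable_integral_norm hInt (by
    refine Summable.of_nonneg_of_le (fun j => integral_nonneg fun _ => norm_nonneg _)
      (fun j => ?_) (hu.mul_right D)
    have := setIntegral_mono_on (hInt j).norm (integrableOn_const (by simp))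
      measurableSet_Icc (hn j)
    simpa using this)
  convert! key using 1
  · ext j; rw [integral_const_mul]
  · refine setIntegral_congr_fun measurableSet_Icc fun x hx => ?_
    simp only [seriesDer, ← mul_assoc]
    exact ((summable_series hb hl (hsub hx)).tsum_mul_right _).symm

lemma integral_seriesDer (hb : Summable fun j => b j ^ 2) {l : ℕ} (hl : l < m) :
    ∫ x in Icc (0 : ℝ) 1, seriesDer m b l x = b l := by
  have h := hasSum_integral_seriesDer_mul hb hl (φ := fun _ => 1) continuous_const
  simp only [mul_one] at h
  refine h.unique ?_
  simp_rw [setIntegral_Icc_eq, integral_basisDer hl]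
  convert hasSum_ite_eq l (b l) using 2 with j
  split_ifs with hj <;> simp [hj]

lemma continuousOn_seriesDer (hb : Summable fun j => b j ^ 2) {l : ℕ} (hl : l < m) :
    ContinuousOn (seriesDer m b l) (Icc (0 : ℝ) 1) := by
  obtain ⟨u, hu, h⟩ := exists_seriesDer_bound (m := m) hb
  refine continuousOn_tsum (fun j => ((continuous_basisDer m l j).const_mul _).continuousOn) hu
    fun j x hx => h l hl j x ?_
  exact Icc_subset_Icc (by norm_num) (by norm_num) hx

end Series

lemma uniqueDiffOn_unit : UniqueDiffOn ℝ (Icc (0 : ℝ) 1) := uniqueDiffOn_Icc zero_lt_one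

lemma unit_subset_Ioo {x : ℝ} (hx : x ∈ Icc (0 : ℝ) 1) : x ∈ Ioo (-1 : ℝ) 2 :=
  ⟨by linarith [hx.1], by linarith [hx.2]⟩

lemma unit_subset_Icc {x : ℝ} (hx : x ∈ Icc (0 : ℝ) 1) : x ∈ Icc (-1 : ℝ) 2 :=
  Ioo_subset_Icc_self (unit_subset_Ioo hx)

lemma der_succ (l : ℕ) (f : ℝ → ℝ) (x : ℝ) :
    der (l + 1) f x = derivWithin (der l f) (Icc 0 1) x :=
  congrFun iteratedDerivWithin_succ x

/-- A tower of functions, each the derivative of the preceding one, computes `der`. -/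
lemma der_eq_of_tower {f : ℝ → ℝ} {F : ℕ → ℝ → ℝ} {n : ℕ} (h0 : EqOn f (F 0) (Icc 0 1))
    (h : ∀ l < n, ∀ x ∈ Icc (0 : ℝ) 1, HasDerivWithinAt (F l) (F (l + 1) x) (Icc 0 1) x) :
    ∀ l ≤ n, EqOn (der l f) (F l) (Icc 0 1) := by
  intro l
  induction l with
  | zero => intro _ x hx; simpa [der] using h0 hx
  | succ l ih =>
    intro hl x hx
    rw [der_succ, derivWithin_congr (ih (by omega)) (ih (by omega) hx)]
    exact (h l (by omega) x hx).derivWithin (uniqueDiffOn_unit x hx)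

/-! ### Expansion of Sobolev functions -/

/-- The coefficients of a Sobolev function in the basis. -/
def sobCoeff (m : ℕ) (f : ℝ → ℝ) (j : ℕ) : ℝ :=
  if j < m then ∫ x in Icc (0 : ℝ) 1, der j f x else casCoeff (der m f) (freq (j - m))

lemma hasSum_nat_of_split {m : ℕ} {a : ℕ → ℝ} {A : ℝ} (h : HasSum (fun n => a (m + n)) A) :
    HasSum a (∑ k ∈ Finset.range m, a k + A) := by
  rw [add_comm]
  refine (hasSum_nat_add_iff m).1 ?_
  simpa only [add_comm] using h

lemma hasSum_freq {F : ℤ → ℝ} {A : ℝ} (h : HasSum F A) : HasSum (fun n => F (freq n)) A :=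
  (Equiv.hasSum_iff Equiv.intEquivNat.symm).2 h

/-- The Sobolev inner product is the `ℓ²` inner product of the coefficients. -/
lemma hasSum_sobCoeff_mul {m : ℕ} {f g : ℝ → ℝ} (hf : MemSobolev m f) (hg : MemSobolev m g) :
    HasSum (fun j => sobCoeff m f j * sobCoeff m g j) (sobolevInner m f g) := by
  have h1 := hasSum_freq (hasSum_casCoeff_mul (hf.memLp m le_rfl) (hg.memLp m le_rfl))
  have e : ∀ (f : ℝ → ℝ) n, sobCoeff m f (m + n) = casCoeff (der m f) (freq n) := by
    intro f n; simp [sobCoeff]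
  simp_rw [← e] at h1
  have h2 := hasSum_nat_of_split (a := fun j => sobCoeff m f j * sobCoeff m g j) h1
  have h3 : ∑ k ∈ Finset.range m, sobCoeff m f k * sobCoeff m g k =
      ∑ k ∈ Finset.range m, (∫ x in Icc (0 : ℝ) 1, der k f x) *
        (∫ y in Icc (0 : ℝ) 1, der k g y) := by
    refine Finset.sum_congr rfl fun k hk => ?_
    rw [sobCoeff, sobCoeff, if_pos (Finset.mem_range.1 hk), if_pos (Finset.mem_range.1 hk)]
  rw [h3] at h2
  exact h2

lemma summable_sq_sobCoeff {m : ℕ} {f : ℝ → ℝ} (hf : MemSobolev m f) :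
    Summable fun j => sobCoeff m f j ^ 2 := by
  simpa only [sq] using (hasSum_sobCoeff_mul hf hf).summable

lemma MemSobolev.continuousOn_der {m : ℕ} {f : ℝ → ℝ} (hf : MemSobolev m f) {l : ℕ}
    (hl : l < m) : ContinuousOn (der l f) (Icc 0 1) :=
  hf.contDiffOn.continuousOn_iteratedDerivWithin (by exact_mod_cast Nat.le_sub_one_of_lt hl)
    uniqueDiffOn_unit

lemma MemSobolev.hasDerivWithinAt_der {m : ℕ} {f : ℝ → ℝ} (hf : MemSobolev m f) {l : ℕ}
    (hl : l + 1 < m) {x : ℝ} (hx : x ∈ Icc (0 : ℝ) 1) :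
    HasDerivWithinAt (der l f) (der (l + 1) f x) (Icc 0 1) x := by
  have h := hf.contDiffOn.differentiableOn_iteratedDerivWithin (m := l)
    (by exact_mod_cast (show l < m - 1 by omega)) uniqueDiffOn_unit x hx
  rw [der_succ]
  exact h.hasDerivWithinAt

lemma MemSobolev.der_sub_der_zero {m : ℕ} (hm : 1 ≤ m) {f : ℝ → ℝ} (hf : MemSobolev m f) {x : ℝ}
    (hx : x ∈ Icc (0 : ℝ) 1) :
    der (m - 1) f x - der (m - 1) f 0 = ∫ t in (0 : ℝ)..x, der m f t := by
  have hac : AbsolutelyContinuousOnInterval (der (m - 1) f) 0 x := hf.absCont.mono (by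
    rw [uIcc_of_le hx.1, uIcc_of_le zero_le_one]; exact Icc_subset_Icc le_rfl hx.2)
  rw [← hac.integral_deriv_eq_sub]
  -- The one-sided and two-sided derivatives may differ at the end point 1, so the null set `t = x`
  -- is discarded.
  have : ∀ᵐ t, t ≠ x := by simp [ae_iff]
  refine intervalIntegral.integral_congr_ae ?_
  filter_upwards [this] with t ht ht'
  rw [uIoc_of_le hx.1] at ht'
  have hlt : t < 1 := lt_of_lt_of_le (lt_of_le_of_ne ht'.2 ht) hx.2
  have h1 := der_succ (m - 1) f t
  rw [Nat.sub_add_cancel hm] at h1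
  rw [h1, derivWithin_of_mem_nhds (Icc_mem_nhds ht'.1 hlt)]

/-- Parseval's identity against the indicator of `(0,x]`. The trigonometric series of `h` converges
only in mean square, yet it may be integrated term by term. -/
lemma hasSum_integral_zero_left {h : ℝ → ℝ}
    (hh : MemLp h 2 (volume.restrict (Icc (0 : ℝ) 1))) {x : ℝ} (hx : x ∈ Icc (0 : ℝ) 1) :
    HasSum (fun z => casCoeff h z * ∫ t in (0 : ℝ)..x, cas (2 * Real.pi * z * t))
      (∫ t in (0 : ℝ)..x, h t) := by
  have hmem : MemLp ((Ioc 0 x).indicator fun _ => (1 : ℝ)) 2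
      (volume.restrict (Icc (0 : ℝ) 1)) :=
    memLp_indicator_const 2 measurableSet_Ioc 1 (Or.inr (measure_ne_top _ _))
  have hsub : Icc (0 : ℝ) 1 ∩ Ioc 0 x = Ioc 0 x :=
    inter_eq_right.2 fun t ht => ⟨ht.1.le, ht.2.trans hx.2⟩
  have e : ∀ g : ℝ → ℝ, ∫ t in Icc (0 : ℝ) 1, g t * (Ioc 0 x).indicator (fun _ => (1 : ℝ)) t =
      ∫ t in (0 : ℝ)..x, g t := by
    intro g
    rw [intervalIntegral.integral_of_le hx.1]
    have : ∀ t, g t * (Ioc 0 x).indicator (fun _ => (1 : ℝ)) t = (Ioc 0 x).indicator g t := by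
      intro t; by_cases ht : t ∈ Ioc 0 x <;> simp [ht]
    simp_rw [this]
    rw [setIntegral_indicator measurableSet_Ioc, hsub]
  have h1 := hasSum_casCoeff_mul hh hmem
  rw [e] at h1
  convert! h1 using 1
  ext z
  rw [← e]
  simp only [casCoeff, mul_comm]

/-- Index `m`, a Bernoulli polynomial, supplies the antiderivative for frequency zero, which has no
periodic one. -/
lemma integral_cas_freq {m : ℕ} (hm : 1 ≤ m) (n : ℕ) (x : ℝ) :
    ∫ t in (0 : ℝ)..x, cas (2 * Real.pi * freq n * t) =
      basisDer m (m - 1) (m + n) x - basisDer m (m - 1) (m + n) 0 := by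
  have h : ∀ t, HasDerivAt (basisDer m (m - 1) (m + n)) (cas (2 * Real.pi * freq n * t)) t := by
    intro t
    have h1 := hasDerivAt_basisDer (show m - 1 < m by omega) (m + n) t
    convert! h1 using 1
    rw [Nat.sub_add_cancel hm]
    rcases Nat.eq_zero_or_pos n with hn | hn
    · subst hn; simp [basisDer, bern, freq_zero, cas]
    · rw [basisDer, if_neg (by omega)]
      simp [trigAnti_zero]
  refine intervalIntegral.integral_eq_sub_of_hasDerivAt (fun t _ => h t) ?_
  exact (continuous_cas.comp (by fun_prop)).intervalIntegrable _ _

lemma integrableOn_unit_of_continuousOn {f : ℝ → ℝ} (hf : ContinuousOn f (Icc 0 1)) :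
    IntegrableOn f (Icc 0 1) := hf.integrableOn_compact isCompact_Icc

lemma eqOn_of_sub_const {f g : ℝ → ℝ} (hf : ContinuousOn f (Icc 0 1))
    (hg : ContinuousOn g (Icc 0 1)) (hc : ∀ x ∈ Icc (0 : ℝ) 1, f x - f 0 = g x - g 0)
    (hi : ∫ x in Icc (0 : ℝ) 1, f x = ∫ x in Icc (0 : ℝ) 1, g x) : EqOn f g (Icc 0 1) := by
  have h1 : ∫ x in Icc (0 : ℝ) 1, (f x - g x) = ∫ x in Icc (0 : ℝ) 1, (f 0 - g 0) :=
    setIntegral_congr_fun measurableSet_Icc fun x hx => by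
      have := hc x hx
      linarith
  rw [integral_sub (integrableOn_unit_of_continuousOn hf) (integrableOn_unit_of_continuousOn hg),
    hi, sub_self] at h1
  simp at h1
  intro x hx
  have := hc x hx
  linarith

/-- A Sobolev function and its derivatives of order below `m` are the sums of their expansions. -/
lemma der_eq_seriesDer {m : ℕ} (hm : 1 ≤ m) {f : ℝ → ℝ} (hf : MemSobolev m f) :
    ∀ k, k < m → EqOn (der (m - 1 - k) f) (seriesDer m (sobCoeff m f) (m - 1 - k)) (Icc 0 1) := by
  have hb := summable_sq_sobCoeff hf
  have hfin : ∀ l < m, (∀ x ∈ Icc (0 : ℝ) 1, der l f x - der l f 0 =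
      seriesDer m (sobCoeff m f) l x - seriesDer m (sobCoeff m f) l 0) →
      EqOn (der l f) (seriesDer m (sobCoeff m f) l) (Icc 0 1) := by
    intro l hl hc
    refine eqOn_of_sub_const (hf.continuousOn_der hl) (continuousOn_seriesDer hb hl) hc ?_
    rw [integral_seriesDer hb hl, sobCoeff, if_pos hl]
  have h0 : (0 : ℝ) ∈ Icc (0 : ℝ) 1 := by simp
  -- Descending induction on the order. At order `m - 1` increments are integrals of the `m`-th
  -- derivative, expanded by Parseval; below that, the derivatives of both sides already agree. Each
  -- constant of integration is fixed by the mean over `[0,1]`.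
  intro k
  induction k with
  | zero =>
    intro _
    refine hfin (m - 1) (by omega) fun x hx => ?_
    rw [hf.der_sub_der_zero hm hx, seriesDer, seriesDer,
      ← (summable_series hb (by omega) (unit_subset_Icc hx)).tsum_sub
        (summable_series hb (by omega) (unit_subset_Icc h0))]
    symm
    refine HasSum.tsum_eq ?_
    have h1 := hasSum_freq (hasSum_integral_zero_left (hf.memLp m le_rfl) hx)
    simp_rw [integral_cas_freq hm] at h1
    have h2 : HasSum (fun n => sobCoeff m f (m + n) * basisDer m (m - 1) (m + n) x -
        sobCoeff m f (m + n) * basisDer m (m - 1) (m + n) 0) (∫ t in (0 : ℝ)..x, der m f t) := by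
      simpa [sobCoeff, mul_sub] using h1
    have h3 := hasSum_nat_of_split (a := fun j => sobCoeff m f j * basisDer m (m - 1) j x -
      sobCoeff m f j * basisDer m (m - 1) j 0) h2
    rw [Finset.sum_eq_zero, zero_add] at h3
    · exact h3
    -- For `j < m` the derivative of order `m - 1` is constant and contributes nothing to an
    -- increment.
    · intro j hj
      have hj' := Finset.mem_range.1 hj
      have : basisDer m (m - 1) j x = basisDer m (m - 1) j 0 := by
        unfold basisDer
        rw [if_pos hj'.le, if_pos hj'.le]
        split_ifs with h
        · rw [show j - (m - 1) = 0 by omega]; simp [bern]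
        · rfl
      rw [this, sub_self]
  | succ k ih =>
    intro hk
    have ih' := ih (by omega)
    set l := m - 1 - (k + 1) with hl
    rw [show m - 1 - k = l + 1 by omega] at ih'
    refine hfin l (by omega) fun x hx => ?_
    have hd : ∀ y ∈ Icc (0 : ℝ) 1, HasDerivWithinAt
        (fun y => der l f y - seriesDer m (sobCoeff m f) l y) 0 (Icc 0 1) y := by
      intro y hy
      have h1 := (hf.hasDerivWithinAt_der (l := l) (by omega) hy).sub
        (hasDerivAt_seriesDer (m := m) hb (l := l) (by omega) (unit_subset_Ioo hy)).hasDerivWithinAt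
      rwa [ih' hy, sub_self] at h1
    have := constant_of_derivWithin_zero (f := fun y => der l f y - seriesDer m (sobCoeff m f) l y)
      (a := 0) (b := 1) (fun y hy => (hd y hy).differentiableWithinAt)
      (fun y hy => (hd y (Ico_subset_Icc_self hy)).derivWithin
        (uniqueDiffOn_unit y (Ico_subset_Icc_self hy))) x hx
    linarith

/-- Pointwise expansion of a Sobolev function. -/
lemma hasSum_sobCoeff {m : ℕ} (hm : 1 ≤ m) {f : ℝ → ℝ} (hf : MemSobolev m f) {x : ℝ}
    (hx : x ∈ Icc (0 : ℝ) 1) : HasSum (fun j => sobCoeff m f j * basisDer m 0 j x) (f x) := by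
  have h := der_eq_seriesDer hm hf (m - 1) (by omega) hx
  rw [Nat.sub_self] at h
  have h0 : der 0 f x = f x := by simp [der]
  rw [← h0, h]
  exact (summable_series (summable_sq_sobCoeff hf) (by omega) (unit_subset_Icc hx)).hasSum

lemma der_const (c : ℝ) (k : ℕ) {x : ℝ} (hx : x ∈ Icc (0 : ℝ) 1) :
    der k (fun _ => c) x = if k = 0 then c else 0 := by
  refine der_eq_of_tower (F := fun k _ => if k = 0 then c else 0) (n := k) (fun x _ => by simp)
    (fun l _ x _ => ?_) k le_rfl hx
  simpa using hasDerivWithinAt_const x (Icc (0 : ℝ) 1) (if l = 0 then c else 0)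

lemma memSobolev_const (m : ℕ) (c : ℝ) : MemSobolev m fun _ => c where
  contDiffOn := contDiffOn_const
  absCont := by
    have : LipschitzOnWith 0 (der (m - 1) fun _ => c) (uIcc 0 1) := by
      intro x hx y hy
      rw [uIcc_of_le zero_le_one] at hx hy
      rw [der_const c _ hx, der_const c _ hy]; simp
    exact this.absolutelyContinuousOnInterval
  memLp := fun k _ => by
    refine (memLp_const (if k = 0 then c else 0)).ae_eq ?_
    filter_upwards [ae_restrict_mem measurableSet_Icc] with x hx
    rw [der_const c k hx]

lemma sobCoeff_one {m : ℕ} (hm : 1 ≤ m) (j : ℕ) :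
    sobCoeff m (fun _ => 1) j = if j = 0 then 1 else 0 := by
  unfold sobCoeff
  split_ifs with h1 h2 h2
  · rw [setIntegral_congr_fun measurableSet_Icc fun x hx => der_const 1 j hx]; simp [h2]
  · rw [setIntegral_congr_fun measurableSet_Icc fun x hx => der_const 1 j hx]; simp [h2]
  · omega
  · unfold casCoeff
    rw [setIntegral_congr_fun (g := fun _ => 0) measurableSet_Icc fun x hx => ?_]
    · simp
    · simp only [der_const 1 m hx, if_neg (show m ≠ 0 by omega), zero_mul]

/-! ### Uniqueness of the expansion -/

/-- A quarter-period shift turns `cas θ` into `-cas (-θ)`, so antidifferentiation sends frequency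
`z` to `-z`. -/
lemma trigAnti_one (z : ℤ) (x : ℝ) :
    trigAnti 1 z x = -(2 * Real.pi * z)⁻¹ * trigAnti 0 (-z) x := by
  simp only [trigAnti, cas]
  push_cast
  rw [one_mul, Real.cos_sub_pi_div_two, Real.sin_sub_pi_div_two,
    show 2 * Real.pi * -(z : ℝ) * x - 0 * (Real.pi / 2) = -(2 * Real.pi * z * x) by ring,
    Real.cos_neg, Real.sin_neg]
  ring

/-- Integration by parts: `bern 1` is x - 1/2, and the boundary term is its unit jump between the
end points. Up to sign the result equals the coefficient that `trigAnti 1` has at its own frequency.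
-/
lemma integral_bern_one_mul_cas {w : ℤ} (hw : w ≠ 0) :
    ∫ x in (0 : ℝ)..1, bern 1 x * trigAnti 0 w x = -(2 * Real.pi * w)⁻¹ := by
  have h := intervalIntegral.integral_mul_deriv_eq_deriv_mul (a := 0) (b := 1)
    (u := bern 1) (v := trigAnti 1 w) (u' := bern 0) (v' := trigAnti 0 w)
    (fun x _ => hasDerivAt_bern 0 x) (fun x _ => hasDerivAt_trigAnti 0 hw x)
    ((continuous_bern 0).intervalIntegrable _ _) ((continuous_trigAnti 0 w).intervalIntegrable _ _)
  rw [h]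
  have h0 : ∀ x, bern 0 x = 1 := fun x => by simp [bern]
  simp only [h0, one_mul, integral_trigAnti 1 hw]
  have e : trigAnti 0 (-w) 1 = trigAnti 0 (-w) 0 := by
    simp only [trigAnti_zero, cas, mul_one, mul_zero]
    rw [show 2 * Real.pi * ((-w : ℤ) : ℝ) = 0 + ((-w : ℤ) : ℝ) * (2 * Real.pi) by ring,
      Real.cos_add_int_mul_two_pi, Real.sin_add_int_mul_two_pi]
  rw [trigAnti_one, trigAnti_one, e]
  simp [bern, trigAnti_zero, cas]
  ring

/-- Termwise differentiation stops at order `m - 1`, so the coefficients with `j ≥ m` are found by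
testing that derivative against the `cas` system. The Bernoulli term of index `m` meets every
nonzero frequency, so the test yields only `b (m + n) = b m`; square summability makes the common
value zero. -/
lemma eq_zero_of_seriesDer_eq_zero {m : ℕ} (hm : 1 ≤ m) {b : ℕ → ℝ}
    (hb : Summable fun j => b j ^ 2) (h : ∀ x ∈ Icc (0 : ℝ) 1, seriesDer m b 0 x = 0) :
    ∀ j, b j = 0 := by
  have hz : ∀ l, l < m → ∀ x ∈ Icc (0 : ℝ) 1, seriesDer m b l x = 0 := by
    intro l
    induction l with
    | zero => exact fun _ => h
    | succ l ih =>
      intro hl x hx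
      have h1 := (hasDerivAt_seriesDer hb hl (unit_subset_Ioo hx)).hasDerivWithinAt
        (s := Icc (0 : ℝ) 1)
      have h2 : HasDerivWithinAt (seriesDer m b l) 0 (Icc 0 1) x :=
        (hasDerivWithinAt_const x (Icc (0 : ℝ) 1) (0 : ℝ)).congr (ih (by omega))
          (ih (by omega) x hx)
      exact (uniqueDiffOn_unit x hx).eq_deriv _ h1 h2
  have hlow : ∀ l < m, b l = 0 := by
    intro l hl
    rw [← integral_seriesDer hb hl,
      setIntegral_congr_fun (g := fun _ => 0) measurableSet_Icc fun x hx => hz l hl x hx]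
    simp
  have hm1 : m - 1 < m := by omega
  have hhigh : ∀ n, n ≠ 0 → b (m + n) = b m := by
    intro n hn
    set w := -freq n with hw
    have hfn := freq_ne_zero hn
    have hw0 : w ≠ 0 := neg_ne_zero.2 hfn
    have h1 := hasSum_integral_seriesDer_mul hb hm1 (continuous_trigAnti 0 w)
    rw [setIntegral_congr_fun (g := fun _ => 0) measurableSet_Icc fun x hx => by
      simp only [hz _ hm1 x hx, zero_mul]] at h1
    simp only [integral_zero, setIntegral_Icc_eq] at h1
    have h2 : ∀ j ∉ ({m, m + n} : Finset ℕ),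
        b j * ∫ x in (0 : ℝ)..1, basisDer m (m - 1) j x * trigAnti 0 w x = 0 := by
      intro j hj
      simp only [Finset.mem_insert, Finset.mem_singleton, not_or] at hj
      rcases lt_or_gt_of_ne hj.1 with hlt | hgt
      · rw [hlow j hlt, zero_mul]
      · have : ∀ x, basisDer m (m - 1) j x * trigAnti 0 w x =
            -(2 * Real.pi * freq (j - m))⁻¹ * (trigAnti 0 (-freq (j - m)) x * trigAnti 0 w x) := by
          intro x
          rw [basisDer, if_neg (by omega), show m - (m - 1) = 1 by omega, trigAnti_one]; ring
        simp_rw [this]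
        rw [intervalIntegral.integral_const_mul, integral_trigAnti_mul, if_neg]
        · simp
        · rw [hw, neg_inj]
          intro h
          have := freq_injective h
          omega
    have h3 := h1.unique (hasSum_sum_of_ne_finset_zero h2)
    rw [Finset.sum_pair (by omega)] at h3
    have e1 : ∫ x in (0 : ℝ)..1, basisDer m (m - 1) m x * trigAnti 0 w x =
        -(2 * Real.pi * w)⁻¹ := by
      rw [← integral_bern_one_mul_cas hw0]
      congr 1; ext x
      rw [basisDer, if_pos le_rfl, if_pos (by omega), show m - (m - 1) = 1 by omega]
    have e2 : ∫ x in (0 : ℝ)..1, basisDer m (m - 1) (m + n) x * trigAnti 0 w x =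
        (2 * Real.pi * w)⁻¹ := by
      have : ∀ x, basisDer m (m - 1) (m + n) x * trigAnti 0 w x =
            (2 * Real.pi * w)⁻¹ * (trigAnti 0 w x * trigAnti 0 w x) := by
          intro x
          rw [basisDer, if_neg (by omega), show m - (m - 1) = 1 by omega, trigAnti_one,
            Nat.add_sub_cancel_left, ← hw]
          have : (2 * Real.pi * (w : ℝ))⁻¹ = -(2 * Real.pi * (freq n : ℝ))⁻¹ := by
            rw [hw]; push_cast; rw [mul_neg, inv_neg]
          rw [this]; ring
      simp_rw [this]
      rw [intervalIntegral.integral_const_mul, integral_trigAnti_mul, if_pos rfl]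
      simp
    rw [e1, e2] at h3
    have hne : (2 * Real.pi * (w : ℝ))⁻¹ ≠ 0 := by
      have : (w : ℝ) ≠ 0 := by exact_mod_cast hw0
      positivity
    have : (2 * Real.pi * (w : ℝ))⁻¹ * (b (m + n) - b m) = 0 := by linarith
    rcases mul_eq_zero.1 this with h | h
    · exact absurd h hne
    · linarith
  have hbm : b m = 0 := by
    have ht : Tendsto (fun n => b (n + m) ^ 2) atTop (𝓝 0) :=
      (tendsto_add_atTop_iff_nat m).2 hb.tendsto_atTop_zero
    have hc : Tendsto (fun n => b (n + m) ^ 2) atTop (𝓝 (b m ^ 2)) := by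
      refine tendsto_const_nhds.congr' ?_
      filter_upwards [eventually_ne_atTop 0] with n hn
      rw [add_comm, hhigh n hn]
    exact pow_eq_zero_iff (two_ne_zero) |>.1 (tendsto_nhds_unique hc ht)
  intro j
  rcases lt_or_ge j m with hj | hj
  · exact hlow j hj
  · obtain ⟨n, rfl⟩ := Nat.exists_eq_add_of_le hj
    rcases eq_or_ne n 0 with rfl | hn
    · simpa using hbm
    · rw [hhigh n hn, hbm]

/-! ### Orthogonality in `L₂[0,1]` -/

/-- Truncation at `m + 1` separates the Bernoulli indices and merges all trigonometric ones, so two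
distinct indices with equal truncation are both trigonometric. -/
lemma integral_basisDer_mul_eq_zero {m i j : ℕ} (hij : i ≠ j)
    (hfam : min i (m + 1) = min j (m + 1)) :
    ∫ x in Icc (0 : ℝ) 1, basisDer m 0 i x * basisDer m 0 j x = 0 := by
  have hi : m < i := by omega
  have hj : m < j := by omega
  simp only [basisDer, if_neg (not_le.2 hi), if_neg (not_le.2 hj)]
  rw [setIntegral_Icc_eq, integral_trigAnti_mul, if_neg]
  intro h
  have := freq_injective h
  omega

/-! ### Square summable families -/

lemma memlp_two_iff {ι : Type*} {a : ι → ℝ} :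
    Memℓp a 2 ↔ Summable fun i => a i ^ 2 := by
  rw [memℓp_gen_iff (by norm_num)]
  simp

open Classical in
/-- A square summable family as an element of `ℓ²`. -/
def toL2 {ι : Type*} (a : ι → ℝ) : lp (fun _ : ι => ℝ) 2 :=
  if h : Memℓp a 2 then ⟨a, h⟩ else 0

lemma toL2_apply {ι : Type*} {a : ι → ℝ} (h : Summable fun i => a i ^ 2) (i : ι) :
    toL2 a i = a i := by
  rw [toL2, dif_pos (memlp_two_iff.2 h)]

lemma summable_sq_lp {ι : Type*} (h : lp (fun _ : ι => ℝ) 2) : Summable fun i => h i ^ 2 :=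
  memlp_two_iff.1 h.2

lemma hasSum_inner_lp {ι : Type*} (h k : lp (fun _ : ι => ℝ) 2) :
    HasSum (fun i => h i * k i) (inner ℝ h k) := by
  have := lp.hasSum_inner (𝕜 := ℝ) h k
  convert! this using 1
  ext i; simp [mul_comm]

lemma hasSum_norm_sq_lp {ι : Type*} (h : lp (fun _ : ι => ℝ) 2) :
    HasSum (fun i => h i ^ 2) (‖h‖ ^ 2) := by
  have := hasSum_inner_lp h h
  rw [real_inner_self_eq_norm_sq] at this
  simpa only [sq] using this

/-- Cauchy–Schwarz for series. -/
lemma sq_tsum_mul_le {ι : Type*} {a b : ι → ℝ} (ha : Summable fun i => a i ^ 2)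
    (hb : Summable fun i => b i ^ 2) :
    (∑' i, a i * b i) ^ 2 ≤ (∑' i, a i ^ 2) * ∑' i, b i ^ 2 := by
  have h1 := hasSum_inner_lp (toL2 a) (toL2 b)
  have h2 := hasSum_norm_sq_lp (toL2 a)
  have h3 := hasSum_norm_sq_lp (toL2 b)
  simp only [toL2_apply ha, toL2_apply hb] at h1 h2 h3
  rw [h1.tsum_eq, h2.tsum_eq, h3.tsum_eq, ← mul_pow]
  exact sq_le_sq.2 (by
    rw [abs_of_nonneg (a := ‖toL2 a‖ * ‖toL2 b‖) (by positivity)]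
    exact abs_real_inner_le_norm _ _)

/-! ### Products of series -/

lemma hasSum_prod_pi : ∀ {r : ℕ} {a : Fin r → ℕ → ℝ}, (∀ s, Summable fun j => ‖a s j‖) →
    (Summable fun i : Fin r → ℕ => ‖∏ s, a s (i s)‖) ∧
      HasSum (fun i : Fin r → ℕ => ∏ s, a s (i s)) (∏ s, ∑' j, a s j) := by
  intro r
  induction r with
  | zero =>
    intro a _
    have : Fintype (Fin 0 → ℕ) := Fintype.ofSubsingleton fun k => k.elim0
    exact ⟨(hasSum_fintype _).summable, by simp⟩
  | succ r ih =>
    intro a ha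
    obtain ⟨h1, h2⟩ := ih (a := fun s => a s.succ) fun s => ha s.succ
    have hs := (ha 0).mul_norm h1
    have hS := HasSum.mul (ha 0).of_norm.hasSum h2 hs.of_norm
    rw [← Equiv.summable_iff (Fin.consEquiv fun _ => ℕ),
      ← Equiv.hasSum_iff (Fin.consEquiv fun _ => ℕ)]
    simp only [Function.comp_def, Fin.prod_univ_succ, Fin.consEquiv_apply, Fin.cons_zero,
      Fin.cons_succ]
    exact ⟨hs, hS⟩

lemma summable_sq_prod_pi {r : ℕ} {a : Fin r → ℕ → ℝ} (ha : ∀ s, Summable fun j => a s j ^ 2) :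
    Summable fun i : Fin r → ℕ => (∏ s, a s (i s)) ^ 2 := by
  have := (hasSum_prod_pi (a := fun s j => a s j ^ 2) fun s => by simpa using ha s).2.summable
  simpa only [Finset.prod_pow] using this

/-! ### Point evaluation of derivatives -/

/-- The space of coefficients. -/
abbrev CoefSpace (r : ℕ) : Type := lp (fun _ : Fin r → ℕ => ℝ) 2

/-- The vector of the derivatives of order `α` of the tensor product basis at the point `x`. -/
def evalVec {r : ℕ} (m : ℕ) (α : Fin r → ℕ) (x : Fin r → ℝ) : CoefSpace r :=
  toL2 fun i => ∏ k, basisDer m (α k) (i k) (x k)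

section EvalVec

variable {r m : ℕ} {α : Fin r → ℕ} {x : Fin r → ℝ}

lemma exists_evalVec_bound (r m : ℕ) : ∃ v : (Fin r → ℕ) → ℝ, (∀ i, 0 ≤ v i) ∧
    (Summable fun i => v i ^ 2) ∧ ∀ α : Fin r → ℕ, (∀ k, α k < m) → ∀ x : Fin r → ℝ,
      (∀ k, x k ∈ Icc (-1 : ℝ) 2) → ∀ i, |∏ k, basisDer m (α k) (i k) (x k)| ≤ v i := by
  obtain ⟨C, hC, h⟩ := exists_abs_basisDer_le_inv m
  refine ⟨fun i => ∏ k, (C * ((i k : ℝ) + 1)⁻¹), fun i => by positivity,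
    summable_sq_prod_pi (a := fun _ j => C * ((j : ℝ) + 1)⁻¹) fun _ => summable_sq_inv_succ C,
    fun α hα x hx i => ?_⟩
  rw [Finset.abs_prod]
  exact Finset.prod_le_prod (fun _ _ => abs_nonneg _) fun k _ => h _ (hα k) _ _ (hx k)

lemma summable_sq_evalVec (hα : ∀ k, α k < m) (hx : ∀ k, x k ∈ Icc (-1 : ℝ) 2) :
    Summable fun i : Fin r → ℕ => (∏ k, basisDer m (α k) (i k) (x k)) ^ 2 := by
  obtain ⟨v, _, hv, h⟩ := exists_evalVec_bound r m
  refine Summable.of_nonneg_of_le (fun i => sq_nonneg _) (fun i => ?_) hv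
  rw [← sq_abs]
  exact pow_le_pow_left₀ (abs_nonneg _) (h α hα x hx i) 2

lemma evalVec_apply (hα : ∀ k, α k < m) (hx : ∀ k, x k ∈ Icc (-1 : ℝ) 2) (i : Fin r → ℕ) :
    evalVec m α x i = ∏ k, basisDer m (α k) (i k) (x k) :=
  toL2_apply (summable_sq_evalVec hα hx) i

lemma hasSum_inner_evalVec (hα : ∀ k, α k < m) (hx : ∀ k, x k ∈ Icc (-1 : ℝ) 2)
    (h : CoefSpace r) :
    HasSum (fun i => h i * ∏ k, basisDer m (α k) (i k) (x k)) (inner ℝ h (evalVec m α x)) := by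
  simpa only [evalVec_apply hα hx] using hasSum_inner_lp h (evalVec m α x)

lemma mem_Icc_of_mem_cube (hx : x ∈ cube r) (k : Fin r) : x k ∈ Icc (-1 : ℝ) 2 :=
  unit_subset_Icc (hx k)

/-- The function with coefficients `h` can be differentiated term by term. -/
lemma hasDerivWithinAt_inner_evalVec (h : CoefSpace r) (hα : ∀ k, α k < m) (hx : x ∈ cube r)
    (s : Fin r) {l : ℕ} (hl : l + 1 < m) {t : ℝ} (ht : t ∈ Icc (0 : ℝ) 1) :
    HasDerivWithinAt
      (fun t => inner ℝ h (evalVec m (Function.update α s l) (Function.update x s t)))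
      (inner ℝ h (evalVec m (Function.update α s (l + 1)) (Function.update x s t)))
      (Icc 0 1) t := by
  obtain ⟨v, hv0, hv, hvb⟩ := exists_evalVec_bound r m
  have hα' : ∀ l < m, ∀ k, Function.update α s l k < m := by
    intro l hl k
    by_cases hk : k = s
    · subst hk; simpa using hl
    · simpa [hk] using hα k
  have hx' : ∀ t ∈ Icc (-1 : ℝ) 2, ∀ k, Function.update x s t k ∈ Icc (-1 : ℝ) 2 := by
    intro t ht k
    by_cases hk : k = s
    · subst hk; simpa using ht
    · simpa [hk] using mem_Icc_of_mem_cube hx k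
  have hprod : ∀ l t (i : Fin r → ℕ),
      ∏ k, basisDer m (Function.update α s l k) (i k) (Function.update x s t k) =
      basisDer m l (i s) t * ∏ k ∈ Finset.univ.erase s, basisDer m (α k) (i k) (x k) := by
    intro l t i
    rw [← Finset.mul_prod_erase _ _ (Finset.mem_univ s)]
    simp only [Function.update_self]
    congr 1
    refine Finset.prod_congr rfl fun k hk => ?_
    have hk' := Finset.ne_of_mem_erase hk
    rw [Function.update_of_ne hk', Function.update_of_ne hk']
  have key := hasDerivAt_tsum_of_isPreconnected
    (g := fun i t => h i * ∏ k, basisDer m (Function.update α s l k) (i k)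
      (Function.update x s t k))
    (g' := fun i t => h i * ∏ k, basisDer m (Function.update α s (l + 1) k) (i k)
      (Function.update x s t k))
    (summable_mul_of_sq (summable_sq_lp h) hv) isOpen_Ioo
    (isPreconnected_Ioo (a := (-1 : ℝ)) (b := 2))
    (fun i t _ => by
      simp only [hprod]
      exact ((hasDerivAt_basisDer (by omega) (i s) t).mul_const _).const_mul _)
    (fun i t ht => by
      rw [norm_mul, Real.norm_eq_abs, Real.norm_eq_abs, abs_of_nonneg (hv0 i)]
      exact mul_le_mul_of_nonneg_left (hvb _ (hα' _ hl) _ (hx' t (Ioo_subset_Icc_self ht)) i)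
        (abs_nonneg _))
    (unit_subset_Ioo ht)
    (hasSum_inner_evalVec (hα' l (by omega)) (hx' t (unit_subset_Icc ht)) h).summable
    (unit_subset_Ioo ht)
  have e : ∀ l < m, ∀ t ∈ Icc (0 : ℝ) 1,
      inner ℝ h (evalVec m (Function.update α s l) (Function.update x s t)) =
      ∑' i, h i * ∏ k, basisDer m (Function.update α s l k) (i k) (Function.update x s t k) :=
    fun l hl t ht => (hasSum_inner_evalVec (hα' l hl) (hx' t (unit_subset_Icc ht)) h).tsum_eq.symm
  rw [e (l + 1) hl t ht]
  exact key.hasDerivWithinAt.congr (fun t ht => e l (by omega) t ht) (e l (by omega) t ht)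

lemma partialDer_eq_inner {h : CoefSpace r} {g : (Fin r → ℝ) → ℝ} (hα : ∀ k, α k < m)
    (hg : ∀ x ∈ cube r, g x = inner ℝ h (evalVec m α x)) {s : Fin r} (hs : α s = 0) {b : ℕ}
    (hb : b < m) (hx : x ∈ cube r) :
    partialDer s b g x = inner ℝ h (evalVec m (Function.update α s b) x) := by
  have hmem : ∀ t ∈ Icc (0 : ℝ) 1, Function.update x s t ∈ cube r := by
    intro t ht k
    by_cases hk : k = s
    · subst hk; simpa using ht
    · simpa [hk] using hx k
  have := der_eq_of_tower (f := fun t => g (Function.update x s t)) (n := b)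
    (F := fun l t => inner ℝ h (evalVec m (Function.update α s l) (Function.update x s t)))
    (fun t ht => by
      simp only [hg _ (hmem t ht)]
      have e : Function.update α s 0 = α := by
        conv_lhs => rw [show (0 : ℕ) = α s from hs.symm]
        exact Function.update_eq_self s α
      rw [e])
    (fun l hl t ht => hasDerivWithinAt_inner_evalVec h hα hx s (by omega) ht) b le_rfl (hx s)
  rw [partialDer, this]
  simp

/-- Mixed derivatives of the function with coefficients `h`. -/
lemma mixedDer_eq_inner (hm : 1 ≤ m) {h : CoefSpace r} {f : (Fin r → ℝ) → ℝ} {β : Fin r → ℕ}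
    (hβ : ∀ k, β k < m) (hf : ∀ x ∈ cube r, f x = inner ℝ h (evalVec m (fun _ => 0) x)) :
    ∀ x ∈ cube r, mixedDer β f x = inner ℝ h (evalVec m β x) := by
  -- One coordinate is differentiated at a time. As the list has no repetition, the coordinate being
  -- treated still carries order zero.
  have key : ∀ l : List (Fin r), l.Nodup → ∀ x ∈ cube r,
      l.foldr (fun s g => partialDer s (β s) g) f x =
        inner ℝ h (evalVec m (fun k => if k ∈ l then β k else 0) x) := by
    intro l
    induction l with
    | nil => intro _ x hx; simpa using hf x hx
    | cons s l ih =>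
      intro hl x hx
      rw [List.nodup_cons] at hl
      rw [List.foldr_cons, partialDer_eq_inner (α := fun k => if k ∈ l then β k else 0)
        (fun k => by split_ifs; exacts [hβ k, by omega]) (ih hl.2)
        (by simp [hl.1]) (hβ s) hx]
      congr 2
      ext k
      by_cases hk : k = s
      · subst hk; simp
      · simp [hk]
  intro x hx
  have := key (List.finRange r) (List.nodup_finRange r) x hx
  simpa [mixedDer] using this

end EvalVec

/-! ### Uniqueness of the coefficients -/

/-- Induction on the number of variables. With all but the first frozen, the series is a univariate
expansion whose coefficients are tensor series in the frozen variables; these vanish by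
`eq_zero_of_seriesDer_eq_zero`. -/
lemma eq_zero_of_tensor_series {m : ℕ} (hm : 1 ≤ m) : ∀ {r : ℕ} {c : (Fin r → ℕ) → ℝ},
    (Summable fun i => c i ^ 2) →
    (∀ x ∈ cube r, ∑' i, c i * ∏ k, basisDer m 0 (i k) (x k) = 0) → ∀ i, c i = 0 := by
  intro r
  induction r with
  | zero =>
    intro c _ h i
    have := h (fun k => k.elim0) (fun k => k.elim0)
    rw [tsum_eq_single i (fun j hj => absurd (Subsingleton.elim j i) hj)] at this
    simpa using this
  | succ r ih =>
    intro c hc h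
    set e := Fin.consEquiv (n := r) fun _ => ℕ with he
    have hc' : Summable fun p : ℕ × (Fin r → ℕ) => c (e p) ^ 2 := (Equiv.summable_iff e).2 hc
    have hb : ∀ x ∈ cube r, ∀ j,
        ∑' i, c (e (j, i)) * ∏ k, basisDer m 0 (i k) (x k) = 0 := by
      intro x hx
      have hsx := summable_sq_evalVec (m := m) (α := fun _ => 0) (fun _ => hm)
        (mem_Icc_of_mem_cube hx)
      refine eq_zero_of_seriesDer_eq_zero hm ?_ ?_
      · refine Summable.of_nonneg_of_le (fun j => sq_nonneg _)
          (fun j => sq_tsum_mul_le (hc'.prod_factor j) hsx) (hc'.prod.mul_right _)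
      · intro t ht
        have hcons : (Fin.cons t x : Fin (r + 1) → ℝ) ∈ cube (r + 1) := by
          intro k
          refine Fin.cases ?_ (fun k => ?_) k
          · simpa using ht
          · simpa using hx k
        have h0 := h _ hcons
        have hsum : Summable fun i : Fin (r + 1) → ℕ =>
            c i * ∏ k, basisDer m 0 (i k) ((Fin.cons t x : Fin (r + 1) → ℝ) k) := by
          refine Summable.of_norm ?_
          simp only [norm_mul, Real.norm_eq_abs]
          exact summable_mul_of_sq hc (summable_sq_evalVec (m := m) (α := fun _ => 0)
            (fun _ => hm) (mem_Icc_of_mem_cube hcons))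
        rw [← Equiv.tsum_eq e] at h0
        have hsum' := (Equiv.summable_iff e).2 hsum
        simp only [Function.comp_def] at hsum'
        rw [hsum'.tsum_prod] at h0
        rw [seriesDer, ← h0]
        congr 1; ext j
        rw [← tsum_mul_right]
        congr 1; ext i
        simp only [he, Fin.consEquiv_apply, Fin.prod_univ_succ, Fin.cons_zero, Fin.cons_succ]
        ring
    intro i
    obtain ⟨⟨j, i⟩, rfl⟩ := e.surjective i
    exact ih (c := fun i => c (e (j, i))) (hc'.prod_factor j) (fun x hx => hb x hx j) i

lemma eq_of_inner_evalVec_eq {r m : ℕ} (hm : 1 ≤ m) {h k : CoefSpace r}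
    (hhk : ∀ x ∈ cube r, inner ℝ h (evalVec m (fun _ => 0) x) =
      inner ℝ k (evalVec m (fun _ => 0) x)) : h = k := by
  rw [← sub_eq_zero]
  ext i
  refine eq_zero_of_tensor_series hm (summable_sq_lp (h - k)) (fun x hx => ?_) i
  rw [(hasSum_inner_evalVec (α := fun _ => 0) (fun _ => hm) (mem_Icc_of_mem_cube hx)
    (h - k)).tsum_eq, inner_sub_left, hhk x hx, sub_self]

/-! ### The space `H_q` inside the space of coefficients -/

/-- The coefficients of an elementary tensor. -/
def tensorCoeff {r : ℕ} (m : ℕ) (a : Fin r → ℝ → ℝ) : CoefSpace r :=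
  toL2 fun i => ∏ s, sobCoeff m (a s) (i s)

lemma ElemTensor.memSobolev {r m q : ℕ} (a : ElemTensor r m q) (s : Fin r) :
    MemSobolev m (a.1 s) := by
  obtain ⟨S, _, h1, h2⟩ := a.2
  by_cases hs : s ∈ S
  · exact (h1 s hs).1
  · rw [h2 s hs]; exact memSobolev_const m 1

section Tensor

variable {r m q : ℕ}

lemma tensorCoeff_apply (a : ElemTensor r m q) (i : Fin r → ℕ) :
    tensorCoeff m a.1 i = ∏ s, sobCoeff m (a.1 s) (i s) :=
  toL2_apply (summable_sq_prod_pi fun s => summable_sq_sobCoeff (a.memSobolev s)) i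

lemma inner_tensorCoeff (a b : ElemTensor r m q) :
    inner ℝ (tensorCoeff m a.1) (tensorCoeff m b.1) = ∏ s, sobolevInner m (a.1 s) (b.1 s) := by
  have h1 := hasSum_inner_lp (tensorCoeff m a.1) (tensorCoeff m b.1)
  simp only [tensorCoeff_apply, ← Finset.prod_mul_distrib] at h1
  have h2 := (hasSum_prod_pi (a := fun s j => sobCoeff m (a.1 s) j * sobCoeff m (b.1 s) j)
    fun s => by
      simp only [norm_mul, Real.norm_eq_abs]
      exact summable_mul_of_sq (summable_sq_sobCoeff (a.memSobolev s))
        (summable_sq_sobCoeff (b.memSobolev s))).2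
  rw [h1.unique h2]
  exact Finset.prod_congr rfl fun s _ =>
    (hasSum_sobCoeff_mul (a.memSobolev s) (b.memSobolev s)).tsum_eq

lemma inner_tensorCoeff_evalVec (hm : 1 ≤ m) (a : ElemTensor r m q) {x : Fin r → ℝ}
    (hx : x ∈ cube r) :
    inner ℝ (tensorCoeff m a.1) (evalVec m (fun _ => 0) x) = ∏ s, a.1 s (x s) := by
  have h1 := hasSum_inner_evalVec (m := m) (α := fun _ => 0) (fun _ => hm)
    (mem_Icc_of_mem_cube hx) (tensorCoeff m a.1)
  simp only [tensorCoeff_apply, ← Finset.prod_mul_distrib] at h1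
  have h2 := (hasSum_prod_pi (a := fun s j => sobCoeff m (a.1 s) j * basisDer m 0 j (x s))
    fun s => (hasSum_sobCoeff hm (a.memSobolev s) (hx s)).summable.norm).2
  rw [h1.unique h2]
  exact Finset.prod_congr rfl fun s _ => (hasSum_sobCoeff hm (a.memSobolev s) (hx s)).tsum_eq

/-- The coefficients of a formal combination of elementary tensors. -/
def formalCoeff (r m q : ℕ) : FormalSum r m q →ₗ[ℝ] CoefSpace r :=
  Finsupp.linearCombination ℝ fun a : ElemTensor r m q => tensorCoeff m a.1

lemma inner_formalCoeff (c d : FormalSum r m q) :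
    inner ℝ (formalCoeff r m q c) (formalCoeff r m q d) = FormalSum.inner c d := by
  rw [formalCoeff, Finsupp.linearCombination_apply, Finsupp.linearCombination_apply,
    Finsupp.sum_inner, FormalSum.inner]
  refine Finsupp.sum_congr fun a _ => ?_
  rw [Finsupp.inner_sum]
  refine Finsupp.sum_congr fun b _ => ?_
  rw [real_inner_smul_left, real_inner_smul_right, inner_tensorCoeff]
  ring

lemma inner_formalCoeff_evalVec (hm : 1 ≤ m) (c : FormalSum r m q) {x : Fin r → ℝ}
    (hx : x ∈ cube r) :
    inner ℝ (formalCoeff r m q c) (evalVec m (fun _ => 0) x) = c.eval x := by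
  rw [formalCoeff, Finsupp.linearCombination_apply, Finsupp.sum_inner, FormalSum.eval]
  refine Finsupp.sum_congr fun a _ => ?_
  rw [real_inner_smul_left, inner_tensorCoeff_evalVec hm a hx]

/-- The coefficient vectors of the functions in `H_q`. -/
def hSpace (r m q : ℕ) : Submodule ℝ (CoefSpace r) :=
  (LinearMap.range (formalCoeff r m q)).topologicalClosure

/-- `f` is the function in `H_q` with coefficient vector `h`. -/
def Realizes (m q : ℕ) (h : CoefSpace r) (f : (Fin r → ℝ) → ℝ) : Prop :=
  h ∈ hSpace r m q ∧ ∀ x ∈ cube r, f x = inner ℝ h (evalVec m (fun _ => 0) x)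

lemma Realizes.unique (hm : 1 ≤ m) {h k : CoefSpace r} {f : (Fin r → ℝ) → ℝ}
    (hh : Realizes m q h f) (hk : Realizes m q k f) : h = k :=
  eq_of_inner_evalVec_eq hm fun x hx => by rw [← hh.2 x hx, ← hk.2 x hx]

lemma Represents.exists_realizes (hm : 1 ≤ m) {c : ℕ → FormalSum r m q} {f : (Fin r → ℝ) → ℝ}
    (hc : Represents c f) :
    ∃ h, Realizes m q h f ∧ Tendsto (fun k => formalCoeff r m q (c k)) atTop (𝓝 h) := by
  have hcauchy : CauchySeq fun k => formalCoeff r m q (c k) := by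
    rw [Metric.cauchySeq_iff]
    intro δ hδ
    obtain ⟨N, hN⟩ := hc.1 (δ ^ 2) (by positivity)
    refine ⟨N, fun k hk l hl => ?_⟩
    have := hN k hk l hl
    rw [← inner_formalCoeff, real_inner_self_eq_norm_sq, map_sub] at this
    rw [dist_eq_norm]
    exact lt_of_pow_lt_pow_left₀ 2 hδ.le this
  obtain ⟨h, hh⟩ := cauchySeq_tendsto_of_complete hcauchy
  refine ⟨h, ⟨?_, fun x hx => ?_⟩, hh⟩
  · exact mem_closure_of_tendsto hh (Eventually.of_forall fun k => LinearMap.mem_range_self _ _)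
  · refine tendsto_nhds_unique (hc.2 x hx) ?_
    have := (hh.inner (tendsto_const_nhds (x := evalVec m (fun _ => 0) x)) : Tendsto
      (fun k => inner ℝ (formalCoeff r m q (c k)) (evalVec m (fun _ => 0) x)) atTop _)
    simpa only [inner_formalCoeff_evalVec hm _ hx] using this

lemma Realizes.exists_represents (hm : 1 ≤ m) {h : CoefSpace r} {f : (Fin r → ℝ) → ℝ}
    (hh : Realizes m q h f) : ∃ c : ℕ → FormalSum r m q, Represents c f ∧
      Tendsto (fun k => formalCoeff r m q (c k)) atTop (𝓝 h) := by
  obtain ⟨y, hy, hlim⟩ := mem_closure_iff_seq_limit.1 hh.1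
  choose c hc using hy
  have hlim' : Tendsto (fun k => formalCoeff r m q (c k)) atTop (𝓝 h) := by
    simpa only [hc] using hlim
  refine ⟨c, ⟨fun δ hδ => ?_, fun x hx => ?_⟩, hlim'⟩
  · obtain ⟨N, hN⟩ := Metric.cauchySeq_iff.1 hlim'.cauchySeq (Real.sqrt δ) (Real.sqrt_pos.2 hδ)
    refine ⟨N, fun k hk l hl => ?_⟩
    have := hN k hk l hl
    rw [dist_eq_norm, ← map_sub] at this
    rw [← inner_formalCoeff, real_inner_self_eq_norm_sq]
    exact (Real.lt_sqrt (norm_nonneg _)).1 this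
  · rw [hh.2 x hx]
    have := (hlim'.inner (tendsto_const_nhds (x := evalVec m (fun _ => 0) x)) : Tendsto
      (fun k => inner ℝ (formalCoeff r m q (c k)) (evalVec m (fun _ => 0) x)) atTop _)
    simpa only [inner_formalCoeff_evalVec hm _ hx] using this

/-- The coefficient map is isometric and point evaluation is continuous on ℓ², so Cauchy sequences
of formal sums with their pointwise limits are the same as limits in the closure of the range. -/
lemma memH_iff (hm : 1 ≤ m) {f : (Fin r → ℝ) → ℝ} : MemH r m q f ↔ ∃ h, Realizes m q h f := by
  constructor
  · rintro ⟨c, hc⟩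
    obtain ⟨h, hh, _⟩ := hc.exists_realizes hm
    exact ⟨h, hh⟩
  · rintro ⟨h, hh⟩
    obtain ⟨c, hc, _⟩ := hh.exists_represents hm
    exact ⟨c, hc⟩

/-- All approximating sequences of a function converge to one coefficient vector, by uniqueness of
coefficients. The chosen limit in `innerH` is thereby well defined. -/
lemma innerH_eq (hm : 1 ≤ m) {h k : CoefSpace r} {f g : (Fin r → ℝ) → ℝ}
    (hh : Realizes m q h f) (hk : Realizes m q k g) : innerH r m q f g = inner ℝ h k := by
  have hex : HasInnerH r m q f g (inner ℝ h k) := by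
    obtain ⟨c, hc, hcl⟩ := hh.exists_represents hm
    obtain ⟨d, hd, hdl⟩ := hk.exists_represents hm
    refine ⟨c, d, hc, hd, ?_⟩
    simpa only [inner_formalCoeff] using (hcl.inner hdl : Tendsto
      (fun k => inner ℝ (formalCoeff r m q (c k)) (formalCoeff r m q (d k))) atTop _)
  have huniq : ∀ v, HasInnerH r m q f g v → v = inner ℝ h k := by
    rintro v ⟨c, d, hc, hd, hv⟩
    obtain ⟨h', hh', hcl⟩ := hc.exists_realizes hm
    obtain ⟨k', hk', hdl⟩ := hd.exists_realizes hm
    rw [hh.unique hm hh', hk.unique hm hk']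
    refine tendsto_nhds_unique hv ?_
    simpa only [inner_formalCoeff] using (hcl.inner hdl : Tendsto
      (fun k => inner ℝ (formalCoeff r m q (c k)) (formalCoeff r m q (d k))) atTop _)
  have hne : ∃ v, HasInnerH r m q f g v := ⟨_, hex⟩
  rw [innerH, dif_pos hne]
  exact huniq _ hne.choose_spec

/-- Outside its active set a tensor has the factor 1, whose only nonzero coefficient is the zeroth.
Hence a nonzero entry at an inactive coordinate kills the product. -/
lemma formalCoeff_apply_eq_zero (hm : 1 ≤ m) (c : FormalSum r m q) {i : Fin r → ℕ}
    (hi : q < (Finset.univ.filter fun k => i k ≠ 0).card) : formalCoeff r m q c i = 0 := by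
  have h1 : ∀ a : ElemTensor r m q, tensorCoeff m a.1 i = 0 := by
    intro a
    obtain ⟨S, hS, _, h2⟩ := a.2
    rw [tensorCoeff_apply]
    have : ∃ k, i k ≠ 0 ∧ k ∉ S := by
      by_contra hcon
      push Not at hcon
      have : (Finset.univ.filter fun k => i k ≠ 0) ⊆ S := fun k hk =>
        hcon k (Finset.mem_filter.1 hk).2
      have := Finset.card_le_card this
      omega
    obtain ⟨k, hk, hkS⟩ := this
    refine Finset.prod_eq_zero (Finset.mem_univ k) ?_
    rw [h2 k hkS, sobCoeff_one hm, if_neg hk]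
  rw [formalCoeff, Finsupp.linearCombination_apply, Finsupp.sum, lp.coeFn_sum, Finset.sum_apply]
  exact Finset.sum_eq_zero fun a _ => by simp [h1]

lemma hSpace_apply_eq_zero (hm : 1 ≤ m) {h : CoefSpace r} (hh : h ∈ hSpace r m q)
    {i : Fin r → ℕ} (hi : q < (Finset.univ.filter fun k => i k ≠ 0).card) : h i = 0 := by
  obtain ⟨y, hy, hlim⟩ := mem_closure_iff_seq_limit.1 hh
  have h1 : Tendsto (fun n => y n i) atTop (𝓝 (h i)) :=
    ((lp.evalCLM ℝ (fun _ : Fin r → ℕ => ℝ) 2 i).continuous.tendsto h).comp hlim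
  refine tendsto_nhds_unique h1 ?_
  have : ∀ n, y n i = 0 := by
    intro n
    obtain ⟨c, hc⟩ := hy n
    rw [← hc, formalCoeff_apply_eq_zero hm c hi]
  simp [this]

end Tensor

/-! ### Squares of series of functions -/

/-- The integral of the square of an absolutely convergent series of functions. -/
lemma hasSum_integral_sq {ι X : Type*} [Countable ι] [MeasurableSpace X] {μ : Measure X}
    [IsFiniteMeasure μ] {φ : ι → X → ℝ} {c w : ι → ℝ} (hφ : ∀ i, AEStronglyMeasurable (φ i) μ)
    (hw : ∀ i, ∀ᵐ x ∂μ, |φ i x| ≤ w i) (hw0 : ∀ i, 0 ≤ w i) (hc : Summable fun i => |c i| * w i) :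
    HasSum (fun p : ι × ι => c p.1 * c p.2 * ∫ x, φ p.1 x * φ p.2 x ∂μ)
      (∫ x, (∑' i, c i * φ i x) ^ 2 ∂μ) := by
  have hb : ∀ p : ι × ι, ∀ᵐ x ∂μ, ‖c p.1 * c p.2 * (φ p.1 x * φ p.2 x)‖ ≤
      (|c p.1| * w p.1) * (|c p.2| * w p.2) := by
    intro p
    filter_upwards [hw p.1, hw p.2] with x h1 h2
    rw [show c p.1 * c p.2 * (φ p.1 x * φ p.2 x) = (c p.1 * φ p.1 x) * (c p.2 * φ p.2 x) by ring,
      norm_mul, norm_mul, norm_mul]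
    simp only [Real.norm_eq_abs]
    have := hw0 p.1
    gcongr
  have hInt : ∀ p : ι × ι, Integrable (fun x => c p.1 * c p.2 * (φ p.1 x * φ p.2 x)) μ := fun p =>
    Integrable.of_bound (((hφ p.1).mul (hφ p.2)).const_mul _) _ (hb p)
  have hs : Summable fun p : ι × ι => (|c p.1| * w p.1) * (|c p.2| * w p.2) :=
    summable_mul_of_summable_norm hc.norm hc.norm
  have key := hasSum_integral_of_summable_integral_norm hInt (by
    refine Summable.of_nonneg_of_le (fun p => integral_nonneg fun _ => norm_nonneg _)
      (fun p => ?_) (hs.mul_right (μ.real univ))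
    have := integral_mono_ae (hInt p).norm (integrable_const _) (hb p)
    simpa [mul_comm] using this)
  have e1 : ∀ p : ι × ι, ∫ x, c p.1 * c p.2 * (φ p.1 x * φ p.2 x) ∂μ =
      c p.1 * c p.2 * ∫ x, φ p.1 x * φ p.2 x ∂μ := fun p => integral_const_mul _ _
  have e2 : ∫ x, ∑' p : ι × ι, c p.1 * c p.2 * (φ p.1 x * φ p.2 x) ∂μ =
      ∫ x, (∑' i, c i * φ i x) ^ 2 ∂μ := by
    refine integral_congr_ae ?_
    filter_upwards [ae_all_iff.2 hw] with x hx
    have hsx : Summable fun i => ‖c i * φ i x‖ := by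
      refine Summable.of_nonneg_of_le (fun _ => norm_nonneg _) (fun i => ?_) hc
      rw [norm_mul]
      exact mul_le_mul_of_nonneg_left (hx i) (abs_nonneg _)
    rw [sq, tsum_mul_tsum_of_summable_norm hsx hsx]
    exact tsum_congr fun p => by ring
  simp only [e1, e2] at key
  exact key

/-- If the off-diagonal terms vanish, the integral of the square is a sum of squares. -/
lemma integral_sq_of_orthogonal {ι X : Type*} [Countable ι] [MeasurableSpace X] {μ : Measure X}
    [IsFiniteMeasure μ] {φ : ι → X → ℝ} {c w : ι → ℝ} (hφ : ∀ i, AEStronglyMeasurable (φ i) μ)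
    (hw : ∀ i, ∀ᵐ x ∂μ, |φ i x| ≤ w i) (hw0 : ∀ i, 0 ≤ w i) (hc : Summable fun i => |c i| * w i)
    (horth : ∀ i j, i ≠ j → c i * c j * ∫ x, φ i x * φ j x ∂μ = 0) :
    HasSum (fun i => c i ^ 2 * ∫ x, φ i x ^ 2 ∂μ) (∫ x, (∑' i, c i * φ i x) ^ 2 ∂μ) := by
  have h := hasSum_integral_sq hφ hw hw0 hc
  have hinj : Function.Injective fun i : ι => (i, i) := fun i j hij => (Prod.ext_iff.1 hij).1
  have h2 := (hinj.hasSum_iff (f := fun p : ι × ι => c p.1 * c p.2 * ∫ x, φ p.1 x * φ p.2 x ∂μ)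
    (a := ∫ x, (∑' i, c i * φ i x) ^ 2 ∂μ) (fun p hp => by
      refine horth p.1 p.2 fun hne => hp ⟨p.1, Prod.ext rfl hne⟩)).2 h
  simpa only [Function.comp_def, ← sq] using h2

/-! ### The `L₂` norm in terms of the coefficients -/

lemma cube_eq_pi (r : ℕ) : cube r = Set.univ.pi fun _ : Fin r => Icc (0 : ℝ) 1 := by
  ext x; simp only [cube, mem_ofPred_eq, mem_univ_pi]

lemma measurableSet_cube (r : ℕ) : MeasurableSet (cube r) := by
  rw [cube_eq_pi]; exact MeasurableSet.univ_pi fun _ => measurableSet_Icc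

lemma isCompact_cube (r : ℕ) : IsCompact (cube r) := by
  rw [cube_eq_pi]; exact isCompact_univ_pi fun _ => isCompact_Icc

instance isFiniteMeasure_cube (r : ℕ) : IsFiniteMeasure (volume.restrict (cube r)) :=
  ⟨by rw [Measure.restrict_apply_univ]; exact (isCompact_cube r).measure_lt_top⟩

lemma volume_real_cube (r : ℕ) : (volume.restrict (cube r)).real univ = 1 := by
  rw [measureReal_def, Measure.restrict_apply_univ, cube_eq_pi, volume_pi_pi]; simp

lemma integral_cube_prod {r : ℕ} (φ : Fin r → ℝ → ℝ) :
    ∫ x in cube r, ∏ k, φ k (x k) = ∏ k, ∫ t in Icc (0 : ℝ) 1, φ k t := by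
  rw [cube_eq_pi, volume_pi, Measure.restrict_pi_pi, integral_fintype_prod_eq_prod]

lemma continuous_basisProd {r m : ℕ} (α i : Fin r → ℕ) :
    Continuous fun x : Fin r → ℝ => ∏ k, basisDer m (α k) (i k) (x k) :=
  continuous_finsetProd _ fun k _ => (continuous_basisDer m _ _).comp (continuous_apply k)

lemma prod_inv_pow_eq {r : ℕ} (C : ℝ) (m : ℕ) (i : Fin r → ℕ) :
    (∏ k, (C * ((i k : ℝ) + 1)⁻¹ ^ m)) ^ 2 =
      C ^ (2 * r) * ((∏ k, ((i k : ℝ) + 1))⁻¹) ^ (2 * m) := by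
  rw [Finset.prod_mul_distrib, Finset.prod_const, Finset.prod_pow, Finset.prod_inv_distrib,
    mul_pow, ← pow_mul, ← pow_mul]
  simp [mul_comm]

/-- The `L₂` norm of the function with coefficients `h` is bounded by a weighted `ℓ²` norm. -/
lemma exists_integral_sq_le {m : ℕ} (hm : 1 ≤ m) (r : ℕ) : ∃ C : ℝ, 0 < C ∧ ∀ h : (Fin r → ℕ) → ℝ,
    (Summable fun i => h i ^ 2) →
    ∫ x in cube r, (∑' i, h i * ∏ k, basisDer m 0 (i k) (x k)) ^ 2 ≤
      C * ∑' i, h i ^ 2 * ((∏ k, ((i k : ℝ) + 1))⁻¹) ^ (2 * m) := by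
  classical
  obtain ⟨C, hC, hCb⟩ := exists_abs_basisDer_le m
  set w : (Fin r → ℕ) → ℝ := fun i => ∏ k, (C * ((i k : ℝ) + 1)⁻¹ ^ m) with hwdef
  have hw0 : ∀ i, 0 ≤ w i := fun i => by positivity
  have hw2 : Summable fun i => w i ^ 2 := by
    refine summable_sq_prod_pi (a := fun _ j => C * ((j : ℝ) + 1)⁻¹ ^ m) fun _ => ?_
    refine Summable.of_nonneg_of_le (fun _ => sq_nonneg _) (fun j => ?_) (summable_sq_inv_succ C)
    have h1 : ((j : ℝ) + 1)⁻¹ ≤ 1 :=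
      inv_le_one_of_one_le₀ (by linarith [(Nat.cast_nonneg j : (0 : ℝ) ≤ j)])
    have h2 : ((j : ℝ) + 1)⁻¹ ^ m ≤ ((j : ℝ) + 1)⁻¹ :=
      pow_le_of_le_one (by positivity) h1 (by omega)
    gcongr
  have hwb : ∀ i, ∀ x ∈ cube r, |∏ k, basisDer m 0 (i k) (x k)| ≤ w i := by
    intro i x hx
    rw [Finset.abs_prod]
    refine Finset.prod_le_prod (fun _ _ => abs_nonneg _) fun k _ => ?_
    simpa using hCb 0 (Nat.zero_le _) (i k) (x k) (unit_subset_Icc (hx k))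
  have hae : ∀ i, ∀ᵐ x ∂(volume.restrict (cube r)), |∏ k, basisDer m 0 (i k) (x k)| ≤ w i :=
    fun i => (ae_restrict_mem (measurableSet_cube r)).mono fun x hx => hwb i x hx
  -- Bernoulli polynomials and trigonometric functions need not be orthogonal in L₂. The
  -- multi-indices are split into finitely many classes by truncation at `m + 1`; inside a class
  -- distinct products are orthogonal.
  set T := Fin r → Fin (m + 2)
  set fam : (Fin r → ℕ) → T := fun i k => ⟨min (i k) (m + 1), by omega⟩ with hfam
  -- One factor comes from Cauchy–Schwarz over the classes, the other from bounding each class by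
  -- the full series.
  refine ⟨(Fintype.card T) * (Fintype.card T) * C ^ (2 * r), ?_, fun h hsq => ?_⟩
  · have : 0 < Fintype.card T := Fintype.card_pos
    positivity
  set hT : T → (Fin r → ℕ) → ℝ := fun τ i => if fam i = τ then h i else 0 with hhT
  have hTle : ∀ τ i, |hT τ i| ≤ |h i| := by
    intro τ i; simp only [hhT]; split_ifs <;> simp
  have hsum : Summable fun i => |h i| * w i := by
    simpa only [abs_of_nonneg (hw0 _)] using summable_mul_of_sq (hsq) hw2
  have hsumT : ∀ τ, Summable fun i => |hT τ i| * w i := fun τ =>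
    Summable.of_nonneg_of_le (fun i => mul_nonneg (abs_nonneg _) (hw0 i))
      (fun i => mul_le_mul_of_nonneg_right (hTle τ i) (hw0 i)) hsum
  have hmeas : ∀ i : Fin r → ℕ, AEStronglyMeasurable
      (fun x : Fin r → ℝ => ∏ k, basisDer m 0 (i k) (x k)) (volume.restrict (cube r)) :=
    fun i => (continuous_basisProd (fun _ => 0) i).aestronglyMeasurable
  have hweight : Summable fun i => h i ^ 2 * w i ^ 2 := by
    refine Summable.of_nonneg_of_le (fun i => by positivity) (fun i => ?_)
      ((hsq).mul_right (C ^ (2 * r)))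
    have : w i ^ 2 ≤ C ^ (2 * r) := by
      rw [hwdef]
      simp only [prod_inv_pow_eq]
      refine mul_le_of_le_one_right (by positivity) (pow_le_one₀ (by positivity) ?_)
      refine inv_le_one_of_one_le₀ ?_
      exact_mod_cast Nat.one_le_iff_ne_zero.2
        (Finset.prod_ne_zero_iff.2 fun k _ => Nat.succ_ne_zero (i k))
    gcongr
  have hone : ∀ τ, ∫ x in cube r, (∑' i, hT τ i * ∏ k, basisDer m 0 (i k) (x k)) ^ 2 ≤
      ∑' i, h i ^ 2 * w i ^ 2 := by
    intro τ
    have hs := integral_sq_of_orthogonal hmeas hae hw0 (hsumT τ) (fun i j hij => by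
      simp only [hhT]
      by_cases h1 : fam i = τ
      swap
      · rw [if_neg h1, zero_mul, zero_mul]
      by_cases h2 : fam j = τ
      swap
      · rw [if_neg h2, mul_zero, zero_mul]
      simp_rw [← Finset.prod_mul_distrib]
      rw [integral_cube_prod fun k t => basisDer m 0 (i k) t * basisDer m 0 (j k) t]
      obtain ⟨k, hk⟩ := Function.ne_iff.1 hij
      rw [Finset.prod_eq_zero (Finset.mem_univ k), mul_zero]
      refine integral_basisDer_mul_eq_zero hk ?_
      have := congrFun (h1.trans h2.symm) k
      simpa [hfam] using this)
    rw [← hs.tsum_eq]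
    refine hs.summable.tsum_le_tsum (fun i => ?_) hweight
    have e1 : hT τ i ^ 2 ≤ h i ^ 2 := sq_le_sq.2 (hTle τ i)
    have e2 : ∫ x in cube r, (∏ k, basisDer m 0 (i k) (x k)) ^ 2 ≤ w i ^ 2 := by
      have := setIntegral_mono_on (μ := volume) (s := cube r)
        (f := fun x => (∏ k, basisDer m 0 (i k) (x k)) ^ 2) (g := fun _ => w i ^ 2)
        (((continuous_basisProd (fun _ => 0) i).pow 2).continuousOn.integrableOn_compact
          (isCompact_cube r)) (integrable_const _) (measurableSet_cube r) (fun x hx => by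
            rw [← sq_abs]
            exact pow_le_pow_left₀ (abs_nonneg _) (hwb i x hx) 2)
      rw [integral_const, volume_real_cube] at this
      simpa using this
    exact mul_le_mul e1 e2 (integral_nonneg fun _ => sq_nonneg _) (sq_nonneg _)
  have hdecomp : ∀ x ∈ cube r, ∑' i, h i * ∏ k, basisDer m 0 (i k) (x k) =
      ∑ τ, ∑' i, hT τ i * ∏ k, basisDer m 0 (i k) (x k) := by
    intro x hx
    rw [← Summable.tsum_finsetSum]
    · congr 1; ext i
      rw [← Finset.sum_mul]
      congr 1
      simp only [hhT]
      rw [Finset.sum_eq_single (fam i) (fun τ _ hτ => if_neg hτ.symm)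
        (fun h => absurd (Finset.mem_univ _) h), if_pos rfl]
    · intro τ _
      refine Summable.of_norm_bounded (hsumT τ) fun i => ?_
      rw [norm_mul]
      exact mul_le_mul_of_nonneg_left (hwb i x hx) (abs_nonneg _)
  have hcont : ∀ τ, ContinuousOn (fun x => (∑' i, hT τ i * ∏ k, basisDer m 0 (i k) (x k)) ^ 2)
      (cube r) := by
    intro τ
    refine ContinuousOn.pow (continuousOn_tsum
      (fun i => ((continuous_basisProd (fun _ => 0) i).const_mul _).continuousOn) (hsumT τ)
      fun i x hx => ?_) 2
    rw [norm_mul]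
    exact mul_le_mul_of_nonneg_left (hwb i x hx) (abs_nonneg _)
  have hInt : ∀ τ, IntegrableOn (fun x => (∑' i, hT τ i * ∏ k, basisDer m 0 (i k) (x k)) ^ 2)
      (cube r) := fun τ => (hcont τ).integrableOn_compact (isCompact_cube r)
  calc ∫ x in cube r, (∑' i, h i * ∏ k, basisDer m 0 (i k) (x k)) ^ 2
      = ∫ x in cube r, (∑ τ, ∑' i, hT τ i * ∏ k, basisDer m 0 (i k) (x k)) ^ 2 :=
        setIntegral_congr_fun (measurableSet_cube r) fun x hx => by simp only [hdecomp x hx]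
    _ ≤ ∫ x in cube r, (Fintype.card T : ℝ) *
          ∑ τ, (∑' i, hT τ i * ∏ k, basisDer m 0 (i k) (x k)) ^ 2 := by
        refine integral_mono_of_nonneg (Eventually.of_forall fun _ => sq_nonneg _)
          ((integrable_finsetSum _ fun τ _ => hInt τ).const_mul _)
          (Eventually.of_forall fun x => ?_)
        exact sq_sum_le_card_mul_sum_sq
    _ = (Fintype.card T : ℝ) *
          ∑ τ, ∫ x in cube r, (∑' i, hT τ i * ∏ k, basisDer m 0 (i k) (x k)) ^ 2 := by
        rw [integral_const_mul, integral_finsetSum _ fun τ _ => hInt τ]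
    _ ≤ (Fintype.card T : ℝ) * ∑ _τ : T, ∑' i, h i ^ 2 * w i ^ 2 := by
        gcongr with τ
        exact hone τ
    _ = _ := by
        rw [Finset.sum_const, Finset.card_univ, nsmul_eq_mul]
        simp only [hwdef, prod_inv_pow_eq]
        simp_rw [mul_left_comm (_ ^ 2) (C ^ (2 * r))]
        rw [tsum_mul_left]
        ring

/-! ### Functions in `H_q` -/

section

variable {r m q : ℕ}

lemma continuousOn_inner_evalVec (hm : 1 ≤ m) (h : CoefSpace r) :
    ContinuousOn (fun x => inner ℝ h (evalVec m (fun _ => 0) x)) (cube r) := by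
  obtain ⟨v, hv0, hv, hvb⟩ := exists_evalVec_bound r m
  have : ContinuousOn (fun x : Fin r → ℝ => ∑' i, h i * ∏ k, basisDer m 0 (i k) (x k)) (cube r) := by
    refine continuousOn_tsum
      (fun i => ((continuous_basisProd (fun _ => 0) i).const_mul _).continuousOn)
      (summable_mul_of_sq (summable_sq_lp h) hv) fun i x hx => ?_
    rw [norm_mul, Real.norm_eq_abs, Real.norm_eq_abs, abs_of_nonneg (hv0 i)]
    exact mul_le_mul_of_nonneg_left (hvb _ (fun _ => hm) _ (mem_Icc_of_mem_cube hx) i)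
      (abs_nonneg _)
  refine this.congr fun x hx => ?_
  exact (hasSum_inner_evalVec (α := fun _ => 0) (fun _ => hm) (mem_Icc_of_mem_cube hx) h).tsum_eq.symm

lemma Realizes.continuousOn (hm : 1 ≤ m) {h : CoefSpace r} {f : (Fin r → ℝ) → ℝ}
    (hf : Realizes m q h f) : ContinuousOn f (cube r) :=
  (continuousOn_inner_evalVec hm h).congr hf.2

lemma Realizes.add_smul {h k : CoefSpace r} {f g : (Fin r → ℝ) → ℝ} (hf : Realizes m q h f)
    (hg : Realizes m q k g) (a : ℝ) : Realizes m q (h + a • k) fun x => f x + a * g x :=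
  ⟨Submodule.add_mem _ hf.1 (Submodule.smul_mem _ a hg.1), fun x hx => by
    rw [inner_add_left, real_inner_smul_left, ← hf.2 x hx, ← hg.2 x hx]⟩

lemma Realizes.sum {ι : Type*} (S : Finset ι) {h : ι → CoefSpace r} {f : ι → (Fin r → ℝ) → ℝ}
    (hf : ∀ i ∈ S, Realizes m q (h i) (f i)) (b : ι → ℝ) :
    Realizes m q (∑ i ∈ S, b i • h i) fun x => ∑ i ∈ S, b i * f i x :=
  ⟨Submodule.sum_mem _ fun i hi => Submodule.smul_mem _ _ (hf i hi).1, fun x hx => by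
    rw [sum_inner]
    exact Finset.sum_congr rfl fun i hi => by rw [real_inner_smul_left, (hf i hi).2 x hx]⟩

lemma integrableOn_mul_dens {f : (Fin r → ℝ) → ℝ} (hf : ContinuousOn f (cube r))
    {dens : (Fin r → ℝ) → ℝ} (hd : Measurable dens) {C : ℝ}
    (hC : ∀ x ∈ cube r, C⁻¹ ≤ dens x ∧ dens x ≤ C) (hC0 : 1 ≤ C) :
    IntegrableOn (fun x => f x * dens x) (cube r) := by
  refine (hf.integrableOn_compact (isCompact_cube r)).mul_bdd (c := C)
    hd.aestronglyMeasurable ?_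
  filter_upwards [ae_restrict_mem (measurableSet_cube r)] with x hx
  have : 0 ≤ C⁻¹ := by positivity
  rw [Real.norm_eq_abs, abs_of_nonneg (this.trans (hC x hx).1)]
  exact (hC x hx).2

/-- The eigenvalues decay at least as fast as `(∏ i_k)^(-2m)`. -/
lemma exists_eigenvalue_le (hm : 1 ≤ m) {dens : (Fin r → ℝ) → ℝ} (hd : Measurable dens)
    (hdb : ∃ C : ℝ, 1 ≤ C ∧ ∀ x ∈ cube r, C⁻¹ ≤ dens x ∧ dens x ≤ C)
    {ρ : (Fin r → ℕ) → ℝ} {ψ : (Fin r → ℕ) → (Fin r → ℝ) → ℝ}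
    (heig : IsEigensystem r m q dens ρ ψ) : ∃ C : ℝ, 0 < C ∧ ∀ j ∈ anovaIndex r q,
      ρ j ≤ C * ((∏ k, (j k : ℝ))⁻¹) ^ (2 * m) := by
  classical
  obtain ⟨Cd, hCd, hCdb⟩ := hdb
  obtain ⟨Co, hCo⟩ := heig.ordered
  obtain ⟨CL, hCL, hL⟩ := exists_integral_sq_le hm r
  have hreal : ∀ i : Fin r → ℕ, ∃ h, i ∈ anovaIndex r q → Realizes m q h (ψ i) := by
    intro i
    by_cases hi : i ∈ anovaIndex r q
    · obtain ⟨h, hh⟩ := (memH_iff hm).1 (heig.mem i hi)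
      exact ⟨h, fun _ => hh⟩
    · exact ⟨0, fun h => absurd h hi⟩
  choose Ψ hΨ using hreal
  have hCo1 : ∀ j ∈ anovaIndex r q, 0 < Co := by
    intro j hj
    have h1 := hCo j hj j hj le_rfl
    have h2 := heig.pos j hj
    by_contra hcon
    nlinarith
  -- The absolute value and the summand 1 make the constant positive before any index is available
  -- to show `0 < Co`.
  refine ⟨Cd * CL * |Co| + 1, by positivity, fun j hj => ?_⟩
  have hCo0 := hCo1 j hj
  have hjpos : ∀ i ∈ anovaIndex r q, 0 < ∏ k, i k := fun i hi =>
    Finset.prod_pos fun k _ => hi.1 k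
  set N := ∏ k, j k with hN
  have hfin : {i | i ∈ anovaIndex r q ∧ ∏ k, i k ≤ N}.Finite := by
    refine (Set.Finite.pi' (fun _ : Fin r => Set.finite_Iic N)).subset fun i hi k => ?_
    have : i k ∣ ∏ k, i k := Finset.dvd_prod_of_mem _ (Finset.mem_univ k)
    exact (Nat.le_of_dvd (hjpos i hi.1) this).trans hi.2
  set S := hfin.toFinset with hS
  have hSmem : ∀ i, i ∈ S ↔ i ∈ anovaIndex r q ∧ ∏ k, i k ≤ N := fun i => by simp [hS]
  -- Min–max without counting asymptotics: `S` contains `j` and `L` does not, so the eigenfunctions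
  -- labelled by `S` outnumber by at least one the tensor coefficients labelled by `L`.
  set L := S.filter fun i => ∏ k, i k < N with hLdef
  have hcard : L.card < S.card := by
    refine Finset.card_lt_card (Finset.filter_ssubset.2 ⟨j, (hSmem j).2 ⟨hj, le_rfl⟩, ?_⟩)
    exact lt_irrefl _
  -- A nonzero combination in the kernel has no tensor coefficient below the cross of size `N`. The
  -- shift by one translates labels starting at 1 into basis indices starting at 0.
  let A : (S → ℝ) →ₗ[ℝ] (L → ℝ) :=
    { toFun := fun b l => ∑ i : S, b i * Ψ i (fun k => l.1 k - 1)
      map_add' := fun b b' => by ext l; simp [add_mul, Finset.sum_add_distrib]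
      map_smul' := fun c b => by ext l; simp [Finset.mul_sum, mul_assoc] }
  have hker : LinearMap.ker A ≠ ⊥ := by
    refine LinearMap.ker_ne_bot_of_finrank_lt ?_
    simpa using hcard
  obtain ⟨b, hbker, hb0⟩ := Submodule.exists_mem_ne_zero_of_ne_bot hker
  have hSψ : ∀ i : S, i.1 ∈ anovaIndex r q := fun i => ((hSmem i.1).1 i.2).1
  set h : CoefSpace r := ∑ i : S, b i • Ψ i.1 with hh
  set f : (Fin r → ℝ) → ℝ := fun x => ∑ i : S, b i * ψ i.1 x with hf
  have hfr : Realizes m q h f := Realizes.sum Finset.univ (fun i _ => hΨ i.1 (hSψ i)) b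
  have hgram : ∀ i : S, inner ℝ (Ψ i.1) h = b i / ρ i := by
    intro i
    rw [hh, inner_sum, Finset.sum_eq_single i]
    · rw [real_inner_smul_right, ← innerH_eq hm (hΨ _ (hSψ i)) (hΨ _ (hSψ i)),
        heig.eigen _ (hSψ i) _ (heig.mem _ (hSψ i)), heig.orthonormal _ (hSψ i) _ (hSψ i),
        if_pos rfl]
      ring
    · intro l _ hl
      rw [real_inner_smul_right, ← innerH_eq hm (hΨ _ (hSψ i)) (hΨ _ (hSψ l)),
        heig.eigen _ (hSψ i) _ (heig.mem _ (hSψ l)), heig.orthonormal _ (hSψ i) _ (hSψ l),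
        if_neg fun h => hl (Subtype.ext h).symm]
      simp
    · simp
  have hnorm : ‖h‖ ^ 2 = ∑ i : S, b i ^ 2 / ρ i := by
    rw [← real_inner_self_eq_norm_sq]
    nth_rw 1 [hh]
    rw [sum_inner]
    refine Finset.sum_congr rfl fun i _ => ?_
    rw [real_inner_smul_left, hgram]
    ring
  have hL2 : innerL2 dens f f = ∑ i : S, b i ^ 2 := by
    have h1 : ∀ i : S, innerL2 dens (ψ i.1) f = b i := by
      intro i
      have := heig.eigen _ (hSψ i) f ((memH_iff hm).2 ⟨h, hfr⟩)
      rw [innerH_eq hm (hΨ _ (hSψ i)) hfr, hgram] at this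
      have hp := heig.pos _ (hSψ i)
      field_simp at this
      exact this.symm
    have h2 : innerL2 dens f f = ∑ i : S, b i * innerL2 dens (ψ i.1) f := by
      simp only [innerL2]
      simp_rw [← integral_const_mul]
      rw [← integral_finsetSum]
      · congr 1; ext x
        simp only [hf, Finset.sum_mul]
        exact Finset.sum_congr rfl fun i _ => by ring
      · intro i _
        exact (integrableOn_mul_dens (((hΨ _ (hSψ i)).continuousOn hm).mul (hfr.continuousOn hm))
          hd hCdb hCd).const_mul _
    rw [h2]
    exact Finset.sum_congr rfl fun i _ => by rw [h1]; ring
  have hbpos : 0 < ∑ i : S, b i ^ 2 := by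
    obtain ⟨i, hi⟩ := Function.ne_iff.1 hb0
    exact Finset.sum_pos' (fun _ _ => sq_nonneg _) ⟨i, Finset.mem_univ _, by
      have : b i ≠ 0 := hi
      positivity⟩
  have hNpos : (0 : ℝ) < N := by exact_mod_cast hjpos j hj
  -- Three cases: too many active coordinates, where membership in `hSpace` gives zero; product
  -- below `N`, where the kernel gives zero; and otherwise the weight is small enough.
  have hcoef : ∀ i : Fin r → ℕ, h i ^ 2 * ((∏ k, ((i k : ℝ) + 1))⁻¹) ^ (2 * m) ≤
      h i ^ 2 * ((N : ℝ)⁻¹) ^ (2 * m) := by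
    intro i
    by_cases hq : q < (Finset.univ.filter fun k => i k ≠ 0).card
    · rw [hSpace_apply_eq_zero hm hfr.1 hq]; simp
    · have hi : (fun k => i k + 1) ∈ anovaIndex r q := by
        refine ⟨fun k => by simp, ?_⟩
        have : (Finset.univ.filter fun k => 1 < i k + 1) =
            Finset.univ.filter fun k => i k ≠ 0 := by
          ext k; simp [Nat.pos_iff_ne_zero]
        rw [this]
        omega
      by_cases hlt : ∏ k, (i k + 1) < N
      · have hmem : (fun k => i k + 1) ∈ L := by
          rw [hLdef, Finset.mem_filter, hSmem]
          exact ⟨⟨hi, hlt.le⟩, hlt⟩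
        have := congrFun (LinearMap.mem_ker.1 hbker) ⟨_, hmem⟩
        have h0 : h i = 0 := by
          rw [hh, lp.coeFn_sum, Finset.sum_apply]
          simpa [A] using this
        rw [h0]; simp
      · have hle : (N : ℝ) ≤ ∏ k, ((i k : ℝ) + 1) := by exact_mod_cast not_lt.1 hlt
        have := inv_anti₀ hNpos hle
        have h3 : 0 ≤ (∏ k, ((i k : ℝ) + 1))⁻¹ := by positivity
        gcongr
  have hbound : ∑ i : S, b i ^ 2 ≤ Cd * (CL * (‖h‖ ^ 2 * ((N : ℝ)⁻¹) ^ (2 * m))) := by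
    rw [← hL2]
    have e1 : innerL2 dens f f ≤ ∫ x in cube r, Cd * f x ^ 2 := by
      have hc := hfr.continuousOn hm
      refine setIntegral_mono_on (integrableOn_mul_dens (hc.mul hc) hd hCdb hCd)
        (((hc.pow 2).integrableOn_compact (isCompact_cube r)).const_mul _) (measurableSet_cube r)
        fun x hx => ?_
      nlinarith [(hCdb x hx).2, sq_nonneg (f x)]
    rw [integral_const_mul] at e1
    refine e1.trans (mul_le_mul_of_nonneg_left ?_ (by positivity))
    have e2 : ∫ x in cube r, f x ^ 2 =
        ∫ x in cube r, (∑' i, h i * ∏ k, basisDer m 0 (i k) (x k)) ^ 2 :=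
      setIntegral_congr_fun (measurableSet_cube r) fun x hx => by
        simp only
        rw [hfr.2 x hx, (hasSum_inner_evalVec (α := fun _ => 0) (fun _ => hm)
          (mem_Icc_of_mem_cube hx) h).tsum_eq]
    rw [e2]
    refine (hL h (summable_sq_lp h)).trans (mul_le_mul_of_nonneg_left ?_ hCL.le)
    have hs := (hasSum_norm_sq_lp h).mul_right (((N : ℝ)⁻¹) ^ (2 * m))
    rw [← hs.tsum_eq]
    exact Summable.tsum_le_tsum hcoef (Summable.of_nonneg_of_le
      (fun i => by positivity) hcoef hs.summable) hs.summable
  -- The labelling assumption enters here: every `i` in `S` has product at most `N`, so its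
  -- eigenvalue is at least `ρ j / Co`. With `hbound` this sandwiches the L₂ norm and forces the
  -- decay of `ρ j`.
  have hnormle : ‖h‖ ^ 2 ≤ Co / ρ j * ∑ i : S, b i ^ 2 := by
    rw [hnorm, Finset.mul_sum]
    refine Finset.sum_le_sum fun i _ => ?_
    have h1 := hCo i.1 (hSψ i) j hj ((hSmem i.1).1 i.2).2
    have h2 := heig.pos _ (hSψ i)
    have h3 := heig.pos _ hj
    rw [div_mul_eq_mul_div, div_le_div_iff₀ h2 h3]
    nlinarith [sq_nonneg (b i)]
  have hρ := heig.pos j hj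
  have hNm : (0 : ℝ) < ((N : ℝ)⁻¹) ^ (2 * m) := by positivity
  have hfinal : ∑ i : S, b i ^ 2 ≤
      (Cd * CL * Co * ((N : ℝ)⁻¹) ^ (2 * m) / ρ j) * ∑ i : S, b i ^ 2 := by
    refine hbound.trans ?_
    calc Cd * (CL * (‖h‖ ^ 2 * ((N : ℝ)⁻¹) ^ (2 * m)))
        ≤ Cd * (CL * ((Co / ρ j * ∑ i : S, b i ^ 2) * ((N : ℝ)⁻¹) ^ (2 * m))) := by gcongr
      _ = _ := by ring
  have h1 : 1 ≤ Cd * CL * Co * ((N : ℝ)⁻¹) ^ (2 * m) / ρ j := by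
    by_contra hcon
    push Not at hcon
    nlinarith
  rw [le_div_iff₀ hρ, one_mul] at h1
  have hcast : (∏ k, (j k : ℝ)) = (N : ℝ) := by rw [hN]; push_cast; rfl
  rw [hcast]
  refine h1.trans ?_
  rw [abs_of_pos hCo0]
  nlinarith

end

/-! ### Sums over hyperbolic crosses -/

/-- The growth of weighted hyperbolic cross sums when `p` coordinates carry the largest
exponent `A`. -/
def crossGrowth (A m p : ℕ) (M : ℝ) : ℝ :=
  if M < 1 then M ^ (2 * m) else if p = 0 then M ^ A else M ^ (A + 1) * (1 + Real.log M) ^ (p - 1)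

lemma crossGrowth_of_lt {A m p : ℕ} {M : ℝ} (h : M < 1) : crossGrowth A m p M = M ^ (2 * m) :=
  if_pos h

lemma crossGrowth_zero {A m : ℕ} {M : ℝ} (h : 1 ≤ M) : crossGrowth A m 0 M = M ^ A := by
  rw [crossGrowth, if_neg (not_lt.2 h), if_pos rfl]

lemma crossGrowth_succ {A m p : ℕ} {M : ℝ} (h : 1 ≤ M) :
    crossGrowth A m (p + 1) M = M ^ (A + 1) * (1 + Real.log M) ^ p := by
  rw [crossGrowth, if_neg (not_lt.2 h), if_neg (Nat.succ_ne_zero p), Nat.add_sub_cancel]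

lemma crossGrowth_nonneg {A m p : ℕ} {M : ℝ} (h : 0 < M) : 0 ≤ crossGrowth A m p M := by
  unfold crossGrowth
  split_ifs with h1 h2
  · positivity
  · positivity
  · have := Real.log_nonneg (not_lt.1 h1)
    positivity

lemma pow_succ_le_crossGrowth {A m p : ℕ} {M : ℝ} (h : 1 ≤ M) :
    M ^ (A + 1) ≤ crossGrowth A m (p + 1) M := by
  rw [crossGrowth_succ h]
  exact le_mul_of_one_le_right (by positivity)
    (one_le_pow₀ (by linarith [Real.log_nonneg h]))

lemma pow_le_crossGrowth {A m p : ℕ} {M : ℝ} (h : 1 ≤ M) : M ^ A ≤ crossGrowth A m p M := by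
  cases p with
  | zero => rw [crossGrowth_zero h]
  | succ p => exact (pow_le_pow_right₀ h (Nat.le_succ A)).trans (pow_succ_le_crossGrowth h)

lemma sum_inv_sq_le (n : ℕ) : ∑ j ∈ Finset.range n, (((j : ℝ) + 1) ^ 2)⁻¹ ≤ 2 := by
  have h := sum_Ioo_inv_sq_le (α := ℝ) 0 (n + 1)
  have e : ∑ j ∈ Finset.range n, (((j : ℝ) + 1) ^ 2)⁻¹ =
      ∑ i ∈ Finset.Ioo 0 (n + 1), ((i : ℝ) ^ 2)⁻¹ := by
    refine Finset.sum_bij (fun j _ => j + 1) ?_ ?_ ?_ ?_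
    · intro j hj; simp at hj ⊢; omega
    · intro j _ j' _ h; omega
    · intro i hi
      simp only [Finset.mem_Ioo] at hi
      exact ⟨i - 1, by simp; omega, by omega⟩
    · intro j _; push_cast; rfl
  rw [e]; simpa using h

lemma sum_inv_sq_tail_le {M : ℝ} (hM : 1 ≤ M) (n : ℕ) :
    ∑ j ∈ Finset.range n, (if M < (j : ℝ) + 1 then (((j : ℝ) + 1) ^ 2)⁻¹ else 0) ≤ 2 / M := by
  have h := sum_Ioo_inv_sq_le (α := ℝ) ⌊M⌋₊ (n + 1)
  rw [← Finset.sum_filter]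
  have e : ∑ j ∈ (Finset.range n).filter (fun j : ℕ => M < (j : ℝ) + 1), (((j : ℝ) + 1) ^ 2)⁻¹ ≤
      ∑ i ∈ Finset.Ioo ⌊M⌋₊ (n + 1), ((i : ℝ) ^ 2)⁻¹ := by
    refine le_of_eq (Finset.sum_bij (fun j _ => j + 1) ?_ ?_ ?_ ?_)
    · intro j hj
      simp only [Finset.mem_filter, Finset.mem_range, Finset.mem_Ioo] at hj ⊢
      refine ⟨(Nat.floor_lt (by linarith)).2 (by push_cast; exact hj.2), by omega⟩
    · intro j _ j' _ h; omega
    · intro i hi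
      simp only [Finset.mem_Ioo] at hi
      obtain ⟨j, rfl⟩ : ∃ j, i = j + 1 := ⟨i - 1, by omega⟩
      refine ⟨j, ?_, rfl⟩
      simp only [Finset.mem_filter, Finset.mem_range]
      refine ⟨by omega, ?_⟩
      have := (Nat.floor_lt (by linarith)).1 hi.1
      push_cast at this; exact this
    · intro j _; push_cast; rfl
  refine e.trans (h.trans ?_)
  gcongr
  exact (Nat.lt_floor_add_one M).le

lemma sum_head_inv_le {M : ℝ} (hM : 1 ≤ M) (n : ℕ) :
    ∑ j ∈ Finset.range n, (if (j : ℝ) + 1 ≤ M then ((j : ℝ) + 1)⁻¹ else 0) ≤ 1 + Real.log M := by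
  have h := harmonic_floor_le_one_add_log M hM
  refine le_trans ?_ h
  rw [← Finset.sum_filter, harmonic]
  push_cast
  refine Finset.sum_le_sum_of_subset_of_nonneg (fun j hj => ?_) fun _ _ _ => by positivity
  simp only [Finset.mem_filter, Finset.mem_range] at hj ⊢
  exact (Nat.lt_iff_add_one_le).2 (Nat.le_floor (by push_cast; exact hj.2))

lemma sum_head_one_le {M : ℝ} (hM : 1 ≤ M) (n : ℕ) :
    ∑ j ∈ Finset.range n, (if (j : ℝ) + 1 ≤ M then (1 : ℝ) else 0) ≤ M := by
  rw [← Finset.sum_filter, Finset.sum_const, nsmul_eq_mul, mul_one]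
  refine le_trans ?_ (Nat.floor_le (by linarith : 0 ≤ M))
  have : ((Finset.range n).filter fun j : ℕ => (j : ℝ) + 1 ≤ M) ⊆ Finset.range ⌊M⌋₊ := by
    intro j hj
    simp only [Finset.mem_filter, Finset.mem_range] at hj ⊢
    exact (Nat.lt_iff_add_one_le).2 (Nat.le_floor (by push_cast; exact hj.2))
  exact_mod_cast (Finset.card_le_card this).trans (by simp)

/-- Past `M` the growth function is a pure power, and `a + 2 ≤ 2 * m` leaves the summable factor `(y
^ 2)⁻¹`. -/
lemma tail_term_le {A m p a : ℕ} (ha : a + 2 ≤ 2 * m) {M : ℝ} (hM : 0 < M) {y : ℝ} (hy : M < y) :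
    y ^ a * crossGrowth A m p (M / y) = M ^ (2 * m) * (y ^ (2 * m - a - 2))⁻¹ * (y ^ 2)⁻¹ := by
  have hy0 : 0 < y := hM.trans hy
  rw [crossGrowth_of_lt ((div_lt_one hy0).2 hy), div_pow]
  have : y ^ (2 * m) = y ^ a * y ^ (2 * m - a - 2) * y ^ 2 := by
    rw [← pow_add, ← pow_add]; congr 1; omega
  rw [this]
  field_simp

/-- Convolution of the growth function with a weight in one further coordinate. -/
lemma sum_crossGrowth_le {A m p a p' : ℕ} (hA : A + 2 ≤ 2 * m)
    (h : (a = A ∧ p' = p + 1) ∨ (a + 2 ≤ A ∧ p' = p)) {M : ℝ} (hM : 0 < M) (n : ℕ) :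
    ∑ j ∈ Finset.range n, ((j : ℝ) + 1) ^ a * crossGrowth A m p (M / ((j : ℝ) + 1)) ≤
      4 * crossGrowth A m p' M := by
  have ha : a + 2 ≤ 2 * m := by omega
  rcases lt_or_ge M 1 with hM1 | hM1
  · have hle : ∀ j : ℕ, ((j : ℝ) + 1) ^ a * crossGrowth A m p (M / ((j : ℝ) + 1)) ≤
        M ^ (2 * m) * (((j : ℝ) + 1) ^ 2)⁻¹ := by
      intro j
      have hj : (1 : ℝ) ≤ (j : ℝ) + 1 := by linarith [(Nat.cast_nonneg j : (0 : ℝ) ≤ j)]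
      rw [tail_term_le ha hM (lt_of_lt_of_le hM1 hj)]
      have : (((j : ℝ) + 1) ^ (2 * m - a - 2))⁻¹ ≤ 1 := inv_le_one_of_one_le₀ (one_le_pow₀ hj)
      have h2 : 0 ≤ M ^ (2 * m) := by positivity
      gcongr
      exact mul_le_of_le_one_right h2 this
    refine (Finset.sum_le_sum fun j _ => hle j).trans ?_
    rw [← Finset.mul_sum, crossGrowth_of_lt hM1]
    have h2 : 0 < M ^ (2 * m) := by positivity
    nlinarith [sum_inv_sq_le n]
  · have hlog := Real.log_nonneg hM1
    have htail : ∀ j : ℕ, M < (j : ℝ) + 1 →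
        ((j : ℝ) + 1) ^ a * crossGrowth A m p (M / ((j : ℝ) + 1)) ≤
          M ^ (a + 2) * (((j : ℝ) + 1) ^ 2)⁻¹ := by
      intro j hj
      rw [tail_term_le ha hM hj]
      have h1 : (((j : ℝ) + 1) ^ (2 * m - a - 2))⁻¹ ≤ (M ^ (2 * m - a - 2))⁻¹ := by
        gcongr
      have h2 : M ^ (2 * m) * (M ^ (2 * m - a - 2))⁻¹ = M ^ (a + 2) := by
        rw [show 2 * m = (a + 2) + (2 * m - a - 2) by omega, pow_add,
          show a + 2 + (2 * m - a - 2) - a - 2 = 2 * m - a - 2 by omega]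
        field_simp
      rw [← h2]
      gcongr
    have htailsum : ∑ j ∈ Finset.range n, (if M < (j : ℝ) + 1 then
        M ^ (a + 2) * (((j : ℝ) + 1) ^ 2)⁻¹ else 0) ≤ 2 * M ^ (a + 1) := by
      have := mul_le_mul_of_nonneg_left (sum_inv_sq_tail_le hM1 n)
        (by positivity : 0 ≤ M ^ (a + 2))
      rw [Finset.mul_sum] at this
      simp only [mul_ite, mul_zero] at this
      refine this.trans (le_of_eq ?_)
      rw [pow_succ]; field_simp
    have hMa : M ^ (a + 1) ≤ crossGrowth A m p' M := by
      rcases h with ⟨rfl, rfl⟩ | ⟨h1, rfl⟩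
      · exact pow_succ_le_crossGrowth hM1
      · exact (pow_le_pow_right₀ hM1 (by omega)).trans (pow_le_crossGrowth hM1)
    -- The tail already costs at most twice the target, so the factor 4 leaves as much for the head.
    suffices hhead : ∑ j ∈ Finset.range n, (if (j : ℝ) + 1 ≤ M then
        ((j : ℝ) + 1) ^ a * crossGrowth A m p (M / ((j : ℝ) + 1)) else 0) ≤
          2 * crossGrowth A m p' M by
      have hsplit : ∀ j : ℕ, ((j : ℝ) + 1) ^ a * crossGrowth A m p (M / ((j : ℝ) + 1)) ≤
          (if (j : ℝ) + 1 ≤ M then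
            ((j : ℝ) + 1) ^ a * crossGrowth A m p (M / ((j : ℝ) + 1)) else 0) +
          (if M < (j : ℝ) + 1 then M ^ (a + 2) * (((j : ℝ) + 1) ^ 2)⁻¹ else 0) := by
        intro j
        rcases le_or_gt ((j : ℝ) + 1) M with hj | hj
        · rw [if_pos hj, if_neg (not_lt.2 hj), add_zero]
        · rw [if_neg (not_le.2 hj), if_pos hj, zero_add]; exact htail j hj
      refine (Finset.sum_le_sum fun j _ => hsplit j).trans ?_
      rw [Finset.sum_add_distrib]
      linarith
    have hdiv : ∀ j : ℕ, (j : ℝ) + 1 ≤ M → 1 ≤ M / ((j : ℝ) + 1) := fun j hj =>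
      (one_le_div (by positivity)).2 hj
    -- If the new exponent is maximal, the head either counts about `M` equal terms or, when a
    -- maximal coordinate is already present, is a harmonic sum and yields one more logarithm.
    rcases h with ⟨rfl, rfl⟩ | ⟨h1, rfl⟩
    · cases p with
      | zero =>
        have hle : ∀ j ∈ Finset.range n, (if (j : ℝ) + 1 ≤ M then
            ((j : ℝ) + 1) ^ a * crossGrowth a m 0 (M / ((j : ℝ) + 1)) else 0) ≤
            M ^ a * (if (j : ℝ) + 1 ≤ M then (1 : ℝ) else 0) := by
          intro j _
          split_ifs with hj
          · rw [crossGrowth_zero (hdiv j hj), div_pow]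
            have : (0 : ℝ) < (j : ℝ) + 1 := by positivity
            field_simp
            exact le_rfl
          · simp
        refine (Finset.sum_le_sum hle).trans ?_
        rw [← Finset.mul_sum, crossGrowth_succ hM1, pow_zero, mul_one, pow_succ]
        have h3 : 0 < M ^ a := by positivity
        nlinarith [sum_head_one_le hM1 n]
      | succ p =>
        have hle : ∀ j ∈ Finset.range n, (if (j : ℝ) + 1 ≤ M then
            ((j : ℝ) + 1) ^ a * crossGrowth a m (p + 1) (M / ((j : ℝ) + 1)) else 0) ≤
            (M ^ (a + 1) * (1 + Real.log M) ^ p) *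
              (if (j : ℝ) + 1 ≤ M then ((j : ℝ) + 1)⁻¹ else 0) := by
          intro j _
          split_ifs with hj
          · have hj1 : (1 : ℝ) ≤ (j : ℝ) + 1 := by linarith [(Nat.cast_nonneg j : (0 : ℝ) ≤ j)]
            have hj0 : (0 : ℝ) < (j : ℝ) + 1 := by positivity
            rw [crossGrowth_succ (hdiv j hj), div_pow]
            have hl : Real.log (M / ((j : ℝ) + 1)) ≤ Real.log M :=
              Real.log_le_log (by positivity) (div_le_self hM.le hj1)
            have hl0 := Real.log_nonneg (hdiv j hj)
            have hp : (1 + Real.log (M / ((j : ℝ) + 1))) ^ p ≤ (1 + Real.log M) ^ p := by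
              gcongr
            calc ((j : ℝ) + 1) ^ a * (M ^ (a + 1) / ((j : ℝ) + 1) ^ (a + 1) *
                  (1 + Real.log (M / ((j : ℝ) + 1))) ^ p)
                = M ^ (a + 1) * ((j : ℝ) + 1)⁻¹ * (1 + Real.log (M / ((j : ℝ) + 1))) ^ p := by
                  rw [pow_succ ((j : ℝ) + 1)]; field_simp
              _ ≤ M ^ (a + 1) * ((j : ℝ) + 1)⁻¹ * (1 + Real.log M) ^ p := by gcongr
              _ = _ := by ring
          · simp
        refine (Finset.sum_le_sum hle).trans ?_
        rw [← Finset.mul_sum, crossGrowth_succ hM1, pow_succ (1 + Real.log M)]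
        have h3 : 0 ≤ M ^ (a + 1) * (1 + Real.log M) ^ p := by positivity
        have h4 := mul_le_mul_of_nonneg_left (sum_head_inv_le hM1 n) h3
        have h5 : 0 ≤ M ^ (a + 1) * (1 + Real.log M) ^ p * (1 + Real.log M) := by positivity
        linarith
    -- With an exponent at least two below the maximum, the terms carry `(j + 1)^(-2)` and their sum
    -- adds no logarithm.
    · have hle : ∀ j ∈ Finset.range n, (if (j : ℝ) + 1 ≤ M then
          ((j : ℝ) + 1) ^ a * crossGrowth A m p' (M / ((j : ℝ) + 1)) else 0) ≤
          crossGrowth A m p' M * (((j : ℝ) + 1) ^ 2)⁻¹ := by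
        intro j _
        have hj1 : (1 : ℝ) ≤ (j : ℝ) + 1 := by linarith [(Nat.cast_nonneg j : (0 : ℝ) ≤ j)]
        have hj0 : (0 : ℝ) < (j : ℝ) + 1 := by positivity
        have hcg := crossGrowth_nonneg (A := A) (m := m) (p := p') hM
        split_ifs with hj
        · have hAa : ((j : ℝ) + 1) ^ a * ((j : ℝ) + 1) ^ 2 ≤ ((j : ℝ) + 1) ^ A := by
            rw [← pow_add]; exact pow_le_pow_right₀ hj1 h1
          have hred : ((j : ℝ) + 1) ^ A * crossGrowth A m p' (M / ((j : ℝ) + 1)) ≤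
              crossGrowth A m p' M := by
            cases p' with
            | zero =>
              rw [crossGrowth_zero (hdiv j hj), crossGrowth_zero hM1, div_pow]
              field_simp
              exact le_rfl
            | succ p =>
              rw [crossGrowth_succ (hdiv j hj), crossGrowth_succ hM1, div_pow]
              have hl : Real.log (M / ((j : ℝ) + 1)) ≤ Real.log M :=
                Real.log_le_log (by positivity) (div_le_self hM.le hj1)
              have hl0 := Real.log_nonneg (hdiv j hj)
              have hp : (1 + Real.log (M / ((j : ℝ) + 1))) ^ p ≤ (1 + Real.log M) ^ p := by
                gcongr
              rw [← mul_assoc]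
              have h6 : ((j : ℝ) + 1) ^ A * (M ^ (A + 1) / ((j : ℝ) + 1) ^ (A + 1)) ≤
                  M ^ (A + 1) := by
                rw [mul_div_assoc', div_le_iff₀ (by positivity), mul_comm]
                exact mul_le_mul_of_nonneg_left (pow_le_pow_right₀ hj1 (Nat.le_succ A))
                  (by positivity)
              gcongr
          rw [← div_eq_mul_inv, le_div_iff₀ (by positivity)]
          have hnn : 0 ≤ crossGrowth A m p' (M / ((j : ℝ) + 1)) :=
            crossGrowth_nonneg (by positivity)
          nlinarith
        · positivity
      refine (Finset.sum_le_sum hle).trans ?_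
      rw [← Finset.mul_sum]
      nlinarith [sum_inv_sq_le n, crossGrowth_nonneg (A := A) (m := m) (p := p') hM]

/-- One term of a weighted hyperbolic cross sum. -/
def crossTerm {r : ℕ} (m : ℕ) (a : Fin r → ℕ) (M : ℝ) (n : Fin r → ℕ) : ℝ :=
  (∏ k, ((n k : ℝ) + 1) ^ a k) * min 1 ((M / ∏ k, ((n k : ℝ) + 1)) ^ (2 * m))

lemma tsum_fin_succ {r : ℕ} (F : (Fin (r + 1) → ℕ) → ℝ≥0∞) :
    ∑' n, F n = ∑' (j : ℕ) (n : Fin r → ℕ), F (Fin.cons j n) := by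
  rw [← (Fin.consEquiv fun _ => ℕ).tsum_eq F]
  exact ENNReal.tsum_prod (f := fun (j : ℕ) (n : Fin r → ℕ) => F (Fin.cons j n))

/-- Fixing the first coordinate at `j` replaces `M` by `M / (j + 1)`, so an active coordinate
amounts to one use of `sum_crossGrowth_le`, while an inactive one contributes `j = 0` only. Values
in `ℝ≥0∞` dispense with summability. -/
lemma exists_tsum_crossTerm_le {A m : ℕ} (hA : A + 2 ≤ 2 * m) : ∀ {r : ℕ} (a : Fin r → ℕ),
    (∀ k, a k = A ∨ a k + 2 ≤ A) → ∀ (u : Fin r → Prop) [DecidablePred u], ∃ C : ℝ, 0 < C ∧ ∀ M : ℝ, 0 < M →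
      ∑' n : Fin r → ℕ, (if ∀ k, ¬ u k → n k = 0 then ENNReal.ofReal (crossTerm m a M n) else 0) ≤
        ENNReal.ofReal (C * crossGrowth A m
          (Finset.univ.filter fun k => u k ∧ a k = A).card M) := by
  intro r
  induction r with
  | zero =>
    intro a _ u _
    refine ⟨1, one_pos, fun M hM => ?_⟩
    rw [tsum_eq_single (fun k => k.elim0) (fun j hj => absurd (Subsingleton.elim j _) hj)]
    rw [if_pos (fun k => k.elim0)]
    refine ENNReal.ofReal_le_ofReal ?_
    simp only [crossTerm, Finset.univ_eq_empty, Finset.prod_empty, one_mul, div_one,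
      Finset.filter_empty, Finset.card_empty]
    rcases lt_or_ge M 1 with h | h
    · rw [crossGrowth_of_lt h]; exact min_le_right _ _
    · rw [crossGrowth_zero h]; exact (min_le_left _ _).trans (one_le_pow₀ h)
  | succ r ih =>
    intro a ha u _
    obtain ⟨C, hC, hCb⟩ := ih (fun k => a k.succ) (fun k => ha k.succ) fun k => u k.succ
    set p := (Finset.univ.filter fun k : Fin r => u k.succ ∧ a k.succ = A).card with hp
    have hcard : (Finset.univ.filter fun k : Fin (r + 1) => u k ∧ a k = A).card =
        (if u 0 ∧ a 0 = A then 1 else 0) + p := by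
      rw [Fin.card_filter_univ_succ]
      split_ifs <;> simp [hp, add_comm]
    have hterm : ∀ (M : ℝ) (j : ℕ) (n : Fin r → ℕ),
        crossTerm m a M (Fin.cons j n : Fin (r + 1) → ℕ) =
          ((j : ℝ) + 1) ^ a 0 * crossTerm m (fun k => a k.succ) (M / ((j : ℝ) + 1)) n := by
      intro M j n
      simp only [crossTerm, Fin.prod_univ_succ, Fin.cons_zero, Fin.cons_succ, div_div]
      ring
    have hcond : ∀ (j : ℕ) (n : Fin r → ℕ),
        (∀ k, ¬ u k → (Fin.cons j n : Fin (r + 1) → ℕ) k = 0) ↔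
          (¬ u 0 → j = 0) ∧ ∀ k : Fin r, ¬ u k.succ → n k = 0 := by
      intro j n
      rw [Fin.forall_fin_succ]
      simp
    have hsum : ∀ M : ℝ, ∑' n : Fin (r + 1) → ℕ,
        (if ∀ k, ¬ u k → n k = 0 then ENNReal.ofReal (crossTerm m a M n) else 0) =
        ∑' j : ℕ, (if ¬ u 0 → j = 0 then ENNReal.ofReal (((j : ℝ) + 1) ^ a 0) *
          ∑' n : Fin r → ℕ, (if ∀ k : Fin r, ¬ u k.succ → n k = 0 then
            ENNReal.ofReal (crossTerm m (fun k => a k.succ) (M / ((j : ℝ) + 1)) n) else 0)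
          else 0) := by
      intro M
      rw [tsum_fin_succ]
      refine tsum_congr fun j => ?_
      rw [← ENNReal.tsum_mul_left]
      by_cases hj : ¬ u 0 → j = 0
      · rw [if_pos hj]
        refine tsum_congr fun n => ?_
        rw [hterm, mul_ite, mul_zero, ENNReal.ofReal_mul (by positivity)]
        refine if_congr ?_ rfl rfl
        rw [hcond]
        exact and_iff_right hj
      · rw [if_neg hj, ENNReal.tsum_eq_zero]
        intro n
        refine if_neg fun h => hj ?_
        exact ((hcond j n).1 h).1
    by_cases hu : u 0
    · refine ⟨C * 4, by positivity, fun M hM => ?_⟩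
      rw [hsum, hcard]
      have hcase : (a 0 = A ∧ ((if u 0 ∧ a 0 = A then 1 else 0) + p) = p + 1) ∨
          (a 0 + 2 ≤ A ∧ ((if u 0 ∧ a 0 = A then 1 else 0) + p) = p) := by
        rcases ha 0 with h | h
        · exact Or.inl ⟨h, by rw [if_pos ⟨hu, h⟩, add_comm]⟩
        · exact Or.inr ⟨h, by rw [if_neg (by omega), zero_add]⟩
      refine ENNReal.tsum_le_of_sum_range_le fun n => ?_
      have hle : ∀ j ∈ Finset.range n, (if ¬ u 0 → j = 0 then ENNReal.ofReal (((j : ℝ) + 1) ^ a 0) *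
          ∑' n : Fin r → ℕ, (if ∀ k : Fin r, ¬ u k.succ → n k = 0 then
            ENNReal.ofReal (crossTerm m (fun k => a k.succ) (M / ((j : ℝ) + 1)) n) else 0)
          else 0) ≤ ENNReal.ofReal
            (C * (((j : ℝ) + 1) ^ a 0 * crossGrowth A m p (M / ((j : ℝ) + 1)))) := by
        intro j _
        rw [if_pos (fun h => absurd hu h)]
        refine (mul_le_mul_right (hCb (M / ((j : ℝ) + 1)) (by positivity)) _).trans ?_
        rw [← ENNReal.ofReal_mul (by positivity)]
        exact ENNReal.ofReal_le_ofReal (le_of_eq (by ring))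
      refine (Finset.sum_le_sum hle).trans ?_
      rw [← ENNReal.ofReal_sum_of_nonneg, ← Finset.mul_sum, mul_assoc]
      · refine ENNReal.ofReal_le_ofReal (mul_le_mul_of_nonneg_left ?_ hC.le)
        exact sum_crossGrowth_le hA hcase hM n
      · intro j _
        have := crossGrowth_nonneg (A := A) (m := m) (p := p)
          (show 0 < M / ((j : ℝ) + 1) by positivity)
        positivity
    · refine ⟨C, hC, fun M hM => ?_⟩
      rw [hsum, hcard, if_neg (fun h => hu h.1), zero_add,
        tsum_eq_single 0 (fun j hj => if_neg fun h => hj (h hu)), if_pos fun _ => rfl]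
      simpa using hCb M hM

/-- The weighted hyperbolic cross sum over multi-indices with at most `q` active coordinates. -/
lemma exists_tsum_cross_le {r m q A p : ℕ} (hA : A + 2 ≤ 2 * m) {a : Fin r → ℕ}
    (ha : ∀ k, a k = A ∨ a k + 2 ≤ A)
    (hp : ∀ U : Finset (Fin r), U.card ≤ q → (U.filter fun k => a k = A).card ≤ p + 1) :
    ∃ C : ℝ, 0 < C ∧ ∀ M : ℝ, 1 ≤ M →
      ∑' i : anovaIndex r q, ENNReal.ofReal ((∏ k, (i.1 k : ℝ) ^ a k) *
        min 1 ((M / ∏ k, (i.1 k : ℝ)) ^ (2 * m))) ≤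
      ENNReal.ofReal (C * (M ^ (A + 1) * (1 + Real.log M) ^ p)) := by
  classical
  choose C hC hCb using fun U : Finset (Fin r) =>
    exists_tsum_crossTerm_le hA a ha fun k => k ∈ U
  refine ⟨∑ U, C U, Finset.sum_pos (fun U _ => hC U) Finset.univ_nonempty, fun M hM => ?_⟩
  set Q := (Finset.univ : Finset (Finset (Fin r))).filter fun U => U.card ≤ q with hQ
  have hM0 : 0 < M := by linarith
  have hg : ∀ U ∈ Q, crossGrowth A m (Finset.univ.filter fun k => k ∈ U ∧ a k = A).card M ≤
      M ^ (A + 1) * (1 + Real.log M) ^ p := by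
    intro U hU
    have hU' := hp U (Finset.mem_filter.1 hU).2
    have e : (Finset.univ.filter fun k => k ∈ U ∧ a k = A) = U.filter fun k => a k = A := by
      ext k; simp
    rw [e]
    have h1 : (1 : ℝ) ≤ 1 + Real.log M := by linarith [Real.log_nonneg hM]
    generalize (U.filter fun k => a k = A).card = c at hU'
    cases c with
    | zero =>
      rw [crossGrowth_zero hM]
      calc M ^ A ≤ M ^ (A + 1) := pow_le_pow_right₀ hM (Nat.le_succ A)
        _ ≤ _ := le_mul_of_one_le_right (by positivity) (one_le_pow₀ h1)
    | succ c =>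
      rw [crossGrowth_succ hM]
      exact mul_le_mul_of_nonneg_left (pow_le_pow_right₀ h1 (by omega)) (by positivity)
  have hlogn := Real.log_nonneg hM
  -- Each multi-index is charged to the set of its entries larger than 1. Overlaps between the sums
  -- for different sets are harmless for an upper bound.
  let F : (Fin r → ℕ) → ℝ≥0∞ := fun n => ∑ U ∈ Q,
    (if ∀ k, ¬ k ∈ U → n k = 0 then ENNReal.ofReal (crossTerm m a M n) else 0)
  have hinj : Function.Injective fun (i : anovaIndex r q) (k : Fin r) => i.1 k - 1 := by
    intro i j hij
    refine Subtype.ext (funext fun k => ?_)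
    have := congrFun hij k
    have h1 := i.2.1 k
    have h2 := j.2.1 k
    simp only at this
    omega
  have hle : ∀ i : anovaIndex r q, ENNReal.ofReal ((∏ k, (i.1 k : ℝ) ^ a k) *
        min 1 ((M / ∏ k, (i.1 k : ℝ)) ^ (2 * m))) ≤ F fun k => i.1 k - 1 := by
    intro i
    set U := Finset.univ.filter fun k => 1 < i.1 k with hU
    have hUQ : U ∈ Q := Finset.mem_filter.2 ⟨Finset.mem_univ _, i.2.2⟩
    refine le_trans ?_ (Finset.single_le_sum (f := fun U : Finset (Fin r) =>
      (if ∀ k, ¬ k ∈ U → i.1 k - 1 = 0 then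
        ENNReal.ofReal (crossTerm m a M fun k => i.1 k - 1) else 0)) (fun _ _ => zero_le) hUQ)
    rw [if_pos]
    · refine le_of_eq ?_
      have hcast : ∀ k, ((i.1 k - 1 : ℕ) : ℝ) + 1 = i.1 k := by
        intro k
        have := i.2.1 k
        push_cast [this]; ring
      simp only [crossTerm, hcast]
    · intro k hk
      have : ¬ 1 < i.1 k := fun h => hk (by simp [hU, h])
      omega
  calc _ ≤ ∑' i : anovaIndex r q, F fun k => i.1 k - 1 := ENNReal.tsum_le_tsum hle
    _ ≤ ∑' n, F n := ENNReal.tsum_comp_le_tsum_of_injective hinj F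
    _ = ∑ U ∈ Q, ∑' n : Fin r → ℕ, (if ∀ k, ¬ k ∈ U → n k = 0 then
          ENNReal.ofReal (crossTerm m a M n) else 0) :=
        Summable.tsum_finsetSum fun _ _ => ENNReal.summable
    _ ≤ ∑ U ∈ Q, ENNReal.ofReal (C U * (M ^ (A + 1) * (1 + Real.log M) ^ p)) := by
        refine Finset.sum_le_sum fun U hU => (hCb U M hM0).trans ?_
        exact ENNReal.ofReal_le_ofReal (mul_le_mul_of_nonneg_left (hg U hU) (hC U).le)
    _ = ENNReal.ofReal (∑ U ∈ Q, C U * (M ^ (A + 1) * (1 + Real.log M) ^ p)) :=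
        (ENNReal.ofReal_sum_of_nonneg fun U _ => by have := hC U; positivity).symm
    _ ≤ _ := by
        refine ENNReal.ofReal_le_ofReal ?_
        rw [← Finset.sum_mul]
        refine mul_le_mul_of_nonneg_right ?_ (by positivity)
        exact Finset.sum_le_sum_of_subset_of_nonneg (Finset.filter_subset _ _)
          fun U _ _ => (hC U).le

/-! ### Expansion in eigenfunctions -/

section Eigen

variable {r m q : ℕ}

instance completeSpace_hSpace : CompleteSpace (hSpace r m q) :=
  (Submodule.isClosed_topologicalClosure _).completeSpace_coe

/-- Expansion of a function in `H_q` along the eigenfunctions. -/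
lemma IsEigensystem.expansion (hm : 1 ≤ m) {dens : (Fin r → ℝ) → ℝ} {ρ : (Fin r → ℕ) → ℝ}
    {ψ : (Fin r → ℕ) → (Fin r → ℝ) → ℝ} (heig : IsEigensystem r m q dens ρ ψ)
    {h : CoefSpace r} {f : (Fin r → ℝ) → ℝ} (hf : Realizes m q h f) :
    HasSum (fun i : anovaIndex r q => innerL2 dens (ψ i) f ^ 2 / ρ i) (‖h‖ ^ 2) ∧
    ∀ β : Fin r → ℕ, (∀ k, β k < m) → ∀ x ∈ cube r,
      HasSum (fun i : anovaIndex r q => innerL2 dens (ψ i) f * mixedDer β (ψ i) x)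
        (inner ℝ h (evalVec m β x)) := by
  have hreal : ∀ i : anovaIndex r q, ∃ h, Realizes m q h (ψ i) := fun i =>
    (memH_iff hm).1 (heig.mem i i.2)
  choose Ψ hΨ using hreal
  have hpos : ∀ i : anovaIndex r q, 0 < ρ i := fun i => heig.pos i i.2
  -- In the norm of H_q the eigenfunction has squared length `1 / ρ i`, whence the normalisation by
  -- the square root.
  let e : anovaIndex r q → hSpace r m q := fun i =>
    ⟨Real.sqrt (ρ i) • Ψ i, Submodule.smul_mem _ _ (hΨ i).1⟩
  have hcoef : ∀ (i : anovaIndex r q) (k : CoefSpace r) (g : (Fin r → ℝ) → ℝ), Realizes m q k g →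
      inner ℝ (Ψ i) k = innerL2 dens (ψ i) g / ρ i := by
    intro i k g hg
    rw [← innerH_eq hm (hΨ i) hg, heig.eigen i i.2 g ((memH_iff hm).2 ⟨k, hg⟩)]
  have he : Orthonormal ℝ e := by
    classical
    rw [orthonormal_iff_ite]
    intro i j
    have h1 : inner ℝ (e i) (e j) = Real.sqrt (ρ i) * (Real.sqrt (ρ j) * inner ℝ (Ψ i) (Ψ j)) := by
      rw [Submodule.coe_inner, real_inner_smul_left, real_inner_smul_right]
    rw [h1, hcoef i _ _ (hΨ j), heig.orthonormal i i.2 j j.2]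
    by_cases hij : i = j
    · subst hij
      have h2 := Real.mul_self_sqrt (hpos i).le
      rw [if_pos rfl, if_pos rfl, ← mul_assoc, h2, mul_one_div, div_self (hpos i).ne']
    · rw [if_neg hij, if_neg fun hh => hij (Subtype.ext hh)]
      simp
  have hbot : (Submodule.span ℝ (Set.range e))ᗮ = ⊥ := by
    rw [Submodule.eq_bot_iff]
    intro k hk
    rw [Submodule.mem_orthogonal] at hk
    set g : (Fin r → ℝ) → ℝ := fun x => inner ℝ (k : CoefSpace r) (evalVec m (fun _ => 0) x)
    have hg : Realizes m q (k : CoefSpace r) g := ⟨k.2, fun x _ => rfl⟩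
    have hzero : ∀ i ∈ anovaIndex r q, innerL2 dens (ψ i) g = 0 := by
      intro i hi
      have h1 := hk (e ⟨i, hi⟩) (Submodule.subset_span ⟨_, rfl⟩)
      rw [Submodule.coe_inner, real_inner_smul_left, hcoef ⟨i, hi⟩ _ _ hg] at h1
      have h2 : Real.sqrt (ρ i) ≠ 0 := (Real.sqrt_pos.2 (heig.pos i hi)).ne'
      have h3 := (heig.pos i hi).ne'
      simpa [h2, h3] using h1
    have h0 := heig.complete g ((memH_iff hm).2 ⟨_, hg⟩) hzero
    have : (k : CoefSpace r) = 0 := by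
      refine eq_of_inner_evalVec_eq hm fun x hx => ?_
      rw [inner_zero_left]
      exact h0 x hx
    exact Subtype.ext this
  let b := HilbertBasis.mkOfOrthogonalEqBot he hbot
  have hb : ∀ i, b i = e i := fun i => by
    rw [HilbertBasis.coe_mkOfOrthogonalEqBot]
  let h' : hSpace r m q := ⟨h, hf.1⟩
  have hin : ∀ i, inner ℝ (e i) h' = Real.sqrt (ρ i) * (innerL2 dens (ψ i) f / ρ i) := by
    intro i
    rw [Submodule.coe_inner, real_inner_smul_left, hcoef i _ _ hf]
  have hsq : ∀ i : anovaIndex r q, Real.sqrt (ρ i) * Real.sqrt (ρ i) = ρ i := fun i =>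
    Real.mul_self_sqrt (hpos i).le
  constructor
  · have h1 := b.hasSum_inner_mul_inner h' h'
    rw [real_inner_self_eq_norm_sq] at h1
    have h2 : ∀ i, inner ℝ h' (b i) * inner ℝ (b i) h' = innerL2 dens (ψ i) f ^ 2 / ρ i := by
      intro i
      rw [hb, real_inner_comm, hin]
      have := (hpos i).ne'
      calc _ = (Real.sqrt (ρ i) * Real.sqrt (ρ i)) * (innerL2 dens (ψ i) f / ρ i) ^ 2 := by ring
        _ = _ := by rw [hsq]; field_simp
    simp only [h2] at h1
    exact h1
  · intro β hβ x hx
    -- Evaluation of the mixed derivative is a bounded functional, so applying it to the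
    -- norm-convergent expansion gives the pointwise expansion of the derivative.
    have h1 := b.hasSum_repr h'
    have h2 := (((innerSL ℝ (evalVec m β x)).comp (hSpace r m q).subtypeL).hasSum h1)
    have h3 : ∀ i, ((innerSL ℝ (evalVec m β x)).comp (hSpace r m q).subtypeL) (b.repr h' i • b i) =
        innerL2 dens (ψ i) f * mixedDer β (ψ i) x := by
      intro i
      rw [mixedDer_eq_inner hm hβ (hΨ i).2 x hx, b.repr_apply_apply, hb, hin]
      have e1 : ((innerSL ℝ (evalVec m β x)).comp (hSpace r m q).subtypeL)
          ((Real.sqrt (ρ i) * (innerL2 dens (ψ i) f / ρ i)) • e i) =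
          (Real.sqrt (ρ i) * (innerL2 dens (ψ i) f / ρ i)) *
            (Real.sqrt (ρ i) * inner ℝ (Ψ i) (evalVec m β x)) := by
        rw [map_smul, smul_eq_mul]
        congr 1
        change inner ℝ (evalVec m β x) (Real.sqrt (ρ i) • Ψ i) = _
        rw [real_inner_smul_right, real_inner_comm]
      rw [e1]
      have := (hpos i).ne'
      calc _ = (Real.sqrt (ρ i) * Real.sqrt (ρ i)) * (innerL2 dens (ψ i) f / ρ i) *
            inner ℝ (Ψ i) (evalVec m β x) := by ring
        _ = _ := by rw [hsq]; field_simp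
    have h4 : ((innerSL ℝ (evalVec m β x)).comp (hSpace r m q).subtypeL) h' =
        inner ℝ h (evalVec m β x) := by
      change inner ℝ (evalVec m β x) h = _
      rw [real_inner_comm]
    simp only [h3, h4] at h2
    exact h2

end Eigen

/-! ### The deterministic part of the error analysis -/

/-- The average of the first `n` terms. -/
def empMean (n : ℕ) (v : ℕ → ℝ) : ℝ := (n : ℝ)⁻¹ * ∑ k ∈ Finset.range n, v k

/-- The shrinkage factor of an eigenvalue. -/
def shrink (lam ρ : ℝ) : ℝ := ρ / (ρ + lam)

lemma shrink_pos {lam ρ : ℝ} (hl : 0 < lam) (hρ : 0 < ρ) : 0 < shrink lam ρ := by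
  unfold shrink; positivity

lemma shrink_le_one {lam ρ : ℝ} (hl : 0 < lam) (hρ : 0 < ρ) : shrink lam ρ ≤ 1 := by
  unfold shrink; rw [div_le_one (by positivity)]; linarith

/-- A weighted form of the Cauchy–Schwarz inequality for series. -/
lemma sq_tsum_mul_le_weighted {ι : Type*} {s d z : ι → ℝ} (hs : ∀ i, 0 < s i)
    (hd : Summable fun i => d i ^ 2 / s i) (hz : Summable fun i => s i * z i ^ 2) :
    (∑' i, d i * z i) ^ 2 ≤ (∑' i, d i ^ 2 / s i) * ∑' i, s i * z i ^ 2 := by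
  have e1 : ∀ i, (d i / Real.sqrt (s i)) ^ 2 = d i ^ 2 / s i := fun i => by
    rw [div_pow, Real.sq_sqrt (hs i).le]
  have e2 : ∀ i, (Real.sqrt (s i) * z i) ^ 2 = s i * z i ^ 2 := fun i => by
    rw [mul_pow, Real.sq_sqrt (hs i).le]
  have e3 : ∀ i, d i / Real.sqrt (s i) * (Real.sqrt (s i) * z i) = d i * z i := fun i => by
    have := (Real.sqrt_pos.2 (hs i)).ne'
    field_simp
  have h := sq_tsum_mul_le (a := fun i => d i / Real.sqrt (s i))
    (b := fun i => Real.sqrt (s i) * z i) (by simpa only [e1] using hd)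
    (by simpa only [e2] using hz)
  simpa only [e1, e2, e3] using h

lemma summable_abs_of_weighted {ι : Type*} {s d : ι → ℝ} (hs : ∀ i, 0 < s i)
    (hd : Summable fun i => d i ^ 2 / s i) (hsum : Summable s) : Summable fun i => |d i| := by
  refine Summable.of_nonneg_of_le (fun i => abs_nonneg _) (fun i => ?_) (hd.add hsum)
  have h1 := hs i
  have h2 : |d i| * 1 ≤ d i ^ 2 / s i + s i := by
    rw [div_add' _ _ _ h1.ne', mul_one, le_div_iff₀ h1]
    nlinarith [sq_nonneg (|d i| - s i), sq_abs (d i), sq_nonneg (s i), sq_nonneg (d i)]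
  linarith

/-- Solving the quadratic inequality satisfied by the error. -/
lemma sq_le_of_quadratic {N a b : ℝ} (hN : 0 ≤ N)
    (h : N ^ 2 ≤ 2 * (N * a) + 2 * (N * b) + N ^ 2 / 4) : N ^ 2 ≤ 16 * (a ^ 2 + b ^ 2) := by
  rcases hN.eq_or_lt with h0 | h0
  · rw [← h0]; nlinarith [sq_nonneg a, sq_nonneg b]
  -- Dividing 3N²/4 ≤ 2N(a + b) by N gives 8/3, and 2 (8/3)² ≤ 16.
  · have h1 : N ≤ 8 / 3 * (a + b) := by
      by_contra hcon
      push Not at hcon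
      nlinarith
    have h2 : N ^ 2 ≤ (8 / 3 * (a + b)) ^ 2 := pow_le_pow_left₀ hN h1 2
    nlinarith [sq_nonneg (a - b)]

lemma abs_empMean_le {n : ℕ} {v : ℕ → ℝ} {B : ℝ} (hv : ∀ k ∈ Finset.range n, |v k| ≤ B)
    (hB : 0 ≤ B) : |empMean n v| ≤ B := by
  unfold empMean
  rcases Nat.eq_zero_or_pos n with rfl | hn
  · simpa using hB
  · have hn' : (0 : ℝ) < n := by exact_mod_cast hn
    rw [abs_mul, abs_of_pos (inv_pos.2 hn'), inv_mul_le_iff₀ hn']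
    refine (Finset.abs_sum_le_sum_abs _ _).trans ((Finset.sum_le_sum hv).trans ?_)
    simp

/-- The squared weighted norm of the noise coefficients. -/
def noiseTerm {ι X : Type*} (s : ι → ℝ) (ψ : ι → X → ℝ) (n : ℕ) (x : ℕ → X) (e : ℕ → ℝ) : ℝ :=
  ∑' i, s i * empMean n (fun k => e k * ψ i (x k)) ^ 2

open Classical in
/-- The squared weighted Hilbert–Schmidt norm of the deviation of the empirical Gram matrix from
the identity. -/
def gramTerm {ι X : Type*} (s : ι → ℝ) (ψ : ι → X → ℝ) (n : ℕ) (x : ℕ → X) : ℝ :=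
  ∑' p : ι × ι, s p.1 * s p.2 *
    (empMean n (fun k => ψ p.1 (x k) * ψ p.2 (x k)) - if p.1 = p.2 then 1 else 0) ^ 2

section Deterministic

variable {ι X : Type*} {s d : ι → ℝ} {ψ : ι → X → ℝ} {C : ℝ}

lemma summable_noiseTerm (hs : ∀ i, 0 < s i) (hsum : Summable s) (n : ℕ) {x : ℕ → X}
    (hψ : ∀ i k, |ψ i (x k)| ≤ C) (e : ℕ → ℝ) :
    Summable fun i => s i * empMean n (fun k => e k * ψ i (x k)) ^ 2 := by
  set E := ∑ k ∈ Finset.range n, |e k| with hE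
  have hb : ∀ i, |empMean n (fun k => e k * ψ i (x k))| ≤ E * |C| := by
    intro i
    refine abs_empMean_le (fun k hk => ?_) (by positivity)
    rw [abs_mul]
    exact mul_le_mul (Finset.single_le_sum (f := fun k => |e k|) (fun _ _ => abs_nonneg _) hk)
      ((hψ i k).trans (le_abs_self _)) (abs_nonneg _) (by positivity)
  refine Summable.of_nonneg_of_le (fun i => mul_nonneg (hs i).le (sq_nonneg _)) (fun i => ?_)
    (hsum.mul_right ((E * |C|) ^ 2))
  refine mul_le_mul_of_nonneg_left ?_ (hs i).le
  rw [← sq_abs]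
  exact pow_le_pow_left₀ (abs_nonneg _) (hb i) 2

open Classical in
lemma summable_gramTerm (hs : ∀ i, 0 < s i) (hsum : Summable s) (n : ℕ) {x : ℕ → X}
    (hψ : ∀ i k, |ψ i (x k)| ≤ C) :
    Summable fun p : ι × ι => s p.1 * s p.2 *
      (empMean n (fun k => ψ p.1 (x k) * ψ p.2 (x k)) - if p.1 = p.2 then 1 else 0) ^ 2 := by
  have hb : ∀ p : ι × ι, |empMean n (fun k => ψ p.1 (x k) * ψ p.2 (x k)) -
      if p.1 = p.2 then 1 else 0| ≤ |C| * |C| + 1 := by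
    intro p
    refine (abs_sub _ _).trans (add_le_add (abs_empMean_le (fun k _ => ?_) (by positivity)) ?_)
    · rw [abs_mul]
      exact mul_le_mul ((hψ _ k).trans (le_abs_self _)) ((hψ _ k).trans (le_abs_self _))
        (abs_nonneg _) (abs_nonneg _)
    · split_ifs <;> simp
  have h2 : Summable fun p : ι × ι => s p.1 * s p.2 :=
    summable_mul_of_summable_norm hsum.norm hsum.norm
  refine Summable.of_nonneg_of_le
    (fun p => mul_nonneg (mul_pos (hs _) (hs _)).le (sq_nonneg _)) (fun p => ?_)
    (h2.mul_right ((|C| * |C| + 1) ^ 2))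
  refine mul_le_mul_of_nonneg_left ?_ (mul_pos (hs _) (hs _)).le
  rw [← sq_abs]
  exact pow_le_pow_left₀ (abs_nonneg _) (hb p) 2

lemma hasSum_empMean {n : ℕ} {F : ι → ℕ → ℝ} {G : ℕ → ℝ} (h : ∀ k, HasSum (fun i => F i k) (G k)) :
    HasSum (fun i => empMean n (F i)) (empMean n G) :=
  (hasSum_sum fun k _ => h k).mul_left _

/-- The linear empirical term. -/
lemma sq_empMean_noise_le (hs : ∀ i, 0 < s i) (hsum : Summable s)
    (hd : Summable fun i => d i ^ 2 / s i) (n : ℕ) {x : ℕ → X} (hψ : ∀ i k, |ψ i (x k)| ≤ C)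
    (e : ℕ → ℝ) {δ : ℕ → ℝ} (hδ : ∀ k, HasSum (fun i => d i * ψ i (x k)) (δ k)) :
    empMean n (fun k => e k * δ k) ^ 2 ≤ (∑' i, d i ^ 2 / s i) * noiseTerm s ψ n x e := by
  have h1 : HasSum (fun i => d i * empMean n (fun k => e k * ψ i (x k)))
      (empMean n fun k => e k * δ k) := by
    have := hasSum_empMean (n := n) (F := fun i k => e k * (d i * ψ i (x k)))
      fun k => (hδ k).mul_left (e k)
    refine this.congr_fun fun i => ?_
    simp only [empMean, Finset.mul_sum]
    exact Finset.sum_congr rfl fun k _ => by ring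
  rw [← h1.tsum_eq]
  exact sq_tsum_mul_le_weighted hs hd (summable_noiseTerm hs hsum n hψ e)

lemma hasSum_mul_self {ι : Type*} {a : ι → ℝ} {A : ℝ} (ha : HasSum a A)
    (hn : Summable fun i => ‖a i‖) : HasSum (fun p : ι × ι => a p.1 * a p.2) (A ^ 2) := by
  have key := HasSum.mul ha ha (summable_mul_of_summable_norm hn hn)
  rwa [← sq] at key

lemma hasSum_sq_div {ι : Type*} {s d : ι → ℝ} {D : ℝ} (hs : ∀ i, 0 < s i)
    (hd : HasSum (fun i => d i ^ 2 / s i) D) :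
    HasSum (fun p : ι × ι => (d p.1 * d p.2) ^ 2 / (s p.1 * s p.2)) (D ^ 2) := by
  have hn : Summable fun i => ‖d i ^ 2 / s i‖ :=
    hd.summable.congr fun i =>
      (Real.norm_of_nonneg (div_nonneg (sq_nonneg _) (hs i).le)).symm
  have key := hasSum_mul_self hd hn
  simpa only [div_mul_div_comm, ← mul_pow] using key

lemma hasSum_diagonal {ι : Type*} [DecidableEq ι] {d : ι → ℝ} (hd : Summable fun i => d i ^ 2) :
    HasSum (fun p : ι × ι => d p.1 * d p.2 * if p.1 = p.2 then 1 else 0) (∑' i, d i ^ 2) := by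
  have hinj : Function.Injective fun i : ι => (i, i) := fun i j hij => (Prod.ext_iff.1 hij).1
  refine (hinj.hasSum_iff (f := fun p : ι × ι => d p.1 * d p.2 * if p.1 = p.2 then 1 else 0)
    (fun p hp => ?_)).1 ?_
  · rw [if_neg fun h => hp ⟨p.1, Prod.ext rfl h⟩, mul_zero]
  · simpa [Function.comp_def, ← sq] using hd.hasSum

/-- The quadratic empirical term. -/
lemma sq_empMean_sq_sub_le (hs : ∀ i, 0 < s i) (hs1 : ∀ i, s i ≤ 1) (hsum : Summable s)
    (hd : Summable fun i => d i ^ 2 / s i) (n : ℕ) {x : ℕ → X} (hψ : ∀ i k, |ψ i (x k)| ≤ C)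
    {δ : ℕ → ℝ} (hδ : ∀ k, HasSum (fun i => d i * ψ i (x k)) (δ k)) :
    (empMean n (fun k => δ k ^ 2) - ∑' i, d i ^ 2) ^ 2 ≤
      (∑' i, d i ^ 2 / s i) ^ 2 * gramTerm s ψ n x := by
  classical
  have habs := summable_abs_of_weighted hs hd hsum
  have hnorm : ∀ k, Summable fun i => ‖d i * ψ i (x k)‖ := by
    intro k
    refine Summable.of_nonneg_of_le (fun _ => norm_nonneg _) (fun i => ?_) (habs.mul_right C)
    rw [norm_mul]
    exact mul_le_mul_of_nonneg_left (hψ i k) (abs_nonneg _)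
  have hd2 : Summable fun i => d i ^ 2 := by
    refine Summable.of_nonneg_of_le (fun i => sq_nonneg _) (fun i => ?_) hd
    exact le_div_self (sq_nonneg _) (hs i) (hs1 i)
  have h1 : ∀ k, HasSum (fun p : ι × ι => (d p.1 * ψ p.1 (x k)) * (d p.2 * ψ p.2 (x k)))
      (δ k ^ 2) := by
    exact fun k => hasSum_mul_self (hδ k) (hnorm k)
  have h2 := hasSum_empMean (n := n) h1
  have h3 := hasSum_diagonal hd2
  -- The difference is the pairing of d ⊗ d with the Gram deviation. Cauchy–Schwarz with product
  -- weights then gives a Hilbert–Schmidt bound, with no operator norm needed.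
  have h4 : HasSum (fun p : ι × ι => (d p.1 * d p.2) *
      (empMean n (fun k => ψ p.1 (x k) * ψ p.2 (x k)) - if p.1 = p.2 then 1 else 0))
      (empMean n (fun k => δ k ^ 2) - ∑' i, d i ^ 2) := by
    refine (h2.sub h3).congr_fun fun p => ?_
    rw [mul_sub]
    congr 1
    simp only [empMean, Finset.mul_sum]
    exact Finset.sum_congr rfl fun k _ => by ring
  have h5 := hasSum_sq_div hs hd.hasSum
  rw [← h4.tsum_eq, ← h5.tsum_eq]
  exact sq_tsum_mul_le_weighted (s := fun p : ι × ι => s p.1 * s p.2)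
    (fun p => mul_pos (hs _) (hs _)) h5.summable (summable_gramTerm hs hsum n hψ)

end Deterministic

/-! ### From the basic inequality to pointwise bounds on derivatives -/

section Error

variable {r m q : ℕ}

/-- The deterministic error bound: if the empirical Gram matrix is close to the identity, the
derivatives of the error are controlled by the noise, the penalty, and a sum over the spectrum. -/
lemma sq_mixedDer_sub_le (hm : 1 ≤ m) {dens : (Fin r → ℝ) → ℝ} {ρ : (Fin r → ℕ) → ℝ}
    {ψ : (Fin r → ℕ) → (Fin r → ℝ) → ℝ} (heig : IsEigensystem r m q dens ρ ψ)
    {β : Fin r → ℕ} (hβ : ∀ k, β k < m) {C : ℝ}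
    (hψ : ∀ i ∈ anovaIndex r q, ∀ x ∈ cube r,
      |ψ i x| ≤ C ∧ |mixedDer β (ψ i) x| ≤ C * ∏ k, (i k : ℝ) ^ β k)
    {R : ℝ} (hR : ∀ i ∈ anovaIndex r q, ρ i ≤ R)
    {h₀ : CoefSpace r} {f₀ : (Fin r → ℝ) → ℝ} (hf₀ : Realizes m q h₀ f₀)
    {lam : ℝ} (hlam : 0 < lam)
    (hsum : Summable fun i : anovaIndex r q => shrink lam (ρ i))
    (hsumβ : Summable fun i : anovaIndex r q =>
      (∏ k, (i.1 k : ℝ) ^ (2 * β k)) * shrink lam (ρ i))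
    {n : ℕ} {x : ℕ → Fin r → ℝ} (hx : ∀ k, x k ∈ cube r) {e : ℕ → ℝ}
    {fhat : (Fin r → ℝ) → ℝ}
    (hfhat : IsKRR r m q n lam x (fun k => f₀ (x k) + e k) fhat)
    (hgram : gramTerm (fun i : anovaIndex r q => shrink lam (ρ i)) (fun i => ψ i) n x ≤ 1 / 16)
    {y : Fin r → ℝ} (hy : y ∈ cube r) :
    (mixedDer β fhat y - mixedDer β f₀ y) ^ 2 ≤
      16 * (noiseTerm (fun i : anovaIndex r q => shrink lam (ρ i)) (fun i => ψ i) n x e +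
        lam * ‖h₀‖ ^ 2) *
      (C ^ 2 * ∑' i : anovaIndex r q, (∏ k, (i.1 k : ℝ) ^ (2 * β k)) * shrink lam (ρ i)) := by
  obtain ⟨hh, hhhat⟩ := (memH_iff hm).1 hfhat.1
  set h := hh + (-1 : ℝ) • h₀ with hhdef
  have hδ : Realizes m q h fun x => fhat x + (-1) * f₀ x := hhhat.add_smul hf₀ (-1)
  obtain ⟨hE1, hE2⟩ := heig.expansion hm hδ
  set δ : (Fin r → ℝ) → ℝ := fun x => fhat x + (-1) * f₀ x with hδdef
  set d : anovaIndex r q → ℝ := fun i => innerL2 dens (ψ i) δ with hd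
  set s : anovaIndex r q → ℝ := fun i => shrink lam (ρ i) with hsdef
  have hpos : ∀ i : anovaIndex r q, 0 < ρ i := fun i => heig.pos i i.2
  have hs : ∀ i, 0 < s i := fun i => shrink_pos hlam (hpos i)
  have hs1 : ∀ i, s i ≤ 1 := fun i => shrink_le_one hlam (hpos i)
  -- The weights are chosen so that the weighted norm is the squared L₂ norm plus `lam` times the
  -- squared H_q norm.
  have hds : ∀ i, d i ^ 2 / s i = d i ^ 2 + lam * (d i ^ 2 / ρ i) := by
    intro i
    have h1 := hpos i
    simp only [hsdef, shrink]
    field_simp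
  have hd2 : Summable fun i => d i ^ 2 := by
    refine Summable.of_nonneg_of_le (fun i => sq_nonneg _) (fun i => ?_) (hE1.summable.mul_right R)
    have h1 := hpos i
    rw [div_mul_eq_mul_div, le_div_iff₀ h1]
    exact mul_le_mul_of_nonneg_left (hR i i.2) (sq_nonneg _)
  have hN : HasSum (fun i => d i ^ 2 / s i) (∑' i, d i ^ 2 + lam * ‖h‖ ^ 2) := by
    simp only [hds]
    exact hd2.hasSum.add (hE1.mul_left lam)
  set N2 := ∑' i, d i ^ 2 + lam * ‖h‖ ^ 2 with hN2
  have hN2nn : 0 ≤ N2 := hN.nonneg fun i => div_nonneg (sq_nonneg _) (hs i).le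
  have hpt : ∀ k, HasSum (fun i : anovaIndex r q => d i * ψ i (x k)) (δ (x k)) := by
    intro k
    have h1 := hE2 (fun _ => 0) (fun _ => hm) (x k) (hx k)
    rw [← hδ.2 _ (hx k)] at h1
    refine h1.congr_fun fun i => ?_
    obtain ⟨Ψ, hΨ⟩ := (memH_iff hm).1 (heig.mem i i.2)
    rw [mixedDer_eq_inner hm (fun _ => hm) hΨ.2 _ (hx k), hΨ.2 _ (hx k)]
  have hψx : ∀ (i : anovaIndex r q) k, |ψ i (x k)| ≤ C := fun i k => (hψ i i.2 _ (hx k)).1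
  have hlin := sq_empMean_noise_le hs hsum hN.summable n hψx e hpt
  have hquad := sq_empMean_sq_sub_le hs hs1 hsum hN.summable n hψx hpt
  rw [hN.tsum_eq] at hlin hquad
  set V := noiseTerm s (fun i : anovaIndex r q => ψ i) n x e with hV
  have hVnn : 0 ≤ V := tsum_nonneg fun i => mul_nonneg (hs i).le (sq_nonneg _)
  -- The minimiser is compared with `f₀`; expanding the squares and the penalty around `f₀` leaves
  -- these terms.
  have hbasic : empMean n (fun k => δ (x k) ^ 2) + lam * ‖h‖ ^ 2 ≤
      2 * empMean n (fun k => e k * δ (x k)) - 2 * lam * inner ℝ h₀ h := by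
    have h1 := hfhat.2 f₀ ((memH_iff hm).2 ⟨h₀, hf₀⟩)
    simp only [krrObjective] at h1
    rw [innerH_eq hm hhhat hhhat, innerH_eq hm hf₀ hf₀] at h1
    have hhat : hh = h₀ + h := by rw [hhdef]; module
    have hexp : inner ℝ hh hh = inner ℝ h₀ h₀ + 2 * inner ℝ h₀ h + ‖h‖ ^ 2 := by
      clear_value h
      rw [hhat, real_inner_add_add_self, real_inner_self_eq_norm_sq h]
    rw [hexp] at h1
    have e1 : ∀ k, (f₀ (x k) + e k - fhat (x k)) ^ 2 =
        e k ^ 2 - 2 * (e k * δ (x k)) + δ (x k) ^ 2 := by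
      intro k; simp only [hδdef]; ring
    have e2 : ∀ k, (f₀ (x k) + e k - f₀ (x k)) ^ 2 = e k ^ 2 := by intro k; ring
    simp only [e1, e2, Finset.sum_add_distrib, Finset.sum_sub_distrib, ← Finset.mul_sum] at h1
    simp only [empMean]
    rw [one_div, mul_inv] at h1
    linarith
  have hcs : |inner ℝ h₀ h| ≤ ‖h₀‖ * ‖h‖ := abs_real_inner_le_norm _ _
  have hNsq : Real.sqrt N2 ^ 2 = N2 := Real.sq_sqrt hN2nn
  have hl1 : |empMean n (fun k => e k * δ (x k))| ≤ Real.sqrt N2 * Real.sqrt V := by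
    rw [← Real.sqrt_mul hN2nn]
    exact Real.abs_le_sqrt hlin
  -- The threshold 1/16 on the Gram deviation turns into a quarter of the weighted norm, which is
  -- absorbed into the left side below.
  have hl2 : |empMean n (fun k => δ (x k) ^ 2) - ∑' i, d i ^ 2| ≤ N2 / 4 := by
    refine abs_le_of_sq_le_sq ?_ (by positivity)
    refine hquad.trans ?_
    nlinarith [sq_nonneg N2]
  have hl3 : lam * (‖h₀‖ * ‖h‖) ≤ Real.sqrt N2 * (Real.sqrt lam * ‖h₀‖) := by
    have h1 : Real.sqrt lam * ‖h‖ ≤ Real.sqrt N2 := by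
      refine Real.le_sqrt_of_sq_le ?_
      rw [mul_pow, Real.sq_sqrt hlam.le]
      have : 0 ≤ ∑' i, d i ^ 2 := tsum_nonneg fun i => sq_nonneg _
      linarith
    have h2 : lam = Real.sqrt lam * Real.sqrt lam := (Real.mul_self_sqrt hlam.le).symm
    have h3 : 0 ≤ Real.sqrt lam * ‖h₀‖ := by positivity
    calc lam * (‖h₀‖ * ‖h‖) = (Real.sqrt lam * Real.sqrt lam) * (‖h₀‖ * ‖h‖) := by rw [← h2]
      _ = (Real.sqrt lam * ‖h‖) * (Real.sqrt lam * ‖h₀‖) := by ring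
      _ ≤ _ := mul_le_mul_of_nonneg_right h1 h3
  have hfin : N2 ≤ 16 * (V + lam * ‖h₀‖ ^ 2) := by
    have h1 : Real.sqrt N2 ^ 2 ≤ 16 * (Real.sqrt V ^ 2 + (Real.sqrt lam * ‖h₀‖) ^ 2) := by
      refine sq_le_of_quadratic (Real.sqrt_nonneg _) ?_
      rw [hNsq]
      have h4 := abs_le.1 hl1
      have h5 := abs_le.1 hl2
      have h6 := abs_le.1 hcs
      have h7 : -(lam * inner ℝ h₀ h) ≤ lam * (‖h₀‖ * ‖h‖) := by
        have := mul_le_mul_of_nonneg_left h6.1 hlam.le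
        linarith
      linarith
    rw [hNsq, Real.sq_sqrt hVnn, mul_pow, Real.sq_sqrt hlam.le] at h1
    exact h1
  have hder : mixedDer β fhat y - mixedDer β f₀ y =
      ∑' i : anovaIndex r q, d i * mixedDer β (ψ i) y := by
    rw [(hE2 β hβ y hy).tsum_eq, mixedDer_eq_inner hm hβ hhhat.2 y hy,
      mixedDer_eq_inner hm hβ hf₀.2 y hy, hhdef, inner_add_left, real_inner_smul_left]
    ring
  have hterm : ∀ i : anovaIndex r q, s i * mixedDer β (ψ i) y ^ 2 ≤
      C ^ 2 * ((∏ k, (i.1 k : ℝ) ^ (2 * β k)) * s i) := by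
    intro i
    have h1 := (hψ i i.2 y hy).2
    have h2 : mixedDer β (ψ i) y ^ 2 ≤ (C * ∏ k, (i.1 k : ℝ) ^ β k) ^ 2 := by
      rw [← sq_abs]; exact pow_le_pow_left₀ (abs_nonneg _) h1 2
    have h3 : (C * ∏ k, (i.1 k : ℝ) ^ β k) ^ 2 = C ^ 2 * ∏ k, (i.1 k : ℝ) ^ (2 * β k) := by
      rw [mul_pow, ← Finset.prod_pow]
      simp only [← pow_mul, mul_comm]
    rw [h3] at h2
    have := mul_le_mul_of_nonneg_left h2 (hs i).le
    linarith
  have hsz : Summable fun i : anovaIndex r q => s i * mixedDer β (ψ i) y ^ 2 :=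
    Summable.of_nonneg_of_le (fun i => mul_nonneg (hs i).le (sq_nonneg _)) hterm
      (hsumβ.mul_left _)
  rw [hder]
  -- One factor measures the error in the weighted norm, independently of `β`; the other is a purely
  -- spectral sum.
  refine (sq_tsum_mul_le_weighted hs hN.summable hsz).trans ?_
  rw [hN.tsum_eq]
  refine mul_le_mul hfin ?_ (tsum_nonneg fun i => mul_nonneg (hs i).le (sq_nonneg _))
    (by positivity)
  rw [← tsum_mul_left]
  exact hsz.tsum_le_tsum hterm (hsumβ.mul_left _)

end Error

/-! ### Sums of shrinkage factors in terms of lam and log n -/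

section Spectral

variable {r m q : ℕ}

/-- The scale `(C / lam) ^ (1 / (2 * m))` is the size `Q` at which the eigenvalue bound crosses
`lam`. It becomes the size of the hyperbolic cross. -/
lemma shrink_le_min {lam ρ C Q : ℝ} (hm : 1 ≤ m) (hlam : 0 < lam) (hρ : 0 < ρ) (hC : 0 < C)
    (hQ : 0 < Q) (h : ρ ≤ C * (Q⁻¹) ^ (2 * m)) :
    shrink lam ρ ≤ min 1 (((C / lam) ^ (1 / (2 * (m : ℝ))) / Q) ^ (2 * m)) := by
  refine le_min (shrink_le_one hlam hρ) ?_
  have hm' : (m : ℝ) ≠ 0 := by positivity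
  have h1 : ((C / lam) ^ (1 / (2 * (m : ℝ)))) ^ (2 * m) = C / lam := by
    rw [← Real.rpow_natCast, ← Real.rpow_mul (by positivity)]
    push_cast
    rw [one_div_mul_cancel (by positivity), Real.rpow_one]
  rw [div_pow, h1, shrink]
  calc ρ / (ρ + lam) ≤ ρ / lam := div_le_div_of_nonneg_left hρ.le hlam (by linarith)
    _ ≤ C * (Q⁻¹) ^ (2 * m) / lam := div_le_div_of_nonneg_right h hlam.le
    _ = _ := by rw [inv_pow]; field_simp

/-- The hypothesis on `n` bounds `-log lam` by `m log n`, so logarithms of the cross size become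
logarithms of `n`. -/
lemma one_add_log_le {lam C : ℝ} (hm : 1 ≤ m) (hlam : 0 < lam) (hC : 0 < C) {n : ℕ} (hn : 3 ≤ n)
    (hnlam : lam ^ (-(1 / (m : ℝ))) ≤ n) :
    1 + Real.log ((C / lam) ^ (1 / (2 * (m : ℝ)))) ≤ (2 + |Real.log C|) * Real.log n := by
  have hm' : (1 : ℝ) ≤ m := by exact_mod_cast hm
  have hn' : (3 : ℝ) ≤ n := by exact_mod_cast hn
  have hlog : 1 ≤ Real.log n := by
    rw [Real.le_log_iff_exp_le (by linarith)]
    linarith [Real.exp_one_lt_d9]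
  have h1 := Real.log_le_log (Real.rpow_pos_of_pos hlam _) hnlam
  rw [Real.log_rpow hlam] at h1
  rw [Real.log_rpow (div_pos hC hlam), Real.log_div hC.ne' hlam.ne']
  have h2 : 1 / (2 * (m : ℝ)) * Real.log C ≤ |Real.log C| := by
    have h3 : 1 / (2 * (m : ℝ)) ≤ 1 := by rw [div_le_one (by positivity)]; linarith
    have h4 : 0 ≤ 1 / (2 * (m : ℝ)) := by positivity
    nlinarith [le_abs_self (Real.log C), abs_nonneg (Real.log C)]
  have h5 : 1 / (2 * (m : ℝ)) * Real.log lam = 1 / 2 * (1 / (m : ℝ) * Real.log lam) := by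
    field_simp
  nlinarith [abs_nonneg (Real.log C)]

/-- Weighted sums of the shrinkage factors. -/
lemma exists_tsum_shrink_le {A p : ℕ} (hA : A + 2 ≤ 2 * m) {a : Fin r → ℕ}
    (ha : ∀ k, a k = A ∨ a k + 2 ≤ A)
    (hp : ∀ U : Finset (Fin r), U.card ≤ q → (U.filter fun k => a k = A).card ≤ p + 1)
    {ρ : (Fin r → ℕ) → ℝ} (hρpos : ∀ i ∈ anovaIndex r q, 0 < ρ i) {C : ℝ} (hC : 0 < C)
    (hρ : ∀ i ∈ anovaIndex r q, ρ i ≤ C * ((∏ k, (i k : ℝ))⁻¹) ^ (2 * m)) :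
    ∃ K > 0, ∀ (n : ℕ) (lam : ℝ), 3 ≤ n → 0 < lam → lam ≤ C → lam ^ (-(1 / (m : ℝ))) ≤ n →
      (Summable fun i : anovaIndex r q => (∏ k, (i.1 k : ℝ) ^ a k) * shrink lam (ρ i)) ∧
      ∑' i : anovaIndex r q, (∏ k, (i.1 k : ℝ) ^ a k) * shrink lam (ρ i) ≤
        K * (lam ^ (-(((A : ℝ) + 1) / (2 * m))) * Real.log n ^ p) := by
  have hm : 1 ≤ m := by omega
  obtain ⟨K, hK, hKs⟩ := exists_tsum_cross_le hA ha hp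
  refine ⟨K * C ^ (((A : ℝ) + 1) / (2 * m)) * (2 + |Real.log C|) ^ p, by positivity, ?_⟩
  intro n lam hn hlam hlamC hnlam
  set M := (C / lam) ^ (1 / (2 * (m : ℝ))) with hM
  have hM1 : 1 ≤ M := Real.one_le_rpow ((one_le_div hlam).2 hlamC) (by positivity)
  have hQ : ∀ i : anovaIndex r q, 0 < ∏ k, (i.1 k : ℝ) := fun i =>
    Finset.prod_pos fun k _ => by exact_mod_cast i.2.1 k
  have hnn : ∀ i : anovaIndex r q, 0 ≤ (∏ k, (i.1 k : ℝ) ^ a k) * shrink lam (ρ i) := fun i =>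
    mul_nonneg (Finset.prod_nonneg fun k _ => by positivity)
      (shrink_pos hlam (hρpos i i.2)).le
  have hle : ∑' i : anovaIndex r q,
      ENNReal.ofReal ((∏ k, (i.1 k : ℝ) ^ a k) * shrink lam (ρ i)) ≤
      ENNReal.ofReal (K * (M ^ (A + 1) * (1 + Real.log M) ^ p)) := by
    refine (ENNReal.tsum_le_tsum fun i => ENNReal.ofReal_le_ofReal ?_).trans (hKs M hM1)
    exact mul_le_mul_of_nonneg_left
      (shrink_le_min hm hlam (hρpos i i.2) hC (hQ i) (hρ i i.2))
      (Finset.prod_nonneg fun k _ => by positivity)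
  have hsum : Summable fun i : anovaIndex r q => (∏ k, (i.1 k : ℝ) ^ a k) * shrink lam (ρ i) := by
    have h1 := ENNReal.summable_toReal (hle.trans_lt ENNReal.ofReal_lt_top).ne
    exact h1.congr fun i => ENNReal.toReal_ofReal (hnn i)
  refine ⟨hsum, ?_⟩
  have hlogM : 0 ≤ Real.log M := Real.log_nonneg hM1
  rw [← ENNReal.ofReal_tsum_of_nonneg hnn hsum,
    ENNReal.ofReal_le_ofReal_iff (by positivity)] at hle
  refine hle.trans ?_
  have e1 : M ^ (A + 1) = C ^ (((A : ℝ) + 1) / (2 * m)) * lam ^ (-(((A : ℝ) + 1) / (2 * m))) := by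
    rw [hM, ← Real.rpow_natCast, ← Real.rpow_mul (by positivity), Real.rpow_neg hlam.le,
      ← div_eq_mul_inv, ← Real.div_rpow hC.le hlam.le]
    congr 1
    push_cast
    ring
  have e2 : (1 + Real.log M) ^ p ≤ (2 + |Real.log C|) ^ p * Real.log n ^ p := by
    rw [← mul_pow]
    exact pow_le_pow_left₀ (by positivity) (one_add_log_le hm hlam hC hn hnlam) p
  have hlamp : 0 < lam ^ (-(((A : ℝ) + 1) / (2 * m))) := Real.rpow_pos_of_pos hlam _
  have hCp : 0 < C ^ (((A : ℝ) + 1) / (2 * m)) := Real.rpow_pos_of_pos hC _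
  rw [e1]
  calc K * (C ^ (((A : ℝ) + 1) / (2 * m)) * lam ^ (-(((A : ℝ) + 1) / (2 * m))) *
        (1 + Real.log M) ^ p)
      ≤ K * (C ^ (((A : ℝ) + 1) / (2 * m)) * lam ^ (-(((A : ℝ) + 1) / (2 * m))) *
        ((2 + |Real.log C|) ^ p * Real.log n ^ p)) := by gcongr
    _ = _ := by ring

/-- Squared derivatives double the exponents, so a non-maximal one falls short by at least two, as
the cross sums require. Logarithms count the maximal coordinates in an active set, at most `min
(nMax β) q` many. -/
lemma exists_tsum_shrink_le_betaMax {β : Fin r → ℕ} (hβm : betaMax β + 1 ≤ m)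
    {ρ : (Fin r → ℕ) → ℝ} (hρpos : ∀ i ∈ anovaIndex r q, 0 < ρ i) {C : ℝ} (hC : 0 < C)
    (hρ : ∀ i ∈ anovaIndex r q, ρ i ≤ C * ((∏ k, (i k : ℝ))⁻¹) ^ (2 * m)) :
    ∃ K > 0, ∀ (n : ℕ) (lam : ℝ), 3 ≤ n → 0 < lam → lam ≤ C → lam ^ (-(1 / (m : ℝ))) ≤ n →
      (Summable fun i : anovaIndex r q => (∏ k, (i.1 k : ℝ) ^ (2 * β k)) * shrink lam (ρ i)) ∧
      ∑' i : anovaIndex r q, (∏ k, (i.1 k : ℝ) ^ (2 * β k)) * shrink lam (ρ i) ≤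
        K * (lam ^ (-((2 * (betaMax β : ℝ) + 1) / (2 * m))) *
          Real.log n ^ (min (nMax β) q - 1)) := by
  have hle : ∀ k, β k ≤ betaMax β := fun k => Finset.le_sup (Finset.mem_univ k)
  have key := exists_tsum_shrink_le (r := r) (m := m) (q := q) (A := 2 * betaMax β)
    (p := min (nMax β) q - 1) (by omega) (a := fun k => 2 * β k)
    (fun k => by have := hle k; omega) (fun U hU => ?_) hρpos hC hρ
  · simpa only [Nat.cast_mul, Nat.cast_ofNat] using key
  · have h1 : (U.filter fun k => 2 * β k = 2 * betaMax β).card ≤ U.card :=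
      Finset.card_filter_le _ _
    have h2 : (U.filter fun k => 2 * β k = 2 * betaMax β).card ≤ nMax β := by
      refine Finset.card_le_card fun k hk => ?_
      simp only [Finset.mem_filter] at hk ⊢
      exact ⟨Finset.mem_univ _, by omega⟩
    omega

/-- All exponents equal the maximum zero, so each of the at most `q` active coordinates counts. This
is the effective dimension of the estimator. -/
lemma exists_tsum_shrink_le_zero (hm : 1 ≤ m)
    {ρ : (Fin r → ℕ) → ℝ} (hρpos : ∀ i ∈ anovaIndex r q, 0 < ρ i) {C : ℝ} (hC : 0 < C)
    (hρ : ∀ i ∈ anovaIndex r q, ρ i ≤ C * ((∏ k, (i k : ℝ))⁻¹) ^ (2 * m)) :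
    ∃ K > 0, ∀ (n : ℕ) (lam : ℝ), 3 ≤ n → 0 < lam → lam ≤ C → lam ^ (-(1 / (m : ℝ))) ≤ n →
      (Summable fun i : anovaIndex r q => shrink lam (ρ i)) ∧
      ∑' i : anovaIndex r q, shrink lam (ρ i) ≤
        K * (lam ^ (-(1 / (2 * (m : ℝ)))) * Real.log n ^ (q - 1)) := by
  have key := exists_tsum_shrink_le (r := r) (m := m) (q := q) (A := 0)
    (p := q - 1) (by omega) (a := fun _ => 0) (fun _ => Or.inl rfl)
    (fun U hU => ((Finset.card_filter_le _ _).trans hU).trans (by omega)) hρpos hC hρ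
  simpa only [pow_zero, Finset.prod_const_one, one_mul, Nat.cast_zero, zero_add] using key

end Spectral

/-! ### Second moments of averages of i.i.d. variables -/

section Averages

variable {Ω E : Type*} [MeasurableSpace Ω] [MeasurableSpace E] {P : Measure Ω}
  [IsProbabilityMeasure P] {W : ℕ → Ω → E}

/-- The mean square error of an average of i.i.d. variables. -/
lemma lintegral_sq_empMean_sub_le (hind : iIndepFun W P)
    (hid : ∀ k, IdentDistrib (W k) (W 0) P P) {G : E → ℝ} (hG : Measurable G)
    (hL : MemLp (fun ω => G (W 0 ω)) 2 P) {B : ℝ} (hB : ∫ ω, G (W 0 ω) ^ 2 ∂P ≤ B) {n : ℕ}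
    (hn : n ≠ 0) :
    ∫⁻ ω, ENNReal.ofReal ((empMean n (fun k => G (W k ω)) - ∫ ω, G (W 0 ω) ∂P) ^ 2) ∂P ≤
      ENNReal.ofReal (B / n) := by
  have hn' : (n : ℝ) ≠ 0 := by exact_mod_cast hn
  have hidG : ∀ k, IdentDistrib (fun ω => G (W k ω)) (fun ω => G (W 0 ω)) P P := fun k =>
    (hid k).comp hG
  have hLk : ∀ k, MemLp (fun ω => G (W k ω)) 2 P := fun k => (hidG k).memLp_iff.2 hL
  have hmean : ∫ ω, empMean n (fun k => G (W k ω)) ∂P = ∫ ω, G (W 0 ω) ∂P := by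
    simp only [empMean]
    rw [integral_const_mul, integral_finsetSum _ fun k _ => (hLk k).integrable one_le_two]
    rw [Finset.sum_congr rfl fun k _ => (hidG k).integral_eq]
    simp [hn']
  have hLe : MemLp (fun ω => empMean n (fun k => G (W k ω))) 2 P :=
    (memLp_finsetSum _ fun k _ => hLk k).const_mul _
  have hvar : Var[fun ω => empMean n (fun k => G (W k ω)); P] ≤ B / n := by
    simp only [empMean]
    rw [variance_const_mul]
    have h1 := IndepFun.variance_sum (s := Finset.range n) (X := fun k ω => G (W k ω)) (μ := P)
      (fun k _ => hLk k)
      (fun k _ l _ hkl => (hind.indepFun hkl).comp hG hG)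
    have h2 : (∑ k ∈ Finset.range n, fun ω => G (W k ω)) =
        fun ω => ∑ k ∈ Finset.range n, G (W k ω) := by
      ext ω; simp
    rw [h2] at h1
    rw [h1, Finset.sum_congr rfl fun k _ => (hidG k).variance_eq, Finset.sum_const,
      Finset.card_range, nsmul_eq_mul]
    have h3 : Var[fun ω => G (W 0 ω); P] ≤ B :=
      (variance_le_expectation_sq hL.aestronglyMeasurable).trans hB
    calc (n : ℝ)⁻¹ ^ 2 * (n * Var[fun ω => G (W 0 ω); P])
        = Var[fun ω => G (W 0 ω); P] / n := by field_simp
      _ ≤ B / n := by gcongr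
  calc _ = evariance (fun ω => empMean n (fun k => G (W k ω))) P := by
        rw [evariance_eq_lintegral_ofReal, hmean]
    _ = ENNReal.ofReal (Var[fun ω => empMean n (fun k => G (W k ω)); P]) :=
        hLe.ofReal_variance_eq.symm
    _ ≤ _ := ENNReal.ofReal_le_ofReal hvar

/-- A divergent real series has value zero by convention, so summability is not needed. -/
lemma ofReal_tsum_le {ι : Type*} {f : ι → ℝ} (hf : ∀ i, 0 ≤ f i) :
    ENNReal.ofReal (∑' i, f i) ≤ ∑' i, ENNReal.ofReal (f i) := by
  by_cases h : Summable f
  · exact (ENNReal.ofReal_tsum_of_nonneg hf h).le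
  · simp [tsum_eq_zero_of_not_summable h]

/-- A Markov bound for weighted sums of squared centered averages. -/
lemma measure_lt_tsum_sq_le {ι : Type*} [Countable ι] (hind : iIndepFun W P)
    (hWm : ∀ k, Measurable (W k)) (hid : ∀ k, IdentDistrib (W k) (W 0) P P) {G : ι → E → ℝ}
    (hG : ∀ i, Measurable (G i)) (hL : ∀ i, MemLp (fun ω => G i (W 0 ω)) 2 P) {B : ℝ}
    (hB : ∀ i, ∫ ω, G i (W 0 ω) ^ 2 ∂P ≤ B) {w : ι → ℝ} (hw : ∀ i, 0 ≤ w i)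
    (hws : Summable w) {n : ℕ} (hn : n ≠ 0) {t : ℝ} (ht : 0 < t) :
    P {ω | t < ∑' i, w i * (empMean n (fun k => G i (W k ω)) - ∫ ω, G i (W 0 ω) ∂P) ^ 2} ≤
      ENNReal.ofReal ((∑' i, w i) * (B / n) / t) := by
  set F : Ω → ℝ≥0∞ := fun ω => ∑' i, ENNReal.ofReal (w i) *
    ENNReal.ofReal ((empMean n (fun k => G i (W k ω)) - ∫ ω, G i (W 0 ω) ∂P) ^ 2) with hF
  have hmeas : ∀ i, Measurable fun ω => ENNReal.ofReal
      ((empMean n (fun k => G i (W k ω)) - ∫ ω, G i (W 0 ω) ∂P) ^ 2) := by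
    intro i
    have h1 : Measurable fun ω => empMean n (fun k => G i (W k ω)) :=
      (Finset.measurable_fun_sum _ fun k _ => (hG i).comp (hWm k)).const_mul _
    exact ((h1.sub_const _).pow_const 2).ennreal_ofReal
  have hFm : Measurable F := Measurable.tsum fun i => (hmeas i).const_mul _
  have hFint : ∫⁻ ω, F ω ∂P ≤ ENNReal.ofReal ((∑' i, w i) * (B / n)) := by
    rw [hF, lintegral_tsum fun i => ((hmeas i).const_mul _).aemeasurable,
      ENNReal.ofReal_mul (tsum_nonneg hw), ENNReal.ofReal_tsum_of_nonneg hw hws,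
      ← ENNReal.tsum_mul_right]
    refine ENNReal.tsum_le_tsum fun i => ?_
    rw [lintegral_const_mul _ (hmeas i)]
    gcongr
    exact lintegral_sq_empMean_sub_le hind hid (hG i) (hL i) (hB i) hn
  have hsub : {ω | t < ∑' i, w i *
      (empMean n (fun k => G i (W k ω)) - ∫ ω, G i (W 0 ω) ∂P) ^ 2} ⊆
      {ω | ENNReal.ofReal t ≤ F ω} := by
    intro ω hω
    refine (ENNReal.ofReal_le_ofReal (le_of_lt hω)).trans
      ((ofReal_tsum_le fun i => mul_nonneg (hw i) (sq_nonneg _)).trans_eq ?_)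
    exact tsum_congr fun i => ENNReal.ofReal_mul (hw i)
  refine (measure_mono hsub).trans ((meas_ge_le_lintegral_div hFm.aemeasurable
    (by simpa using ht) ENNReal.ofReal_ne_top).trans ?_)
  rw [ENNReal.ofReal_div_of_pos ht]
  gcongr

end Averages

/-! ### Consequences of the assumptions on noise and design -/

section Moments

variable {Ω : Type*} [MeasurableSpace Ω] {P : Measure Ω} {r : ℕ}
  {X : ℕ → Ω → Fin r → ℝ} {ε : ℕ → Ω → ℝ} {dens : (Fin r → ℝ) → ℝ}

/-- If the square were not integrable, its conditional expectation would be zero by convention,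
against the positive lower bound on the conditional variance. -/
lemma IsNoise.memLp [IsProbabilityMeasure P] {Z : Ω → Fin r → ℝ} {e : Ω → ℝ} (he : Measurable e) (h : IsNoise P Z e) :
    MemLp e 2 P := by
  rw [memLp_two_iff_integrable_sq he.aestronglyMeasurable]
  by_contra hcon
  obtain ⟨C, hC, h1, -⟩ := h.condMoments
  rw [condExp_of_not_integrable hcon] at h1
  obtain ⟨ω, hω⟩ := h1.exists
  have : 0 < C⁻¹ := inv_pos.2 hC
  simp only [Pi.zero_apply] at hω
  linarith

/-- A bounded function of `Z` can be taken out of the conditional expectation given `Z`, which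
vanishes. -/
lemma IsNoise.integral_mul_eq_zero [IsProbabilityMeasure P] {Z : Ω → Fin r → ℝ} {e : Ω → ℝ} (hZ : Measurable Z)
    (he : Measurable e) (h : IsNoise P Z e) {g : (Fin r → ℝ) → ℝ} (hg : Measurable g) {C : ℝ}
    (hgC : ∀ x, |g x| ≤ C) : ∫ ω, e ω * g (Z ω) ∂P = 0 := by
  have hm : MeasurableSpace.comap Z inferInstance ≤ (inferInstance : MeasurableSpace Ω) :=
    hZ.comap_le
  have hei : Integrable e P := (h.memLp he).integrable one_le_two
  have hgm : StronglyMeasurable[MeasurableSpace.comap Z inferInstance] fun ω => g (Z ω) :=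
    (hg.comp (comap_measurable Z)).stronglyMeasurable
  have key := condExp_stronglyMeasurable_mul_of_bound hm hgm hei C
    (Eventually.of_forall fun ω => hgC (Z ω))
  have h0 : P[(fun ω => g (Z ω)) * e | MeasurableSpace.comap Z inferInstance] =ᵐ[P] 0 := by
    filter_upwards [key, h.condMean] with ω h1 h2
    rw [h1, Pi.mul_apply, h2]
    simp
  have h1 := integral_condExp (μ := P) (f := (fun ω => g (Z ω)) * e) hm
  rw [integral_congr_ae h0] at h1
  simp only [Pi.zero_apply, integral_zero, Pi.mul_apply] at h1
  rw [h1]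
  exact integral_congr_ae (Eventually.of_forall fun ω => mul_comm _ _)

lemma IsDesign.integral_comp (hd : IsDesign P r X ε dens) {g : (Fin r → ℝ) → ℝ}
    (hg : Measurable g) : ∫ ω, g (X 0 ω) ∂P = ∫ x in cube r, g x * dens x := by
  rw [← integral_map (hd.measurable_X 0).aemeasurable hg.aestronglyMeasurable, hd.map_eq,
    integral_withDensity_eq_integral_toReal_smul hd.measurable_dens.ennreal_ofReal
      (Eventually.of_forall fun _ => ENNReal.ofReal_lt_top)]
  refine setIntegral_congr_fun (measurableSet_cube r) fun x hx => ?_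
  obtain ⟨C, hC, hb⟩ := hd.dens_bounds
  have : 0 ≤ dens x := le_trans (by positivity) (hb x hx).1
  simp only [ENNReal.toReal_ofReal this, smul_eq_mul, mul_comm]

end Moments

/-! ### Probability bounds for the Gram and noise terms -/

section Empirical

variable {Ω : Type*} [MeasurableSpace Ω] {P : Measure Ω} [IsProbabilityMeasure P] {r m q : ℕ}
  {X : ℕ → Ω → Fin r → ℝ} {ε : ℕ → Ω → ℝ} {dens : (Fin r → ℝ) → ℝ}
  {ρ : (Fin r → ℕ) → ℝ} {ψ : (Fin r → ℕ) → (Fin r → ℝ) → ℝ} {C : ℝ}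

/-- Eigenfunctions are controlled only on the cube. Cutting them off gives measurable functions
bounded everywhere, unchanged at the design points. -/
lemma IsEigensystem.measurable_indicator (hm : 1 ≤ m) (heig : IsEigensystem r m q dens ρ ψ)
    {i : Fin r → ℕ} (hi : i ∈ anovaIndex r q) : Measurable ((cube r).indicator (ψ i)) := by
  obtain ⟨h, hh⟩ := (memH_iff hm).1 (heig.mem i hi)
  classical
  rw [← Set.piecewise_eq_indicator]
  exact (hh.continuousOn hm).measurable_piecewise continuousOn_const (measurableSet_cube r)

lemma abs_indicator_cube_le (hC : 0 ≤ C) (hψ : ∀ i ∈ anovaIndex r q, ∀ x ∈ cube r, |ψ i x| ≤ C)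
    {i : Fin r → ℕ} (hi : i ∈ anovaIndex r q) (x : Fin r → ℝ) :
    |(cube r).indicator (ψ i) x| ≤ C := by
  by_cases hx : x ∈ cube r
  · rw [indicator_of_mem hx]; exact hψ i hi x hx
  · rw [indicator_of_notMem hx]; simpa using hC

/-- By orthonormality under the design density, the entries of the empirical Gram matrix are
averages with mean 0 or 1. Their summands have second moment at most `C ^ 4`, and the product
weights sum to the square of the total weight. -/
lemma measure_lt_gramTerm_le (hm : 1 ≤ m) (hd : IsDesign P r X ε dens)
    (heig : IsEigensystem r m q dens ρ ψ) (hC : 0 ≤ C)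
    (hψ : ∀ i ∈ anovaIndex r q, ∀ x ∈ cube r, |ψ i x| ≤ C)
    {s : anovaIndex r q → ℝ} (hs : ∀ i, 0 ≤ s i) (hsum : Summable s) {n : ℕ} (hn : n ≠ 0)
    {t : ℝ} (ht : 0 < t) :
    P {ω | t < gramTerm s (fun i => ψ i) n (fun k => X k ω)} ≤
      ENNReal.ofReal ((∑' i, s i) ^ 2 * (C ^ 4 / n) / t) := by
  classical
  set g : anovaIndex r q → (Fin r → ℝ) → ℝ := fun i => (cube r).indicator (ψ i) with hg
  have hgm : ∀ i, Measurable (g i) := fun i => heig.measurable_indicator hm i.2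
  have hgC : ∀ i x, |g i x| ≤ C := fun i x => abs_indicator_cube_le hC hψ i.2 x
  have hgX : ∀ i k ω, g i (X k ω) = ψ i (X k ω) := fun i k ω =>
    indicator_of_mem (hd.mem_cube k ω) _
  have hprod := hasSum_mul_self hsum.hasSum hsum.norm
  have hbound : ∀ (p : anovaIndex r q × anovaIndex r q) x, |g p.1 x * g p.2 x| ≤ C ^ 2 := by
    intro p x
    rw [abs_mul, sq]
    exact mul_le_mul (hgC _ _) (hgC _ _) (abs_nonneg _) hC
  have hGm : ∀ p : anovaIndex r q × anovaIndex r q,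
      Measurable fun z : (Fin r → ℝ) × ℝ => g p.1 z.1 * g p.2 z.1 := fun p =>
    ((hgm p.1).comp measurable_fst).mul ((hgm p.2).comp measurable_fst)
  have hWm : ∀ k, Measurable fun ω => (X k ω, ε k ω) := fun k =>
    (hd.measurable_X k).prodMk (hd.measurable_noise k)
  have key := measure_lt_tsum_sq_le (P := P) (W := fun k ω => (X k ω, ε k ω)) hd.indep
    hWm hd.identDistrib
    (G := fun (p : anovaIndex r q × anovaIndex r q) z => g p.1 z.1 * g p.2 z.1) hGm
    (fun p => MemLp.of_bound ((hGm p).comp (hWm 0)).aestronglyMeasurable (C ^ 2)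
      (Eventually.of_forall fun ω => hbound p _))
    (B := C ^ 4) (fun p => ?_) (w := fun p => s p.1 * s p.2)
    (fun p => mul_nonneg (hs _) (hs _)) hprod.summable hn ht
  · rw [hprod.tsum_eq] at key
    have hmean : ∀ p : anovaIndex r q × anovaIndex r q,
        ∫ ω, g p.1 (X 0 ω) * g p.2 (X 0 ω) ∂P = if p.1 = p.2 then 1 else 0 := by
      intro p
      rw [hd.integral_comp (g := fun x => g p.1 x * g p.2 x) ((hgm p.1).mul (hgm p.2))]
      simp only [Subtype.ext_iff]
      rw [← heig.orthonormal _ p.1.2 _ p.2.2, innerL2]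
      refine setIntegral_congr_fun (measurableSet_cube r) fun x hx => ?_
      simp only [hg, indicator_of_mem hx]
    simp only [hgX] at hmean key
    simp only [hmean] at key
    simp only [gramTerm]
    convert key
  · have h1 : ∀ ω, (g p.1 (X 0 ω) * g p.2 (X 0 ω)) ^ 2 ≤ C ^ 4 := by
      intro ω
      rw [← sq_abs, show C ^ 4 = (C ^ 2) ^ 2 by ring]
      exact pow_le_pow_left₀ (abs_nonneg _) (hbound p _) 2
    calc ∫ ω, (g p.1 (X 0 ω) * g p.2 (X 0 ω)) ^ 2 ∂P ≤ ∫ _, C ^ 4 ∂P :=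
          integral_mono_of_nonneg (Eventually.of_forall fun ω => sq_nonneg _)
            (integrable_const _) (Eventually.of_forall h1)
      _ = C ^ 4 := by simp

/-- The averages are centred because the noise has conditional mean zero, and the total weight
enters only to the first power. -/
lemma measure_lt_noiseTerm_le (hm : 1 ≤ m) (hd : IsDesign P r X ε dens)
    (hε : IsNoise P (X 0) (ε 0)) (heig : IsEigensystem r m q dens ρ ψ) (hC : 0 ≤ C)
    (hψ : ∀ i ∈ anovaIndex r q, ∀ x ∈ cube r, |ψ i x| ≤ C)
    {s : anovaIndex r q → ℝ} (hs : ∀ i, 0 ≤ s i) (hsum : Summable s) {n : ℕ} (hn : n ≠ 0)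
    {t : ℝ} (ht : 0 < t) :
    P {ω | t < noiseTerm s (fun i => ψ i) n (fun k => X k ω) (fun k => ε k ω)} ≤
      ENNReal.ofReal ((∑' i, s i) * ((C ^ 2 * ∫ ω, ε 0 ω ^ 2 ∂P) / n) / t) := by
  set g : anovaIndex r q → (Fin r → ℝ) → ℝ := fun i => (cube r).indicator (ψ i) with hg
  have hgm : ∀ i, Measurable (g i) := fun i => heig.measurable_indicator hm i.2
  have hgC : ∀ i x, |g i x| ≤ C := fun i x => abs_indicator_cube_le hC hψ i.2 x
  have hgX : ∀ i k ω, g i (X k ω) = ψ i (X k ω) := fun i k ω =>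
    indicator_of_mem (hd.mem_cube k ω) _
  have hGm : ∀ i : anovaIndex r q,
      Measurable fun z : (Fin r → ℝ) × ℝ => z.2 * g i z.1 := fun i =>
    measurable_snd.mul ((hgm i).comp measurable_fst)
  have hWm : ∀ k, Measurable fun ω => (X k ω, ε k ω) := fun k =>
    (hd.measurable_X k).prodMk (hd.measurable_noise k)
  have hεL := hε.memLp (hd.measurable_noise 0)
  have hε2 := hεL.integrable_sq
  have key := measure_lt_tsum_sq_le (P := P) (W := fun k ω => (X k ω, ε k ω)) hd.indep
    hWm hd.identDistrib (G := fun i z => z.2 * g i z.1) hGm (fun i => ?_)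
    (B := C ^ 2 * ∫ ω, ε 0 ω ^ 2 ∂P)
    (fun i => ?_) hs hsum hn ht
  · have hmean : ∀ i, ∫ ω, ε 0 ω * g i (X 0 ω) ∂P = 0 := fun i =>
      hε.integral_mul_eq_zero (hd.measurable_X 0) (hd.measurable_noise 0) (hgm i) (hgC i)
    simp only [hgX] at hmean key
    simp only [hmean, sub_zero] at key
    exact key
  · refine (hεL.const_mul C).of_le ((hGm i).comp (hWm 0)).aestronglyMeasurable
      (Eventually.of_forall fun ω => ?_)
    simp only [norm_mul, Real.norm_eq_abs, abs_of_nonneg hC]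
    rw [mul_comm]
    exact mul_le_mul_of_nonneg_right (hgC _ _) (abs_nonneg _)
  · rw [← integral_const_mul]
    refine integral_mono_of_nonneg (Eventually.of_forall fun ω => sq_nonneg _)
      (hε2.const_mul _) (Eventually.of_forall fun ω => ?_)
    simp only [mul_pow]
    rw [mul_comm]
    refine mul_le_mul_of_nonneg_right ?_ (sq_nonneg _)
    rw [← sq_abs]
    exact pow_le_pow_left₀ (abs_nonneg _) (hgC _ _) 2

end Empirical

/-! ### Calculus of stochastic orders -/

section StochasticOrder

variable {Ω : Type*} [MeasurableSpace Ω] {P : Measure Ω}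

lemma supNorm_sq_le {r : ℕ} {f : (Fin r → ℝ) → ℝ} {V : ℝ} (hV : 0 ≤ V)
    (h : ∀ x ∈ cube r, f x ^ 2 ≤ V) : supNorm f ^ 2 ≤ ENNReal.ofReal V := by
  have h1 : supNorm f ≤ ENNReal.ofReal (Real.sqrt V) := by
    refine iSup₂_le fun x hx => ?_
    rw [← ofReal_norm]
    exact ENNReal.ofReal_le_ofReal (Real.abs_le_sqrt (h x hx))
  calc supNorm f ^ 2 ≤ ENNReal.ofReal (Real.sqrt V) ^ 2 := by gcongr
    _ = ENNReal.ofReal V := by rw [← ENNReal.ofReal_pow (Real.sqrt_nonneg _), Real.sq_sqrt hV]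

lemma IsBigOP.of_isBigO {Z : ℕ → Ω → ℝ≥0∞} {a b : ℕ → ℝ} (h : IsBigOP P Z a)
    (hab : a =O[atTop] b) (hb : ∀ᶠ n in atTop, 0 ≤ b n) : IsBigOP P Z b := by
  intro δ hδ
  obtain ⟨C, hC, hCn⟩ := h δ hδ
  obtain ⟨D, hD, hDn⟩ := hab.exists_pos
  refine ⟨C * D, by positivity, ?_⟩
  filter_upwards [hCn, hDn.bound, hb] with n h1 h2 h3
  refine (measure_mono fun ω hω => ?_).trans h1
  refine lt_of_le_of_lt (ENNReal.ofReal_le_ofReal ?_) hω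
  rw [Real.norm_of_nonneg h3] at h2
  rw [mul_assoc]
  exact mul_le_mul_of_nonneg_left ((le_abs_self _).trans h2) hC.le

lemma IsBigOP.isLittleOPOne {Z : ℕ → Ω → ℝ≥0∞} {a : ℕ → ℝ}
    (h : IsBigOP P (fun n ω => Z n ω ^ 2) a) (ha : Tendsto a atTop (𝓝 0)) :
    IsLittleOPOne P Z := by
  intro δ hδ
  rw [ENNReal.tendsto_nhds_zero]
  intro η hη
  obtain ⟨C, hC, hCn⟩ := h η hη
  have h1 : Tendsto (fun n => C * a n) atTop (𝓝 0) := by simpa using ha.const_mul C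
  filter_upwards [hCn, h1.eventually (gt_mem_nhds (show 0 < δ ^ 2 by positivity))] with n h2 h3
  refine (measure_mono fun ω hω => ?_).trans h2
  calc ENNReal.ofReal (C * a n) ≤ ENNReal.ofReal (δ ^ 2) := ENNReal.ofReal_le_ofReal h3.le
    _ = ENNReal.ofReal δ ^ 2 := ENNReal.ofReal_pow hδ.le 2
    _ < Z n ω ^ 2 := by
      have hω' : ENNReal.ofReal δ < Z n ω := hω
      exact ENNReal.pow_lt_pow_left two_ne_zero hω'

end StochasticOrder

/-! ### Powers of n, lam and log n -/

section Rates

lemma tendsto_rpow_mul_log_rpow {α : ℝ} (hα : α < 0) (γ : ℝ) :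
    Tendsto (fun n : ℕ => (n : ℝ) ^ α * Real.log n ^ γ) atTop (𝓝 0) := by
  have h1 := (isLittleO_log_rpow_rpow_atTop γ (neg_pos.2 hα)).tendsto_div_nhds_zero
  have h2 := h1.comp tendsto_natCast_atTop_atTop
  refine h2.congr fun n => ?_
  simp only [Function.comp]
  rw [Real.rpow_neg (Nat.cast_nonneg n), div_inv_eq_mul, mul_comm]

lemma eventually_log_pos : ∀ᶠ n : ℕ in atTop, 0 < (n : ℝ) ∧ 0 < Real.log n := by
  filter_upwards [eventually_ge_atTop 2] with n hn
  have h : (2 : ℝ) ≤ n := by exact_mod_cast hn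
  exact ⟨by linarith, Real.log_pos (by linarith)⟩

/-- Products of powers of `n`, `lam n` and `log n` when `lam` has polynomial order up to
logarithms. -/
lemma isTheta_rate {lam : ℕ → ℝ} (hlam : ∀ n, 0 < lam n) {c a : ℝ}
    (h : lam =Θ[atTop] fun n : ℕ => ((n : ℝ) * Real.log n ^ c) ^ a) (t s u : ℝ) :
    (fun n : ℕ => (n : ℝ) ^ t * lam n ^ s * Real.log n ^ u) =Θ[atTop]
      fun n : ℕ => (n : ℝ) ^ (t + a * s) * Real.log n ^ (c * a * s + u) := by
  have h1 : (fun n => lam n ^ s) =Θ[atTop]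
      fun n : ℕ => (((n : ℝ) * Real.log n ^ c) ^ a) ^ s :=
    Asymptotics.IsTheta.rpow (Eventually.of_forall fun n => (hlam n).le)
      (eventually_log_pos.mono fun n hn => by
        have := hn.1; have := hn.2; simp only [Pi.zero_apply]; positivity) h
  have h2 := ((Asymptotics.isTheta_refl (fun n : ℕ => (n : ℝ) ^ t) atTop).mul h1).mul
    (Asymptotics.isTheta_refl (fun n : ℕ => Real.log n ^ u) atTop)
  refine h2.trans_eventuallyEq ?_
  filter_upwards [eventually_log_pos] with n hn
  obtain ⟨hn, hl⟩ := hn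
  have hlc : 0 < Real.log n ^ c := Real.rpow_pos_of_pos hl c
  rw [← Real.rpow_mul (by positivity), Real.mul_rpow hn.le hlc.le, ← Real.rpow_mul hl.le,
    Real.rpow_add hn, Real.rpow_add hl, mul_assoc c]
  ring

lemma tendsto_atTop_of_isTheta {f : ℕ → ℝ} (hf : ∀ᶠ n in atTop, 0 < f n) {α γ : ℝ} (hα : 0 < α)
    (h : f =Θ[atTop] fun n : ℕ => (n : ℝ) ^ α * Real.log n ^ γ) : Tendsto f atTop atTop := by
  have h1 : Tendsto (fun n => (f n)⁻¹) atTop (𝓝 0) := by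
    refine h.inv.isBigO.trans_tendsto
      ((tendsto_rpow_mul_log_rpow (neg_neg_of_pos hα) (-γ)).congr' ?_)
    filter_upwards [eventually_log_pos] with n hn
    rw [Real.rpow_neg hn.1.le, Real.rpow_neg hn.2.le, mul_inv]
  have h2 : Tendsto (fun n => (f n)⁻¹) atTop (𝓝[>] 0) :=
    tendsto_nhdsWithin_iff.2 ⟨h1, hf.mono fun n hn => inv_pos.2 hn⟩
  exact h2.inv_tendsto_nhdsGT_zero.congr fun n => inv_inv (f n)

end Rates

/-! ### The bound in probability and the general rate -/

section Main

variable {Ω : Type*} [MeasurableSpace Ω] {P : Measure Ω} [IsProbabilityMeasure P] {r m q : ℕ}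
  {β : Fin r → ℕ} {X : ℕ → Ω → Fin r → ℝ} {ε : ℕ → Ω → ℝ} {dens : (Fin r → ℝ) → ℝ}
  {ρ : (Fin r → ℕ) → ℝ} {ψ : (Fin r → ℕ) → (Fin r → ℝ) → ℝ} {f₀ : (Fin r → ℝ) → ℝ}

lemma nMax_pos (hr : 1 ≤ r) (β : Fin r → ℕ) : 1 ≤ nMax β := by
  obtain ⟨k, -, hk⟩ := Finset.exists_mem_eq_sup (Finset.univ : Finset (Fin r))
    ⟨⟨0, hr⟩, Finset.mem_univ _⟩ β
  exact Finset.card_pos.2 ⟨k, Finset.mem_filter.2 ⟨Finset.mem_univ _, hk.symm⟩⟩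

/-- A non-asymptotic bound in probability: constants depend only on the model. -/
lemma exists_measure_lt_supNorm_le (hβm : betaMax β + 1 ≤ m) (hf₀ : MemH r m q f₀)
    (hd : IsDesign P r X ε dens) (hε : IsNoise P (X 0) (ε 0))
    (heig : IsEigensystem r m q dens ρ ψ) (hψ : EigenfunctionBounds r q β ψ) :
    ∃ A > 0, ∃ K > 0, ∃ L > 0, ∀ (n : ℕ) (lam : ℝ), 3 ≤ n → 0 < lam → lam ≤ A →
      lam ^ (-(1 / (m : ℝ))) ≤ n → ∀ fhat : Ω → (Fin r → ℝ) → ℝ,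
      (∀ ω, IsKRR r m q n lam (fun i => X i ω) (fun i => f₀ (X i ω) + ε i ω) (fhat ω)) →
      ∀ η > 0, P {ω | ENNReal.ofReal (K * (1 + η⁻¹) *
          ((lam ^ (-(1 / (2 * (m : ℝ)))) * Real.log n ^ (q - 1) / n + lam) *
            (lam ^ (-((2 * (betaMax β : ℝ) + 1) / (2 * m))) *
              Real.log n ^ (min (nMax β) q - 1)))) <
          supNorm (fun x => mixedDer β (fhat ω) x - mixedDer β f₀ x) ^ 2} ≤
        ENNReal.ofReal (L * (lam ^ (-(1 / (m : ℝ))) * Real.log n ^ (2 * (q - 1)) / n)) +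
          ENNReal.ofReal η := by
  have hm : 1 ≤ m := by omega
  obtain ⟨A, hA, hρ⟩ := exists_eigenvalue_le hm hd.measurable_dens hd.dens_bounds heig
  obtain ⟨C, hC, hψ⟩ := hψ
  obtain ⟨K₀, hK₀, hS⟩ := exists_tsum_shrink_le_zero hm heig.pos hA hρ
  obtain ⟨K₁, hK₁, hT⟩ := exists_tsum_shrink_le_betaMax hβm heig.pos hA hρ
  obtain ⟨h₀, hh₀⟩ := (memH_iff hm).1 hf₀
  have hR : ∀ i ∈ anovaIndex r q, ρ i ≤ A := by
    intro i hi
    refine (hρ i hi).trans (mul_le_of_le_one_right hA.le (pow_le_one₀ (by positivity) ?_))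
    refine inv_le_one_of_one_le₀ ?_
    exact_mod_cast Finset.one_le_prod' fun k _ => hi.1 k
  have hβ : ∀ k, β k < m := fun k =>
    lt_of_le_of_lt (Finset.le_sup (f := β) (Finset.mem_univ k)) hβm
  set σ2 := ∫ ω, ε 0 ω ^ 2 ∂P with hσ2
  have hσ : 0 ≤ σ2 := integral_nonneg fun _ => sq_nonneg _
  -- The added 1 makes the Markov threshold `t` positive without a lower bound on the variance.
  set B := C ^ 2 * σ2 + 1 with hB
  have hBpos : 0 < B := by positivity
  refine ⟨A, hA, 16 * C ^ 2 * K₁ * (K₀ * B + ‖h₀‖ ^ 2), by positivity, K₀ ^ 2 * C ^ 4 * 16,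
    by positivity, ?_⟩
  intro n lam hn hlam hlamA hnlam fhat hfhat η hη
  obtain ⟨hsum, hSle⟩ := hS n lam hn hlam hlamA hnlam
  obtain ⟨hsumβ, hTle⟩ := hT n lam hn hlam hlamA hnlam
  have hn' : (3 : ℝ) ≤ n := by exact_mod_cast hn
  have hlog : 0 < Real.log n := Real.log_pos (by linarith)
  set s : anovaIndex r q → ℝ := fun i => shrink lam (ρ i) with hs
  have hspos : ∀ i, 0 ≤ s i := fun i => (shrink_pos hlam (heig.pos i i.2)).le
  set U := lam ^ (-(1 / (2 * (m : ℝ)))) * Real.log n ^ (q - 1) with hU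
  set T := lam ^ (-((2 * (betaMax β : ℝ) + 1) / (2 * m))) * Real.log n ^ (min (nMax β) q - 1)
    with hTdef
  have hUpos : 0 < U := by positivity
  have hTpos : 0 < T := by positivity
  have hS0 : 0 ≤ ∑' i, s i := tsum_nonneg hspos
  have hU2 : U ^ 2 = lam ^ (-(1 / (m : ℝ))) * Real.log n ^ (2 * (q - 1)) := by
    rw [hU, mul_pow, ← Real.rpow_natCast, ← Real.rpow_mul hlam.le, ← pow_mul, mul_comm (q - 1) 2]
    congr 2
    push_cast
    field_simp
  -- The threshold at which Markov's inequality bounds the noise event by `η`.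
  set t := K₀ * U * (B / n) / η with ht
  have htpos : 0 < t := by positivity
  have hψ1 : ∀ i ∈ anovaIndex r q, ∀ x ∈ cube r, |ψ i x| ≤ C := fun i hi x hx => (hψ i hi x hx).1
  have hgram := measure_lt_gramTerm_le hm hd heig hC.le hψ1 hspos hsum (n := n) (by omega)
    (t := 1 / 16) (by norm_num)
  have hnoise := measure_lt_noiseTerm_le hm hd hε heig hC.le hψ1 hspos hsum (n := n) (by omega)
    htpos
  have hgram' : P {ω | 1 / 16 < gramTerm s (fun i => ψ i) n (fun k => X k ω)} ≤
      ENNReal.ofReal (K₀ ^ 2 * C ^ 4 * 16 *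
        (lam ^ (-(1 / (m : ℝ))) * Real.log n ^ (2 * (q - 1)) / n)) := by
    refine hgram.trans (ENNReal.ofReal_le_ofReal ?_)
    rw [← hU2]
    have h1 : (∑' i, s i) ^ 2 ≤ (K₀ * U) ^ 2 := pow_le_pow_left₀ hS0 hSle 2
    calc (∑' i, s i) ^ 2 * (C ^ 4 / n) / (1 / 16) ≤ (K₀ * U) ^ 2 * (C ^ 4 / n) / (1 / 16) := by
          gcongr
      _ = _ := by ring
  have hnoise' : P {ω | t < noiseTerm s (fun i => ψ i) n (fun k => X k ω) (fun k => ε k ω)} ≤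
      ENNReal.ofReal η := by
    refine hnoise.trans (ENNReal.ofReal_le_ofReal ?_)
    rw [div_le_iff₀ htpos, ht, mul_div_cancel₀ _ hη.ne']
    have h1 : C ^ 2 * σ2 ≤ B := by rw [hB]; linarith
    gcongr
  -- An inclusion of events is enough, so the estimator need not be measurable in `ω`.
  refine le_trans (measure_mono (t := {ω | 1 / 16 < gramTerm s (fun i => ψ i) n (fun k => X k ω)} ∪
    {ω | t < noiseTerm s (fun i => ψ i) n (fun k => X k ω) (fun k => ε k ω)}) ?_)
    ((measure_union_le _ _).trans (add_le_add hgram' hnoise'))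
  intro ω hω
  by_contra hcon
  simp only [mem_union, mem_ofPred_eq, not_or, not_lt] at hcon
  refine absurd hω (not_lt.2 (supNorm_sq_le (by positivity) fun y hy => ?_))
  refine (sq_mixedDer_sub_le hm heig hβ hψ hR hh₀ hlam hsum hsumβ (fun k => hd.mem_cube k ω)
    (hfhat ω) hcon.1 hy).trans ?_
  have h1 : t + lam * ‖h₀‖ ^ 2 ≤ (K₀ * B + ‖h₀‖ ^ 2) * (1 + η⁻¹) * (U / n + lam) := by
    have e1 : t = K₀ * B * η⁻¹ * (U / n) := by rw [ht]; ring
    have p1 : 0 ≤ K₀ * B := by positivity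
    have p2 : 0 < η⁻¹ := inv_pos.2 hη
    have p3 : 0 ≤ U / n := by positivity
    have p4 : 0 ≤ ‖h₀‖ ^ 2 := by positivity
    have a1 : K₀ * B * η⁻¹ ≤ (K₀ * B + ‖h₀‖ ^ 2) * (1 + η⁻¹) := by nlinarith
    have a2 : ‖h₀‖ ^ 2 ≤ (K₀ * B + ‖h₀‖ ^ 2) * (1 + η⁻¹) := by nlinarith
    have a3 := add_le_add (mul_le_mul_of_nonneg_right a1 p3) (mul_le_mul_of_nonneg_right a2 hlam.le)
    rw [e1]
    linarith
  calc 16 * (noiseTerm s (fun i => ψ i) n (fun k => X k ω) (fun k => ε k ω) + lam * ‖h₀‖ ^ 2) *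
        (C ^ 2 * ∑' i : anovaIndex r q, (∏ k, (i.1 k : ℝ) ^ (2 * β k)) * s i)
      ≤ 16 * (t + lam * ‖h₀‖ ^ 2) * (C ^ 2 * (K₁ * T)) := by
        have hT0 : 0 ≤ ∑' i : anovaIndex r q, (∏ k, (i.1 k : ℝ) ^ (2 * β k)) * s i :=
          tsum_nonneg fun i => mul_nonneg (Finset.prod_nonneg fun k _ => by positivity) (hspos i)
        gcongr
        exact hcon.2
    _ ≤ 16 * ((K₀ * B + ‖h₀‖ ^ 2) * (1 + η⁻¹) * (U / n + lam)) * (C ^ 2 * (K₁ * T)) := by gcongr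
    _ = _ := by ring

/-- The two terms of the rate share the spectral factor; the other factor is variance plus penalty.
`1 ≤ q` and `1 ≤ N` make the natural subtractions agree with the real exponents. -/
lemma rate_eq {lam l : ℝ} (hlam : 0 < lam) (hm : 1 ≤ m) (hq : 1 ≤ q) {N b n : ℕ}
    (hN : 1 ≤ N) :
    (lam ^ (-(1 / (2 * (m : ℝ)))) * l ^ (q - 1) / n + lam) *
        (lam ^ (-((2 * (b : ℝ) + 1) / (2 * m))) * l ^ (N - 1)) =
      lam ^ (1 - (2 * (b : ℝ) + 1) / (2 * (m : ℝ))) * l ^ ((N : ℝ) - 1) +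
        (n : ℝ)⁻¹ * lam ^ (-(((b : ℝ) + 1) / (m : ℝ))) * l ^ ((N : ℝ) + (q : ℝ) - 2) := by
  have hm' : (m : ℝ) ≠ 0 := by positivity
  have e1 : l ^ ((N : ℝ) - 1) = l ^ (N - 1) := by
    rw [← Real.rpow_natCast, Nat.cast_sub hN, Nat.cast_one]
  have e2 : l ^ ((N : ℝ) + (q : ℝ) - 2) = l ^ (q - 1) * l ^ (N - 1) := by
    rw [← pow_add, ← Real.rpow_natCast, Nat.cast_add, Nat.cast_sub hN, Nat.cast_sub hq]
    congr 1
    push_cast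
    ring
  have e3 : lam ^ (1 - (2 * (b : ℝ) + 1) / (2 * (m : ℝ))) =
      lam * lam ^ (-((2 * (b : ℝ) + 1) / (2 * m))) := by
    rw [sub_eq_add_neg, Real.rpow_add hlam, Real.rpow_one]
  have e4 : lam ^ (-(((b : ℝ) + 1) / (m : ℝ))) =
      lam ^ (-(1 / (2 * (m : ℝ)))) * lam ^ (-((2 * (b : ℝ) + 1) / (2 * m))) := by
    rw [← Real.rpow_add hlam]
    congr 1
    field_simp
    ring
  rw [e1, e2, e3, e4]
  ring

/-- The Gram event has vanishing probability by the growth condition, and the noise event has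
probability at most a prescribed `η` at the price of the constant `1 + η⁻¹`. -/
theorem isBigOP_supNorm_sq (hq : 1 ≤ q) (hqr : q ≤ r) (hβm : betaMax β + 1 ≤ m)
    (hf₀ : MemH r m q f₀) (hd : IsDesign P r X ε dens) (hε : IsNoise P (X 0) (ε 0))
    (heig : IsEigensystem r m q dens ρ ψ) (hψ : EigenfunctionBounds r q β ψ)
    {lam : ℕ → ℝ} (hlam : ∀ n, 0 < lam n) {fhat : ℕ → Ω → (Fin r → ℝ) → ℝ}
    (hfhat : ∀ n ω, IsKRR r m q n (lam n) (fun i => X i ω)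
      (fun i => f₀ (X i ω) + ε i ω) (fhat n ω))
    (hlarge : Tendsto (fun n : ℕ => (n : ℝ) * lam n ^ (1 / (m : ℝ)) *
      Real.log n ^ (2 - 2 * (q : ℝ))) atTop atTop)
    (hsmall : Tendsto lam atTop (𝓝 0)) :
    IsBigOP P
      (fun n ω => supNorm (fun x => mixedDer β (fhat n ω) x - mixedDer β f₀ x) ^ 2)
      (fun n : ℕ =>
        lam n ^ (1 - (2 * (betaMax β : ℝ) + 1) / (2 * (m : ℝ)))
            * Real.log n ^ (((min (nMax β) q : ℕ) : ℝ) - 1)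
          + (n : ℝ)⁻¹ * lam n ^ (-(((betaMax β : ℝ) + 1) / (m : ℝ)))
            * Real.log n ^ (((min (nMax β) q : ℕ) : ℝ) + (q : ℝ) - 2)) := by
  have hm : 1 ≤ m := by omega
  have hN : 1 ≤ min (nMax β) q := le_min (nMax_pos (hq.trans hqr) β) hq
  obtain ⟨A, hA, K, hK, L, hL, hmain⟩ := exists_measure_lt_supNorm_le hβm hf₀ hd hε heig hψ
  have hgl : ∀ᶠ n : ℕ in atTop, 3 ≤ n ∧ 1 ≤ Real.log n := by
    filter_upwards [eventually_ge_atTop 3] with n hn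
    have hn' : (3 : ℝ) ≤ n := by exact_mod_cast hn
    refine ⟨hn, ?_⟩
    rw [Real.le_log_iff_exp_le (by linarith)]
    linarith [Real.exp_one_lt_d9]
  -- The bound on the Gram event is a constant times the inverse of the quantity assumed to diverge.
  have hinv : ∀ᶠ n : ℕ in atTop, lam n ^ (-(1 / (m : ℝ))) * Real.log n ^ (2 * (q - 1)) / n =
      ((n : ℝ) * lam n ^ (1 / (m : ℝ)) * Real.log n ^ (2 - 2 * (q : ℝ)))⁻¹ := by
    filter_upwards [hgl] with n hn
    have h1 : Real.log n ^ (2 - 2 * (q : ℝ)) = (Real.log n ^ (2 * (q - 1)))⁻¹ := by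
      rw [← Real.rpow_natCast, ← Real.rpow_neg (by linarith [hn.2])]
      congr 1
      push_cast [Nat.cast_sub hq]
      ring
    rw [h1, Real.rpow_neg (hlam n).le, mul_inv, mul_inv, inv_inv]
    ring
  have hgram0 : Tendsto (fun n : ℕ => L * (lam n ^ (-(1 / (m : ℝ))) *
      Real.log n ^ (2 * (q - 1)) / n)) atTop (𝓝 0) := by
    have h1 := (tendsto_inv_atTop_zero.comp hlarge).const_mul L
    rw [mul_zero] at h1
    refine h1.congr' ?_
    filter_upwards [hinv] with n hn
    rw [hn, Function.comp]
  have hnlam : ∀ᶠ n : ℕ in atTop, lam n ^ (-(1 / (m : ℝ))) ≤ n := by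
    filter_upwards [hgl, hinv, hlarge.eventually_ge_atTop 1] with n hn h1 h2
    have h3 : lam n ^ (-(1 / (m : ℝ))) * Real.log n ^ (2 * (q - 1)) / n ≤ 1 := by
      rw [h1]; exact inv_le_one_of_one_le₀ h2
    have hn' : (0 : ℝ) < n := by have := hn.1; positivity
    rw [div_le_one hn'] at h3
    exact (le_mul_of_one_le_right (Real.rpow_nonneg (hlam n).le _) (one_le_pow₀ hn.2)).trans h3
  intro δ hδ
  -- The minimum with 1 covers `δ = ∞`; one half each is spent on the noise and Gram events.
  set η := (min δ 1).toReal / 2 with hη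
  have hδ1 : min δ 1 ≠ ⊤ := ne_top_of_le_ne_top ENNReal.one_ne_top (min_le_right _ _)
  have hηpos : 0 < η := half_pos (ENNReal.toReal_pos (lt_min hδ one_pos).ne' hδ1)
  refine ⟨K * (1 + η⁻¹), by positivity, ?_⟩
  filter_upwards [hgl, hnlam, hsmall.eventually (ge_mem_nhds hA),
    hgram0.eventually (ge_mem_nhds hηpos)] with n h1 h2 h3 h4
  rw [← rate_eq (hlam n) hm hq hN]
  refine (hmain n (lam n) h1.1 (hlam n) h3 h2 (fhat n) (hfhat n) η hηpos).trans ?_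
  calc _ ≤ ENNReal.ofReal η + ENNReal.ofReal η := by gcongr
    _ = ENNReal.ofReal (η + η) := (ENNReal.ofReal_add hηpos.le hηpos.le).symm
    _ = min δ 1 := by rw [hη, add_halves, ENNReal.ofReal_toReal hδ1]
    _ ≤ δ := min_le_left _ _

end Main

end SSAnova

end

/-! ### The prescribed choices of lam -/

open SSAnova in
theorem corollary1 {Ω : Type*} [MeasurableSpace Ω] (P : Measure Ω) [IsProbabilityMeasure P]
    (r m q : ℕ) (hq : 1 ≤ q) (hqr : q ≤ r)
    (β : Fin r → ℕ) (hβq : (Finset.univ.filter fun s => 0 < β s).card ≤ q)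
    (hβm : betaMax β + 1 ≤ m)
    (f₀ : (Fin r → ℝ) → ℝ) (hf₀ : MemH r m q f₀)
    (X : ℕ → Ω → Fin r → ℝ) (ε : ℕ → Ω → ℝ) (dens : (Fin r → ℝ) → ℝ)
    (hdesign : IsDesign P r X ε dens) (hnoise : IsNoise P (X 0) (ε 0))
    (ρ : (Fin r → ℕ) → ℝ) (ψ : (Fin r → ℕ) → (Fin r → ℝ) → ℝ)
    (heig : IsEigensystem r m q dens ρ ψ) (hψ : EigenfunctionBounds r q β ψ)
    (lam : ℕ → ℝ) (hlam : ∀ n, 0 < lam n)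
    (fhat : ℕ → Ω → (Fin r → ℝ) → ℝ)
    (hfhat : ∀ n ω, IsKRR r m q n (lam n) (fun i => X i ω)
      (fun i => f₀ (X i ω) + ε i ω) (fhat n ω)) :
    (Tendsto (fun n : ℕ => (n : ℝ) * lam n ^ (1 / (m : ℝ)) * Real.log n ^ (2 - 2 * (q : ℝ)))
        atTop atTop →
      Tendsto lam atTop (𝓝 0) →
      IsBigOP P
        (fun n ω => supNorm (fun x => mixedDer β (fhat n ω) x - mixedDer β f₀ x) ^ 2)
        (fun n : ℕ =>
          lam n ^ (1 - (2 * (betaMax β : ℝ) + 1) / (2 * (m : ℝ)))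
              * Real.log n ^ (((min (nMax β) q : ℕ) : ℝ) - 1)
            + (n : ℝ)⁻¹ * lam n ^ (-(((betaMax β : ℝ) + 1) / (m : ℝ)))
              * Real.log n ^ (((min (nMax β) q : ℕ) : ℝ) + (q : ℝ) - 2))) ∧
    (lam =Θ[atTop] (fun n : ℕ =>
          ((n : ℝ) * Real.log n ^ (1 - (q : ℝ))) ^ (-(2 * (m : ℝ) / (2 * (m : ℝ) + 1)))) →
      IsBigOP P
        (fun n ω => supNorm (fun x => mixedDer β (fhat n ω) x - mixedDer β f₀ x) ^ 2)
        (fun n : ℕ =>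
          (n : ℝ) ^ (-((2 * (m : ℝ) - 2 * (betaMax β : ℝ) - 1) / (2 * (m : ℝ) + 1)))
            * Real.log n ^
              (((q : ℝ) - 1) * (2 * (m : ℝ) - 2 * (betaMax β : ℝ) - 1) / (2 * (m : ℝ) + 1)
                + ((min (nMax β) q : ℕ) : ℝ) - 1))) ∧
    (∀ ν : ℝ, 0 < ν → ν < (m : ℝ) / ((betaMax β : ℝ) + 1) →
      lam =Θ[atTop] (fun n : ℕ => (n : ℝ) ^ (-ν)) →
      IsLittleOPOne P
        (fun n ω => supNorm (fun x => mixedDer β (fhat n ω) x - mixedDer β f₀ x))) := by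
  have hm : 1 ≤ m := by omega
  have hm' : (1 : ℝ) ≤ m := by exact_mod_cast hm
  have hb : (betaMax β : ℝ) + 1 ≤ m := by exact_mod_cast hβm
  have hb0 : (0 : ℝ) ≤ betaMax β := Nat.cast_nonneg _
  have main := isBigOP_supNorm_sq (lam := lam) hq hqr hβm hf₀ hdesign hnoise heig hψ hlam hfhat
  -- For `lam` of order `(n log^c n)^a`, powers of `n` decide both conditions whatever the
  -- logarithms: `a < 0` and `1 + a / m > 0`.
  have hcond : ∀ a c : ℝ, lam =Θ[atTop] (fun n : ℕ => ((n : ℝ) * Real.log n ^ c) ^ a) →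
      a < 0 → 0 < 1 + a * (1 / (m : ℝ)) →
      Tendsto (fun n : ℕ => (n : ℝ) * lam n ^ (1 / (m : ℝ)) * Real.log n ^ (2 - 2 * (q : ℝ)))
        atTop atTop ∧ Tendsto lam atTop (𝓝 0) := by
    intro a c hΘ ha ham
    constructor
    · refine tendsto_atTop_of_isTheta (γ := c * a * (1 / (m : ℝ)) + (2 - 2 * (q : ℝ))) ?_ ham ?_
      · filter_upwards [eventually_log_pos] with n hn
        have := hn.1
        have := hn.2
        have := hlam n
        positivity
      · simpa only [Real.rpow_one] using
          isTheta_rate hlam hΘ 1 (1 / (m : ℝ)) (2 - 2 * (q : ℝ))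
    · have h1 := isTheta_rate hlam hΘ 0 1 0
      simp only [Real.rpow_zero, Real.rpow_one, one_mul, mul_one, zero_add, add_zero] at h1
      exact h1.isBigO.trans_tendsto (tendsto_rpow_mul_log_rpow ha _)
  refine ⟨main, fun hΘ => ?_, fun ν hν hνm hΘ => ?_⟩
  · have hden : (0 : ℝ) < 2 * m + 1 := by positivity
    obtain ⟨hlarge, hsmall⟩ := hcond _ _ hΘ (neg_neg_of_pos (by positivity)) (by
      have h1 : 1 + -(2 * (m : ℝ) / (2 * m + 1)) * (1 / (m : ℝ)) = (2 * m - 1) / (2 * m + 1) := by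
        field_simp
        ring
      rw [h1]
      exact div_pos (by linarith) hden)
    -- This `lam` balances penalty and variance, that is, `lam` against `n⁻¹ lam^(-1/(2m)) (log
    -- n)^(q-1)`, so both terms have the same order, including logarithms.
    refine (main hlarge hsmall).of_isBigO (Asymptotics.IsBigO.add ?_ ?_) ?_
    · have h1 := (isTheta_rate hlam hΘ 0 (1 - (2 * (betaMax β : ℝ) + 1) / (2 * (m : ℝ)))
        (((min (nMax β) q : ℕ) : ℝ) - 1)).isBigO
      simp only [Real.rpow_zero, one_mul] at h1
      have e1 : 0 + -(2 * (m : ℝ) / (2 * m + 1)) * (1 - (2 * (betaMax β : ℝ) + 1) / (2 * (m : ℝ))) =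
          -((2 * (m : ℝ) - 2 * (betaMax β : ℝ) - 1) / (2 * (m : ℝ) + 1)) := by
        field_simp
        ring
      have e2 : (1 - (q : ℝ)) * -(2 * (m : ℝ) / (2 * m + 1)) * (1 - (2 * (betaMax β : ℝ) + 1) / (2 * (m : ℝ))) +
          (((min (nMax β) q : ℕ) : ℝ) - 1) =
          ((q : ℝ) - 1) * (2 * (m : ℝ) - 2 * (betaMax β : ℝ) - 1) / (2 * (m : ℝ) + 1)
            + ((min (nMax β) q : ℕ) : ℝ) - 1 := by
        field_simp
        ring
      rw [e1, e2] at h1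
      exact h1
    · have h1 := (isTheta_rate hlam hΘ (-1) (-(((betaMax β : ℝ) + 1) / (m : ℝ)))
        (((min (nMax β) q : ℕ) : ℝ) + (q : ℝ) - 2)).isBigO
      simp only [Real.rpow_neg_one] at h1
      have e1 : -1 + -(2 * (m : ℝ) / (2 * m + 1)) * -(((betaMax β : ℝ) + 1) / (m : ℝ)) =
          -((2 * (m : ℝ) - 2 * (betaMax β : ℝ) - 1) / (2 * (m : ℝ) + 1)) := by
        field_simp
        ring
      have e2 : (1 - (q : ℝ)) * -(2 * (m : ℝ) / (2 * m + 1)) * -(((betaMax β : ℝ) + 1) / (m : ℝ)) +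
          (((min (nMax β) q : ℕ) : ℝ) + (q : ℝ) - 2) =
          ((q : ℝ) - 1) * (2 * (m : ℝ) - 2 * (betaMax β : ℝ) - 1) / (2 * (m : ℝ) + 1)
            + ((min (nMax β) q : ℕ) : ℝ) - 1 := by
        field_simp
        ring
      rw [e1, e2] at h1
      exact h1
    · filter_upwards [eventually_log_pos] with n hn
      have := hn.1
      have := hn.2
      positivity
  · have hΘ' : lam =Θ[atTop] fun n : ℕ => ((n : ℝ) * Real.log n ^ (0 : ℝ)) ^ (-ν) := by
      simpa only [Real.rpow_zero, mul_one] using hΘ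
    have hνb : ν * (betaMax β + 1) < m := (lt_div_iff₀ (by positivity)).1 hνm
    obtain ⟨hlarge, hsmall⟩ := hcond _ _ hΘ' (neg_neg_of_pos hν) (by
      have h1 : ν < m := by nlinarith
      have h2 : 1 + -ν * (1 / (m : ℝ)) = (m - ν) / m := by
        field_simp
        ring
      rw [h2]
      exact div_pos (by linarith) (by linarith))
    refine (main hlarge hsmall).isLittleOPOne ?_
    -- The first term vanishes because `2 * betaMax β + 1 < 2 * m`, the second because `ν * (betaMax
    -- β + 1) < m`; the logarithmic factors are negligible against a negative power of `n`.
    rw [← add_zero (0 : ℝ)]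
    refine Tendsto.add ?_ ?_
    · have h1 := (isTheta_rate hlam hΘ' 0 (1 - (2 * (betaMax β : ℝ) + 1) / (2 * (m : ℝ)))
        (((min (nMax β) q : ℕ) : ℝ) - 1)).isBigO
      simp only [Real.rpow_zero, one_mul] at h1
      refine h1.trans_tendsto (tendsto_rpow_mul_log_rpow ?_ _)
      have h2 : 0 < 1 - (2 * (betaMax β : ℝ) + 1) / (2 * (m : ℝ)) := by
        rw [sub_pos, div_lt_one (by linarith)]
        linarith
      nlinarith
    · have h1 := (isTheta_rate hlam hΘ' (-1) (-(((betaMax β : ℝ) + 1) / (m : ℝ)))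
        (((min (nMax β) q : ℕ) : ℝ) + (q : ℝ) - 2)).isBigO
      simp only [Real.rpow_neg_one] at h1
      refine h1.trans_tendsto (tendsto_rpow_mul_log_rpow ?_ _)
      have h2 : ν * ((betaMax β + 1) / m) < 1 := by
        rw [← mul_div_assoc, div_lt_one (by linarith)]
        exact hνb
      linarith
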